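/- Let $a,b,c,d\in\mathbb R\cup\{\infty\}$ and let $$f(x)=\min(2x_1,2x_2,2x_3,x_1+x_2+x_3,a+x_1,b+x_2,c+x_3,d),\qquad x\in\mathbb R^3,$$ be the tropicalization of the equation $X_1^2+X_2^2+X_3^2+X_1X_2X_3=AX_1+BX_2+CX_3+D$ whose coefficients $A,B,C,D$ have valuations $a,b,c,d$. Let the skeleton $Sk=Sk(a,b,c,d)\subset\mathbb R^3$ be the set of points $x$ at which the minimum $f(x)$ is attained by at least two of the eight terms and $f(x)=x_1+x_2+x_3$. The tropicalized Vieta involutions $$s_1(x)=(\min(2x_2,2x_3,b+x_2,c+x_3,d)-x_1,\,x_2,\,x_3),$$ $$s_2(x)=(x_1,\,\min(2x_1,2x_3,a+x_1,c+x_3,d)-x_2,\,x_3),$$ $$s_3(x)=(x_1,\,x_2,\,\min(2x_1,2x_2,a+x_1,b+x_2,d)-x_3)$$ restrict to homeomorphisms of $Sk$; let $\Gamma=\langle s_1,s_2,s_3\rangle$ be the group of homeomorphisms of $Sk$ which they generate. Let $r_1(z)=2-\bar z$, $r_2(z)=\bar z/(2\bar z-1)$, $r_3(z)=-\bar z$ be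 the reflections in the sides of the ideal triangle with vertices $0,1,\infty$ in the upper half-plane $\mathbb H^2$; they generate the $(\infty,\infty,\infty)$-triangle group $\langle r_1,r_2,r_3\rangle$, which also acts on the ideal boundary $\partial\mathbb H^2=\mathbb R\cup\{\infty\}$. Then $\Gamma$ is the free product of the three groups $\{1,s_i\}$ of order two, there is a group isomorphism $\Gamma\to\langle r_1,r_2,r_3\rangle$ with $s_i\mapsto r_i$, and the following hold, where equivariance is understood with respect to this isomorphism. (a) Suppose $\min(a,b,c,d)<0$. Put $(a_1,a_2,a_3)=(a,b,c)$, $Q_i=\{x\in Sk: x_1+x_2+x_3=2x_i\}$ and $L_i=\{x\in Sk: x_1+x_2+x_3=a_i+x_i\}$. There is exactly one triple $(D_1,D_2,D_3)$ of pairwise disjoint subsets of $Sk$ such that, for each $i$, the set $D_i$ is a topological open half-plane of $Sk$ (some homeomorphism $Sk\to\mathbb R^2$ carries $D_i$ onto an open half-plane), $s_i(D_i)=Sk\setminus\overline{D_i}$, $\partial D_i$ is the fixed set of $s_i$ in $Sk$, and $\operatorname{int}(Q_i)\subset D_i\subset Q_i\cup L_i$ (closures, boundaries and interiors in $Sk$).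 It is a ping-pong structure for $s_1,s_2,s_3$: the $D_i$ are open and disjoint, $s_j(D_i)\subset D_j$ for $i\neq j$, $s_i$ fixes $\partial D_i$ pointwise, and $s_i(D_i)=Sk\setminus\overline{D_i}$. The ping-pong table $$D_0=\Bigl(Sk\setminus\bigcup_i\overline{D_i}\Bigr)\cup\bigcup_i\Bigl(\partial D_i\setminus\bigcup_{j\ne i}\overline{D_j}\Bigr)$$ has nonempty interior. Its orbit $U=\Gamma.D_0$ is open and dense in $Sk$, and $Sk\setminus U$ is a countable union of rays (images of $[0,\infty)$ under injective affine maps). There is an equivariant homeomorphism $U\to\mathbb H^2$. (b) Suppose $\min(a,b,c,d)\ge 0$. Then $Sk$ is isomorphic to $Sk(\infty,\infty,\infty,\infty)$ as a $\Gamma$-space: there is a homeomorphism between them that intertwines the two actions, matching the respective involutions $s_1,s_2,s_3$. The action of $\Gamma$ preserves $Sk\setminus\{0\}$ and induces an action by homeomorphisms on the radial projection $(Sk\setminus\{0\})/\mathbb R_{>0}$ (points of $Sk\setminus\{0\}$ that are positive multiples of each other are identified; quotient topology), and there is an equivariant homeomorphism from $(Sk\setminus\{0\})/\mathbb R_{>0}$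 to $\partial\mathbb H^2$. -/

import Mathlib

open Set Topology UpperHalfPlane
open scoped MatrixGroups

noncomputable section

/-! ### Tropicalization and the skeleton

The parameters `a b c d` are the valuations of the coefficients `A, B, C, D` of the cubic surface
`X₁² + X₂² + X₃² + X₁X₂X₃ = A X₁ + B X₂ + C X₃ + D`; they are arbitrary elements of `ℝ ∪ {∞}`.
Coordinates are indexed by `Fin 3 = {0, 1, 2}`. -/

/-- The eight tropical monomials of the defining equation. -/
def tropMonomial (a b c d : WithTop ℝ) (x : Fin 3 → ℝ) : Fin 8 → WithTop ℝ :=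
  ![((2 * x 0 : ℝ) : WithTop ℝ), ((2 * x 1 : ℝ) : WithTop ℝ), ((2 * x 2 : ℝ) : WithTop ℝ),
    ((x 0 + x 1 + x 2 : ℝ) : WithTop ℝ),
    a + (x 0 : WithTop ℝ), b + (x 1 : WithTop ℝ), c + (x 2 : WithTop ℝ), d]

/-- The tropical polynomial: the minimum of the tropical monomials. -/
def tropPoly (a b c d : WithTop ℝ) (x : Fin 3 → ℝ) : WithTop ℝ :=
  Finset.univ.inf (tropMonomial a b c d x)

/-- The tropical surface: the points where the minimum is attained by at least two monomials. -/
def tropSurface (a b c d : WithTop ℝ) : Set (Fin 3 → ℝ) :=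
  {x | ∃ i j, i ≠ j ∧ tropMonomial a b c d x i = tropPoly a b c d x ∧
    tropMonomial a b c d x j = tropPoly a b c d x}

/-- The skeleton `Sk(a,b,c,d)`, with the topology induced from `ℝ³`. -/
def Sk (a b c d : WithTop ℝ) : Set (Fin 3 → ℝ) :=
  {x | x ∈ tropSurface a b c d ∧
    ((x 0 + x 1 + x 2 : ℝ) : WithTop ℝ) = tropPoly a b c d x}

/-! ### Tropicalized Vieta involutions -/

/-- The real number `min (2y, 2z, p + y, q + z, r)`. It is finite since `2y` is, so the default
value of `untopD` is never used. -/
def pairMin (p q r : WithTop ℝ) (y z : ℝ) : ℝ :=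
  (min ((2 * y : ℝ) : WithTop ℝ) (min ((2 * z : ℝ) : WithTop ℝ)
    (min (p + (y : WithTop ℝ)) (min (q + (z : WithTop ℝ)) r)))).untopD 0

/-- The tropicalized Vieta involutions of `ℝ³`. -/
def tropVieta (a b c d : WithTop ℝ) (i : Fin 3) (x : Fin 3 → ℝ) : Fin 3 → ℝ :=
  match i with
  | 0 => ![pairMin b c d (x 1) (x 2) - x 0, x 1, x 2]
  | 1 => ![x 0, pairMin a c d (x 0) (x 2) - x 1, x 2]
  | 2 => ![x 0, x 1, pairMin a b d (x 0) (x 1) - x 2]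

theorem coe_pairMin (p q r : WithTop ℝ) (y z : ℝ) :
    ((pairMin p q r y z : ℝ) : WithTop ℝ) =
      min ((2 * y : ℝ) : WithTop ℝ) (min ((2 * z : ℝ) : WithTop ℝ)
        (min (p + (y : WithTop ℝ)) (min (q + (z : WithTop ℝ)) r))) := by
  unfold pairMin
  have h : min ((2 * y : ℝ) : WithTop ℝ) (min ((2 * z : ℝ) : WithTop ℝ)
      (min (p + (y : WithTop ℝ)) (min (q + (z : WithTop ℝ)) r))) ≠ ⊤ :=
    ne_top_of_le_ne_top (WithTop.coe_ne_top (a := 2 * y)) (min_le_left _ _)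
  lift min ((2 * y : ℝ) : WithTop ℝ) (min ((2 * z : ℝ) : WithTop ℝ)
      (min (p + (y : WithTop ℝ)) (min (q + (z : WithTop ℝ)) r))) to ℝ using h with m
  rfl

theorem continuous_pairMin (p q r : WithTop ℝ) :
    Continuous fun v : ℝ × ℝ => pairMin p q r v.1 v.2 := by
  have key : ∀ f : ℝ × ℝ → ℝ, Continuous f →
      (∀ v : ℝ × ℝ, ((f v : ℝ) : WithTop ℝ) = ((pairMin p q r v.1 v.2 : ℝ) : WithTop ℝ)) →
      Continuous fun v : ℝ × ℝ => pairMin p q r v.1 v.2 := by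
    intro f hf h
    have : (fun v : ℝ × ℝ => pairMin p q r v.1 v.2) = f :=
      funext fun v => (WithTop.coe_injective (h v)).symm
    rw [this]; exact hf
  simp only [coe_pairMin] at key
  induction p using WithTop.recTopCoe <;> induction q using WithTop.recTopCoe <;>
    induction r using WithTop.recTopCoe
  · exact key (fun v => min (2 * v.1) (2 * v.2)) (by fun_prop) (by simp)
  · rename_i r
    exact key (fun v => min (2 * v.1) (min (2 * v.2) r)) (by fun_prop) (by simp)
  · rename_i q
    exact key (fun v => min (2 * v.1) (min (2 * v.2) (q + v.2))) (by fun_prop) (by simp)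
  · rename_i q r
    exact key (fun v => min (2 * v.1) (min (2 * v.2) (min (q + v.2) r))) (by fun_prop) (by simp)
  · rename_i p
    exact key (fun v => min (2 * v.1) (min (2 * v.2) (p + v.1))) (by fun_prop) (by simp)
  · rename_i p r
    exact key (fun v => min (2 * v.1) (min (2 * v.2) (min (p + v.1) r))) (by fun_prop) (by simp)
  · rename_i p q
    exact key (fun v => min (2 * v.1) (min (2 * v.2) (min (p + v.1) (q + v.2))))
      (by fun_prop) (by simp)
  · rename_i p q r
    exact key (fun v => min (2 * v.1) (min (2 * v.2) (min (p + v.1) (min (q + v.2) r))))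
      (by fun_prop) (by simp)

theorem tropPoly_eq (a b c d : WithTop ℝ) (x : Fin 3 → ℝ) :
    tropPoly a b c d x =
      min ((x 0 + x 1 + x 2 : ℝ) : WithTop ℝ) (min ((2 * x 0 : ℝ) : WithTop ℝ)
        (min ((2 * x 1 : ℝ) : WithTop ℝ) (min ((2 * x 2 : ℝ) : WithTop ℝ)
          (min (a + (x 0 : WithTop ℝ)) (min (b + (x 1 : WithTop ℝ))
            (min (c + (x 2 : WithTop ℝ)) d)))))) := by
  apply eq_of_forall_le_iff
  intro t
  simp only [tropPoly, Finset.le_inf_iff, Finset.mem_univ, true_imp_iff, le_min_iff]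
  constructor
  · intro h
    exact ⟨h 3, h 0, h 1, h 2, h 4, h 5, h 6, h 7⟩
  · rintro ⟨h3, h0, h1, h2, h4, h5, h6, h7⟩ i
    fin_cases i <;> assumption

/-- The skeleton is the locus where `x₁ + x₂ + x₃` equals the minimum of the other monomials. -/
theorem mem_Sk_iff (a b c d : WithTop ℝ) (x : Fin 3 → ℝ) :
    x ∈ Sk a b c d ↔ ((x 0 + x 1 + x 2 : ℝ) : WithTop ℝ) =
      min ((2 * x 0 : ℝ) : WithTop ℝ) (min ((2 * x 1 : ℝ) : WithTop ℝ)
        (min ((2 * x 2 : ℝ) : WithTop ℝ) (min (a + (x 0 : WithTop ℝ))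
          (min (b + (x 1 : WithTop ℝ)) (min (c + (x 2 : WithTop ℝ)) d))))) := by
  have hp := tropPoly_eq a b c d x
  constructor
  · rintro ⟨⟨i, j, hij, hi, hj⟩, hS⟩
    have main : ∀ k : Fin 8, k ≠ 3 → tropMonomial a b c d x k = tropPoly a b c d x →
        ((x 0 + x 1 + x 2 : ℝ) : WithTop ℝ) =
      min ((2 * x 0 : ℝ) : WithTop ℝ) (min ((2 * x 1 : ℝ) : WithTop ℝ)
        (min ((2 * x 2 : ℝ) : WithTop ℝ) (min (a + (x 0 : WithTop ℝ))
          (min (b + (x 1 : WithTop ℝ)) (min (c + (x 2 : WithTop ℝ)) d))))) := by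
      intro k hk hkp
      rw [← hS] at hkp hp
      refine le_antisymm ?_ ?_
      · rw [hp]; exact min_le_right _ _
      · rw [← hkp]
        fin_cases k
        · exact min_le_left _ _
        · exact (min_le_right _ _).trans (min_le_left _ _)
        · exact (min_le_right _ _).trans ((min_le_right _ _).trans (min_le_left _ _))
        · exact absurd rfl hk
        · exact (min_le_right _ _).trans ((min_le_right _ _).trans
            ((min_le_right _ _).trans (min_le_left _ _)))
        · exact (min_le_right _ _).trans ((min_le_right _ _).trans
            ((min_le_right _ _).trans ((min_le_right _ _).trans (min_le_left _ _))))
        · exact (min_le_right _ _).trans ((min_le_right _ _).trans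
            ((min_le_right _ _).trans ((min_le_right _ _).trans
              ((min_le_right _ _).trans (min_le_left _ _)))))
        · exact (min_le_right _ _).trans ((min_le_right _ _).trans
            ((min_le_right _ _).trans ((min_le_right _ _).trans
              ((min_le_right _ _).trans (min_le_right _ _)))))
    by_cases h3 : i = 3
    · exact main j (fun h => hij (h3.trans h.symm)) hj
    · exact main i h3 hi
  · intro h
    have hS : ((x 0 + x 1 + x 2 : ℝ) : WithTop ℝ) = tropPoly a b c d x := by
      rw [hp, ← h, min_self]
    refine ⟨?_, hS⟩
    have h3 : tropMonomial a b c d x 3 = tropPoly a b c d x := hS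
    rw [hS] at h
    rcases min_choice ((2 * x 0 : ℝ) : WithTop ℝ) (min ((2 * x 1 : ℝ) : WithTop ℝ)
        (min ((2 * x 2 : ℝ) : WithTop ℝ) (min (a + (x 0 : WithTop ℝ))
          (min (b + (x 1 : WithTop ℝ)) (min (c + (x 2 : WithTop ℝ)) d))))) with e | e <;>
      rw [e] at h
    · exact ⟨0, 3, by decide, h.symm, h3⟩
    rcases min_choice ((2 * x 1 : ℝ) : WithTop ℝ)
        (min ((2 * x 2 : ℝ) : WithTop ℝ) (min (a + (x 0 : WithTop ℝ))
          (min (b + (x 1 : WithTop ℝ)) (min (c + (x 2 : WithTop ℝ)) d)))) with e | e <;>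
      rw [e] at h
    · exact ⟨1, 3, by decide, h.symm, h3⟩
    rcases min_choice ((2 * x 2 : ℝ) : WithTop ℝ) (min (a + (x 0 : WithTop ℝ))
          (min (b + (x 1 : WithTop ℝ)) (min (c + (x 2 : WithTop ℝ)) d))) with e | e <;>
      rw [e] at h
    · exact ⟨2, 3, by decide, h.symm, h3⟩
    rcases min_choice (a + (x 0 : WithTop ℝ))
          (min (b + (x 1 : WithTop ℝ)) (min (c + (x 2 : WithTop ℝ)) d)) with e | e <;>
      rw [e] at h
    · exact ⟨4, 3, by decide, h.symm, h3⟩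
    rcases min_choice (b + (x 1 : WithTop ℝ)) (min (c + (x 2 : WithTop ℝ)) d) with e | e <;>
      rw [e] at h
    · exact ⟨5, 3, by decide, h.symm, h3⟩
    rcases min_choice (c + (x 2 : WithTop ℝ)) d with e | e <;> rw [e] at h
    · exact ⟨6, 3, by decide, h.symm, h3⟩
    · exact ⟨7, 3, by decide, h.symm, h3⟩

/-- The computation behind the invariance of the skeleton. -/
theorem flip_eq (a : WithTop ℝ) (x s m : ℝ)
    (h : ((x + s : ℝ) : WithTop ℝ) = min ((2 * x : ℝ) : WithTop ℝ) (min (a + (x : WithTop ℝ)) m)) :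
    ((m - x + s : ℝ) : WithTop ℝ) =
      min ((2 * (m - x) : ℝ) : WithTop ℝ) (min (a + ((m - x : ℝ) : WithTop ℝ)) m) := by
  induction a using WithTop.recTopCoe with
  | top =>
    simp only [top_add, min_top_left] at h ⊢
    norm_cast at h ⊢
    rcases min_cases (2 * x) m with h1 | h1 <;>
      rcases min_cases (2 * (m - x)) m with h2 | h2 <;> linarith
  | coe a =>
    norm_cast at h ⊢
    rcases min_cases (2 * x) (min (a + x) m) with h1 | h1 <;>
      rcases min_cases (a + x) m with h3 | h3 <;>
      rcases min_cases (2 * (m - x)) (min (a + (m - x)) m) with h2 | h2 <;>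
      rcases min_cases (a + (m - x)) m with h4 | h4 <;> linarith

theorem mem_Sk_iff_zero (a b c d : WithTop ℝ) (x : Fin 3 → ℝ) :
    x ∈ Sk a b c d ↔ ((x 0 + (x 1 + x 2) : ℝ) : WithTop ℝ) =
      min ((2 * x 0 : ℝ) : WithTop ℝ)
        (min (a + (x 0 : WithTop ℝ)) (pairMin b c d (x 1) (x 2) : ℝ)) := by
  rw [mem_Sk_iff, coe_pairMin, ← add_assoc]
  ac_nf

theorem mem_Sk_iff_one (a b c d : WithTop ℝ) (x : Fin 3 → ℝ) :
    x ∈ Sk a b c d ↔ ((x 1 + (x 0 + x 2) : ℝ) : WithTop ℝ) =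
      min ((2 * x 1 : ℝ) : WithTop ℝ)
        (min (b + (x 1 : WithTop ℝ)) (pairMin a c d (x 0) (x 2) : ℝ)) := by
  rw [mem_Sk_iff, coe_pairMin, show x 1 + (x 0 + x 2) = x 0 + x 1 + x 2 by ring]
  ac_nf

theorem mem_Sk_iff_two (a b c d : WithTop ℝ) (x : Fin 3 → ℝ) :
    x ∈ Sk a b c d ↔ ((x 2 + (x 0 + x 1) : ℝ) : WithTop ℝ) =
      min ((2 * x 2 : ℝ) : WithTop ℝ)
        (min (c + (x 2 : WithTop ℝ)) (pairMin a b d (x 0) (x 1) : ℝ)) := by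
  rw [mem_Sk_iff, coe_pairMin, show x 2 + (x 0 + x 1) = x 0 + x 1 + x 2 by ring]
  ac_nf

/-- The skeleton is invariant under the tropicalized Vieta involutions. -/
theorem tropVieta_mem (a b c d : WithTop ℝ) (i : Fin 3) (x : Fin 3 → ℝ) (hx : x ∈ Sk a b c d) :
    tropVieta a b c d i x ∈ Sk a b c d := by
  fin_cases i
  · rw [mem_Sk_iff_zero] at hx ⊢
    exact flip_eq _ _ _ _ hx
  · rw [mem_Sk_iff_one] at hx ⊢
    exact flip_eq _ _ _ _ hx
  · rw [mem_Sk_iff_two] at hx ⊢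
    exact flip_eq _ _ _ _ hx

theorem tropVieta_tropVieta (a b c d : WithTop ℝ) (i : Fin 3) (x : Fin 3 → ℝ) :
    tropVieta a b c d i (tropVieta a b c d i x) = x := by
  fin_cases i <;> ext j <;> fin_cases j <;> simp [tropVieta]

theorem continuous_tropVieta (a b c d : WithTop ℝ) (i : Fin 3) :
    Continuous (tropVieta a b c d i) := by
  have h0 := (continuous_pairMin b c d).comp
    (show Continuous fun x : Fin 3 → ℝ => (x 1, x 2) by fun_prop)
  have h1 := (continuous_pairMin a c d).comp
    (show Continuous fun x : Fin 3 → ℝ => (x 0, x 2) by fun_prop)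
  have h2 := (continuous_pairMin a b d).comp
    (show Continuous fun x : Fin 3 → ℝ => (x 0, x 1) by fun_prop)
  fin_cases i <;> refine continuous_pi fun j => ?_ <;> fin_cases j
  · exact h0.sub (continuous_apply 0)
  · exact continuous_apply 1
  · exact continuous_apply 2
  · exact continuous_apply 0
  · exact h1.sub (continuous_apply 1)
  · exact continuous_apply 2
  · exact continuous_apply 0
  · exact continuous_apply 1
  · exact h2.sub (continuous_apply 2)

/-- The tropicalized Vieta involutions as homeomorphisms of the skeleton. -/
def skVieta (a b c d : WithTop ℝ) (i : Fin 3) : Sk a b c d ≃ₜ Sk a b c d where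
  toFun x := ⟨tropVieta a b c d i x, tropVieta_mem a b c d i x x.2⟩
  invFun x := ⟨tropVieta a b c d i x, tropVieta_mem a b c d i x x.2⟩
  left_inv x := Subtype.ext (tropVieta_tropVieta a b c d i x)
  right_inv x := Subtype.ext (tropVieta_tropVieta a b c d i x)
  continuous_toFun :=
    ((continuous_tropVieta a b c d i).comp continuous_subtype_val).subtype_mk _
  continuous_invFun :=
    ((continuous_tropVieta a b c d i).comp continuous_subtype_val).subtype_mk _

/-- The group `Γ` of homeomorphisms of the skeleton generated by the three tropicalized Vieta
involutions. -/
def vietaGroup (a b c d : WithTop ℝ) : Subgroup (Sk a b c d ≃ₜ Sk a b c d) :=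
  Subgroup.closure (Set.range (skVieta a b c d))

/-- The generators `s₁, s₂, s₃` of `Γ`. -/
def vietaGen (a b c d : WithTop ℝ) (i : Fin 3) : vietaGroup a b c d :=
  ⟨skVieta a b c d i, Subgroup.subset_closure (Set.mem_range_self i)⟩

/-- The group `⟨σ₁, σ₂, σ₃ ∣ σ₁² = σ₂² = σ₃² = 1⟩`, the free product of three groups of order two. -/
abbrev FreeInvolutionGroup : Type :=
  PresentedGroup (Set.range fun i : Fin 3 => FreeGroup.of i ^ 2)

/-! ### Cells, ping-pong structures and the ping-pong table -/

/-- The cell of the skeleton where `x₁ + x₂ + x₃ = 2 xᵢ`. -/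
def quadCell (a b c d : WithTop ℝ) (i : Fin 3) : Set (Sk a b c d) :=
  {x | x.1 0 + x.1 1 + x.1 2 = 2 * x.1 i}

/-- The cell of the skeleton where `x₁ + x₂ + x₃ = aᵢ + xᵢ`, with `(a₁, a₂, a₃) = (a, b, c)`. -/
def linCell (a b c d : WithTop ℝ) (i : Fin 3) : Set (Sk a b c d) :=
  {x | ((x.1 0 + x.1 1 + x.1 2 : ℝ) : WithTop ℝ) = ![a, b, c] i + (x.1 i : WithTop ℝ)}

/-- The half-spaces `D₁, D₂, D₃` of the skeleton attached to the three involutions: `Dᵢ` is a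
topological open half-plane, it is mapped by `sᵢ` onto the complement of its closure, its boundary
is the fixed set of `sᵢ`, it lies in the union of the `i`-th quadratic and the `i`-th linear cell
and contains the interior of the former; and the three sets are disjoint. -/
structure IsVietaDomains (a b c d : WithTop ℝ) (D : Fin 3 → Set (Sk a b c d)) : Prop where
  halfSpace : ∀ i, ∃ φ : Sk a b c d ≃ₜ ℝ × ℝ, φ '' D i = {p | 0 < p.1}
  image : ∀ i, skVieta a b c d i '' D i = (closure (D i))ᶜ
  frontier_eq : ∀ i, frontier (D i) = {x | skVieta a b c d i x = x}
  subset_cells : ∀ i, D i ⊆ quadCell a b c d i ∪ linCell a b c d i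
  interior_subset : ∀ i, interior (quadCell a b c d i) ⊆ D i
  disjoint : ∀ i j, i ≠ j → Disjoint (D i) (D j)

/-- A ping-pong structure for three self-homeomorphisms of a topological space. -/
structure IsPingPong {X : Type*} [TopologicalSpace X] (σ : Fin 3 → X ≃ₜ X)
    (D : Fin 3 → Set X) : Prop where
  isOpen : ∀ i, IsOpen (D i)
  disjoint : ∀ i j, i ≠ j → Disjoint (D i) (D j)
  image_subset : ∀ i j, i ≠ j → σ j '' D i ⊆ D j
  fixes_frontier : ∀ i, ∀ x ∈ frontier (D i), σ i x = x
  image_eq : ∀ i, σ i '' D i = (closure (D i))ᶜ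

/-- The `i`-th ping-pong net: the boundary of `Dᵢ` minus the closures of the other two sets. -/
def pingPongNet {X : Type*} [TopologicalSpace X] (D : Fin 3 → Set X) (i : Fin 3) : Set X :=
  frontier (D i) \ ⋃ j ∈ {j : Fin 3 | j ≠ i}, closure (D j)

/-- The ping-pong table `D₀`: the complement of the closures of the `Dᵢ`, together with the nets. -/
def pingPongTable {X : Type*} [TopologicalSpace X] (D : Fin 3 → Set X) : Set X :=
  (⋃ i, closure (D i))ᶜ ∪ ⋃ i, pingPongNet D i

/-- The union `Γ.T` of the translates of a subset `T` of the skeleton. -/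
def vietaOrbit (a b c d : WithTop ℝ) (T : Set (Sk a b c d)) : Set (Sk a b c d) :=
  {y | ∃ g : vietaGroup a b c d, ∃ x ∈ T, g.1 x = y}

/-- A ray in `ℝ³`: the image of `[0, ∞)` under an injective affine map. -/
def IsRay (R : Set (Fin 3 → ℝ)) : Prop :=
  ∃ p v : Fin 3 → ℝ, v ≠ 0 ∧ R = {x | ∃ t : ℝ, 0 ≤ t ∧ x = p + t • v}

/-! ### The radial projection -/

/-- The skeleton without the origin. -/
abbrev PuncturedSk (a b c d : WithTop ℝ) : Type :=
  {x : Sk a b c d // (x : Fin 3 → ℝ) ≠ 0}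

/-- Two nonzero points of the skeleton are equivalent if they span the same ray from the origin. -/
def radialSetoid (a b c d : WithTop ℝ) : Setoid (PuncturedSk a b c d) where
  r x y := ∃ t : ℝ, 0 < t ∧ (y.1 : Fin 3 → ℝ) = t • (x.1 : Fin 3 → ℝ)
  iseqv :=
    { refl := fun x => ⟨1, one_pos, (one_smul ℝ _).symm⟩
      symm := by
        rintro x y ⟨t, ht, h⟩
        exact ⟨t⁻¹, inv_pos.mpr ht, by rw [h, inv_smul_smul₀ ht.ne']⟩
      trans := by
        rintro x y z ⟨t, ht, h⟩ ⟨u, hu, k⟩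
        exact ⟨u * t, mul_pos hu ht, by rw [k, h, mul_smul]⟩ }

/-- The radial projection `(Sk ∖ {0}) / ℝ_{>0}`, with the quotient topology. -/
abbrev Radial (a b c d : WithTop ℝ) : Type :=
  Quotient (radialSetoid a b c d)

/-! ### The `(∞,∞,∞)`-triangle group -/

/-- Matrices of determinant `-1` representing the reflections of the hyperbolic plane
`r₁(z) = 2 - z̄`, `r₂(z) = z̄ / (2 z̄ - 1)`, `r₃(z) = - z̄` in the three sides of the ideal triangle
with vertices `0, 1, ∞`. In Mathlib a matrix of negative determinant acts on the upper half-plane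
`ℍ` by `z ↦ (α z̄ + β) / (γ z̄ + δ)`, and on the ideal boundary `ℝ ∪ {∞} = OnePoint ℝ` by
`t ↦ (α t + β) / (γ t + δ)`, which is the continuous extension. -/
def triReflection : Fin 3 → GL (Fin 2) ℝ :=
  ![Matrix.GeneralLinearGroup.mkOfDetNeZero !![-1, 2; 0, 1] (by simp),
    Matrix.GeneralLinearGroup.mkOfDetNeZero !![1, 0; 2, -1] (by simp),
    Matrix.GeneralLinearGroup.mkOfDetNeZero !![-1, 0; 0, 1] (by simp)]

/-- The `(∞,∞,∞)`-triangle group `⟨r₁, r₂, r₃⟩`. -/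
def triangleGroup : Subgroup (GL (Fin 2) ℝ) :=
  Subgroup.closure (Set.range triReflection)

/-- The generators of the triangle group. -/
def triGen (i : Fin 3) : triangleGroup :=
  ⟨triReflection i, Subgroup.subset_closure (Set.mem_range_self i)⟩

end

/-! The skeleton lies in the octant x ≤ 0. With u = -x, p_i = max(-a_i, 0) and D = max(-d, 0) its
equation says that u₀ + u₁ + u₂ is the maximum of D, the 2u_i and the p_i + u_i. The involution s_i
replaces u_i by m_i - u_i, where m_i is the maximum of the terms free of u_i. So the wall function
h_i = 2u_i - m_i changes sign under s_i and vanishes exactly on its fixed set, and 2u_j ≤ m_i for j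
≠ i makes the half-spaces h_i > 0 disjoint. The reflections in the sides of the ideal triangle
behave in the same way, with h_i = -λ_i for homogeneous coordinates λ. `ReflectionAction` isolates
this common structure. Ping-pong on reduced words makes both groups free products
(`ReflectionAction.exists_freeInvolution_equiv`). An element that moves a point of the closed
chamber into the closed chamber is generated by the reflections in the walls through that point
(`ReflectionAction.mem_closure_of_apply_mem`), so a wall preserving homeomorphism of tables extends
equivariantly to their orbits (`ReflectionAction.exists_homeomorph`).

For (a), D_i is the set h_i > 0. By `exists_chart` h_i is one of two global coordinates, hence D_i
is a half-plane; uniqueness holds because a competitor is connected, has the same frontier and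
shares a point with D_i. Crossing a wall from its positive side raises the coordinate x_i ≤ 0, and
this descent brings every orbit into the closed chamber (`ReflectionAction.exists_apply_nonpos`).
What the orbit of the table misses are the translates of the corners, where two walls meet. A corner
is a ray inside quadratic cells, on which reduced words act linearly (`skVieta_of_quadCell`), and
Baire's theorem gives density. Finally the table is matched with the ideal triangle by comparing the
vectors (h_i) up to scaling: every admissible direction contains exactly one point of the table
(`tablePoint_spec`, `eq_tablePoint`, `exists_tableRadius`). The translates of the triangle fill the
hyperbolic plane by the same descent.

For (b), p = D = 0 and the skeleton is the cone of vectors one of whose entries is the sum of the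
others. The map t ↦ (|t|, 1, |t - 1|) parametrizes its rays by the ideal boundary, and the
reflections become the involutions (`exists_smul_rayVec`). -/

noncomputable section

/-! ### Reduced words and groups generated by reflections -/

/-- Words in three letters without equal neighbours, whose last letter does not lie in `Z`. -/
inductive ReducedWord (Z : Set (Fin 3)) : List (Fin 3) → Prop
  | nil : ReducedWord Z []
  | single {i : Fin 3} (hi : i ∉ Z) : ReducedWord Z [i]
  | cons {i j : Fin 3} {l : List (Fin 3)} (hij : i ≠ j) (h : ReducedWord Z (j :: l)) :
      ReducedWord Z (i :: j :: l)

theorem ReducedWord.tail {Z : Set (Fin 3)} {i : Fin 3} {l : List (Fin 3)}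
    (h : ReducedWord Z (i :: l)) : ReducedWord Z l := by
  cases h with
  | single _ => exact .nil
  | cons _ h => exact h

/-- Normal form: up to a right factor generated by the letters in `Z`, every element of a group
generated by three involutions is the product of a reduced word. -/
theorem exists_reducedWord {G : Type*} [Group G] {t : Fin 3 → G} (ht : ∀ i, t i * t i = 1)
    (hgen : Subgroup.closure (range t) = ⊤) (Z : Set (Fin 3)) (g : G) :
    ∃ w z, ReducedWord Z w ∧ z ∈ Subgroup.closure (t '' Z) ∧ g = (w.map t).prod * z := by
  have step : ∀ (i : Fin 3) (y : G),
      (∃ w z, ReducedWord Z w ∧ z ∈ Subgroup.closure (t '' Z) ∧ y = (w.map t).prod * z) →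
      ∃ w z, ReducedWord Z w ∧ z ∈ Subgroup.closure (t '' Z) ∧ t i * y = (w.map t).prod * z := by
    rintro i y ⟨w, z, hw, hz, rfl⟩
    rcases w with _ | ⟨j, l⟩
    · by_cases hi : i ∈ Z
      · exact ⟨[], t i * z, .nil,
          mul_mem (Subgroup.subset_closure (mem_image_of_mem t hi)) hz, by simp⟩
      · exact ⟨[i], z, .single hi, hz, by simp⟩
    · by_cases hij : i = j
      · subst hij
        exact ⟨l, z, hw.tail, hz, by simp [← mul_assoc, ht]⟩
      · exact ⟨i :: j :: l, z, .cons hij hw, hz, by simp [mul_assoc]⟩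
  have hg : g ∈ Subgroup.closure (range t) := hgen ▸ Subgroup.mem_top g
  induction hg using Subgroup.closure_induction_left with
  | one => exact ⟨[], 1, .nil, one_mem _, by simp⟩
  | mul_left x hx y _ ih => obtain ⟨i, rfl⟩ := hx; exact step i y ih
  | inv_mul_cancel x hx y _ ih =>
    obtain ⟨i, rfl⟩ := hx
    rw [inv_eq_of_mul_eq_one_left (ht i)]
    exact step i y ih

/-- An action of a group generated by three involutions `t i` on a space, such that the wall
functions `h i` are exchanged with their negatives, the walls `h i = 0` are fixed, and the three
half-spaces `0 < h i` are disjoint. -/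
structure ReflectionAction {G X : Type*} [Group G] [TopologicalSpace X] (t : Fin 3 → G)
    (ρ : G →* (X ≃ₜ X)) (h : Fin 3 → X → ℝ) : Prop where
  continuous_wall : ∀ i, Continuous (h i)
  closure_eq_top : Subgroup.closure (range t) = ⊤
  mul_self : ∀ i, t i * t i = 1
  wall_apply : ∀ i x, h i (ρ (t i) x) = -h i x
  fixed : ∀ i x, h i x = 0 → ρ (t i) x = x
  neg_of_pos : ∀ i j x, i ≠ j → 0 < h i x → h j x < 0

/-- The points on the nonpositive side of all walls which lie on at most one wall. -/
def wallTable {X : Type*} (h : Fin 3 → X → ℝ) : Set X :=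
  {x | (∀ i, h i x ≤ 0) ∧ ∀ i j, h i x = 0 → h j x = 0 → i = j}

/-- The union of the translates of a set under a group of homeomorphisms. -/
def translates {G X : Type*} [Group G] [TopologicalSpace X] (ρ : G →* (X ≃ₜ X)) (T : Set X) :
    Set X :=
  {y | ∃ g : G, ∃ x ∈ T, ρ g x = y}

namespace ReflectionAction

variable {G X : Type*} [Group G] [TopologicalSpace X] {t : Fin 3 → G}
  {ρ : G →* (X ≃ₜ X)} {h : Fin 3 → X → ℝ}

theorem apply_mul (g g' : G) (x : X) : ρ (g * g') x = ρ g (ρ g' x) := by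
  rw [map_mul]; rfl

theorem apply_inv_apply (g : G) (x : X) : ρ g⁻¹ (ρ g x) = x := by
  rw [← apply_mul, inv_mul_cancel, map_one]; rfl

theorem apply_apply_inv (g : G) (x : X) : ρ g (ρ g⁻¹ x) = x := by
  rw [← apply_mul, mul_inv_cancel, map_one]; rfl

theorem apply_apply (A : ReflectionAction t ρ h) (i : Fin 3) (x : X) :
    ρ (t i) (ρ (t i) x) = x := by
  rw [← apply_mul, A.mul_self, map_one]; rfl

/-- Ping-pong: the last letter sends a point of its negative side to its positive side, which lies
on the negative side of every other wall, in particular of the wall of the next letter to act. -/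
theorem wall_word_pos (A : ReflectionAction t ρ h) {Z : Set (Fin 3)} {x : X}
    (hZ : ∀ i, i ∉ Z → h i x < 0) {w : List (Fin 3)} (hw : ReducedWord Z w) :
    ∀ i l, w = i :: l → 0 < h i (ρ (w.map t).prod x) := by
  induction hw with
  | nil => intro i l hl; cases hl
  | single hi =>
    intro i l hl
    cases hl
    simpa [A.wall_apply] using hZ _ hi
  | @cons i j l hij _ ih =>
    intro i' l' hl
    cases hl
    have := A.neg_of_pos j i _ hij.symm (ih j l rfl)
    rw [List.map_cons, List.prod_cons, apply_mul, A.wall_apply]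
    linarith

theorem apply_eq_of_mem_closure (A : ReflectionAction t ρ h) {x : X} {g : G} {Z : Set (Fin 3)}
    (hZ : ∀ i ∈ Z, h i x = 0) (hg : g ∈ Subgroup.closure (t '' Z)) : ρ g x = x := by
  induction hg using Subgroup.closure_induction with
  | mem y hy =>
    obtain ⟨i, hi, rfl⟩ := hy
    exact A.fixed i x (hZ i hi)
  | one => simp
  | mul a b _ _ ha hb => rw [apply_mul, hb, ha]
  | inv a _ ha => nth_rewrite 1 [← ha]; exact apply_inv_apply a x

/-- If `g` moves a point of the closed chamber into the closed chamber, then `g` is generated by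
the reflections in the walls through that point. -/
theorem mem_closure_of_apply_mem (A : ReflectionAction t ρ h) {x : X} {g : G}
    (hx : ∀ i, h i x ≤ 0) (hgx : ∀ i, h i (ρ g x) ≤ 0) :
    g ∈ Subgroup.closure (t '' {i | h i x = 0}) := by
  obtain ⟨w, z, hw, hz, rfl⟩ := exists_reducedWord A.mul_self A.closure_eq_top {i | h i x = 0} g
  have hzx : ρ z x = x := A.apply_eq_of_mem_closure (fun i hi => hi) hz
  rcases w with _ | ⟨i, l⟩
  · simpa using hz
  · have := A.wall_word_pos (x := x) (fun i hi => lt_of_le_of_ne (hx i) hi) hw i l rfl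
    have h2 := hgx i
    rw [apply_mul, hzx] at h2
    linarith

/-- A nontrivial reduced word acting trivially would put one point into two disjoint half-spaces. -/
theorem injective (A : ReflectionAction t ρ h) (hne : ∀ i, ∃ x, 0 < h i x) :
    Function.Injective ρ := by
  rw [injective_iff_map_eq_one]
  intro g hg
  obtain ⟨w, z, hw, hz, rfl⟩ := exists_reducedWord A.mul_self A.closure_eq_top ∅ g
  have hz1 : z = 1 := by simpa using hz
  subst hz1
  rw [mul_one] at hg ⊢
  rcases w with _ | ⟨i, l⟩
  · simp
  exfalso
  -- Here k is the last letter of the word, the first to act.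
  have key : ∀ w, ReducedWord ∅ w → ∀ i l, w = i :: l → ∃ k, ∀ j x, j ≠ k → 0 < h j x →
      0 < h i (ρ (w.map t).prod x) := by
    intro w hw
    induction hw with
    | nil => intro i l hl; cases hl
    | @single i _ =>
      intro i' l hl
      cases hl
      refine ⟨i, fun j x hj hx => ?_⟩
      simpa [A.wall_apply] using A.neg_of_pos j i x hj hx
    | @cons i j l hij _ ih =>
      intro i' l' hl
      cases hl
      obtain ⟨k, hk⟩ := ih j l rfl
      refine ⟨k, fun j' x hj hx => ?_⟩
      have := A.neg_of_pos j i _ hij.symm (hk j' x hj hx)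
      rw [List.map_cons, List.prod_cons, apply_mul, A.wall_apply]
      linarith
  obtain ⟨k, hk⟩ := key _ hw i l rfl
  -- A letter avoiding both the first and the last letter of the word exists because there are three
  -- of them.
  obtain ⟨j, hjk, hji⟩ : ∃ j : Fin 3, j ≠ k ∧ j ≠ i := by
    clear hk hg hw
    revert i k; decide
  obtain ⟨x, hx⟩ := hne j
  have h1 := hk j x hjk hx
  rw [hg] at h1
  have h2 := A.neg_of_pos i j x hji.symm h1
  linarith

/-- The closed chamber is a strict fundamental domain: each orbit meets it in at most one point. -/
theorem apply_mem_table_iff (A : ReflectionAction t ρ h) {x : X} {g : G}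
    (hx : ∀ i, h i x ≤ 0) (hgx : ∀ i, h i (ρ g x) ≤ 0) : ρ g x = x :=
  A.apply_eq_of_mem_closure (fun _ hi => hi) (A.mem_closure_of_apply_mem hx hgx)

theorem apply_mem_translates {T : Set X} (g : G) {y : X} (hy : y ∈ translates ρ T) :
    ρ g y ∈ translates ρ T := by
  obtain ⟨g', x, hx, rfl⟩ := hy
  exact ⟨g * g', x, hx, by rw [apply_mul]⟩

theorem mem_translates_of_apply {T : Set X} (g : G) {y : X} (hy : ρ g y ∈ translates ρ T) :
    y ∈ translates ρ T := by
  simpa [apply_inv_apply] using apply_mem_translates g⁻¹ hy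

/-- The open set swept out by the open chamber, its `i`-th face and its `i`-th mirror image. -/
def gallery (t : Fin 3 → G) (ρ : G →* (X ≃ₜ X)) (h : Fin 3 → X → ℝ) (i : Fin 3) : Set X :=
  {x | ∀ j, j ≠ i → h j x < 0 ∧ h j (ρ (t i) x) < 0}

theorem isOpen_gallery (A : ReflectionAction t ρ h) (i : Fin 3) : IsOpen (gallery t ρ h i) := by
  have : gallery t ρ h i = ⋂ j, ⋂ (_ : j ≠ i), ({x | h j x < 0} ∩ {x | h j (ρ (t i) x) < 0}) := by
    ext x; simp [gallery]
  rw [this]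
  refine isOpen_iInter_of_finite fun j => isOpen_iInter_of_finite fun _ => ?_
  exact (isOpen_lt (A.continuous_wall j) continuous_const).inter
    (isOpen_lt ((A.continuous_wall j).comp (ρ (t i)).continuous) continuous_const)

theorem mem_gallery_of_mem_table (A : ReflectionAction t ρ h) {x : X} (hx : x ∈ wallTable h) :
    ∃ i, x ∈ gallery t ρ h i := by
  obtain ⟨i, hi⟩ : ∃ i, ∀ j, j ≠ i → h j x < 0 := by
    by_cases hz : ∃ i, h i x = 0
    · obtain ⟨i, hi⟩ := hz
      exact ⟨i, fun j hj => lt_of_le_of_ne (hx.1 j) fun h0 => hj (hx.2 _ _ h0 hi)⟩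
    · push Not at hz
      -- Off all walls any index serves.
      exact ⟨0, fun j _ => lt_of_le_of_ne (hx.1 j) (hz j)⟩
  refine ⟨i, fun j hj => ⟨hi j hj, ?_⟩⟩
  rcases (hx.1 i).lt_or_eq with h1 | h1
  · exact A.neg_of_pos i j _ hj.symm (by rw [A.wall_apply]; linarith)
  · rw [A.fixed i x h1]; exact hi j hj

theorem mem_table_of_mem_gallery {Y : Type*} {h : Fin 3 → Y → ℝ} {i : Fin 3} {x : Y}
    (hx : ∀ j, j ≠ i → h j x < 0) (hi : h i x ≤ 0) : x ∈ wallTable h := by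
  refine ⟨fun j => ?_, fun j k hj hk => ?_⟩
  · by_cases hji : j = i
    · exact hji ▸ hi
    · exact (hx j hji).le
  · by_contra hjk
    by_cases hji : j = i
    · exact (hx k (fun hki => hjk (hji.trans hki.symm))).ne hk
    · exact (hx j hji).ne hj

theorem gallery_subset (A : ReflectionAction t ρ h) (i : Fin 3) :
    gallery t ρ h i ⊆ translates ρ (wallTable h) := by
  intro x hx
  rcases le_total (h i x) 0 with h1 | h1
  · exact ⟨1, x, mem_table_of_mem_gallery (fun j hj => (hx j hj).1) h1, by simp⟩
  · exact ⟨t i, ρ (t i) x, mem_table_of_mem_gallery (fun j hj => (hx j hj).2)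
      (by rw [A.wall_apply]; linarith), A.apply_apply i x⟩

/-- The table is not open, but each of its points lies in a gallery, which is open and covered by
the table and one mirror image. -/
theorem isOpen_translates (A : ReflectionAction t ρ h) :
    IsOpen (translates ρ (wallTable h)) := by
  have : translates ρ (wallTable h) = ⋃ g : G, ⋃ i, (ρ g⁻¹) ⁻¹' gallery t ρ h i := by
    ext y
    simp only [mem_iUnion, mem_preimage]
    constructor
    · rintro ⟨g, x, hx, rfl⟩
      obtain ⟨i, hi⟩ := A.mem_gallery_of_mem_table hx
      exact ⟨g, i, by rwa [apply_inv_apply]⟩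
    · rintro ⟨g, i, hi⟩
      exact mem_translates_of_apply g⁻¹ (A.gallery_subset i hi)
  rw [this]
  exact isOpen_iUnion fun g => isOpen_iUnion fun i =>
    (A.isOpen_gallery i).preimage (ρ g⁻¹).continuous

/-- A translate of a point of a set, as a point of the union of the translates. -/
def translate (ρ : G →* (X ≃ₜ X)) {T : Set X} (g : G) (x : T) : translates ρ T :=
  ⟨ρ g x, g, x, x.2, rfl⟩

theorem exists_eq_translate {T : Set X} (y : translates ρ T) : ∃ g x, y = translate ρ g x := by
  obtain ⟨y, g, x, hx, rfl⟩ := y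
  exact ⟨g, ⟨x, hx⟩, rfl⟩

variable {X' : Type*} [TopologicalSpace X'] {ρ' : G →* (X' ≃ₜ X')} {h' : Fin 3 → X' → ℝ}

/-- Well-definedness of the equivariant extension: two representations of a point differ by
reflections in walls through it, and these walls also contain the image under k. -/
theorem translate_eq_of_translate_eq (A : ReflectionAction t ρ h) (A' : ReflectionAction t ρ' h')
    {k : wallTable h → wallTable h'} (hz : ∀ x i, h i x.1 = 0 → h' i (k x).1 = 0)
    {g₁ g₂ : G} {x₁ x₂ : wallTable h} (he : translate ρ g₁ x₁ = translate ρ g₂ x₂) :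
    translate ρ' g₁ (k x₁) = translate ρ' g₂ (k x₂) := by
  have he : ρ g₁ x₁ = ρ g₂ x₂ := congrArg Subtype.val he
  have h1 : ρ (g₂⁻¹ * g₁) x₁ = x₂ := by rw [apply_mul, he, apply_inv_apply]
  have hm := A.mem_closure_of_apply_mem x₁.2.1 (g := g₂⁻¹ * g₁) (by rw [h1]; exact x₂.2.1)
  have h2 : ρ (g₂⁻¹ * g₁) x₁ = x₁ := A.apply_eq_of_mem_closure (fun _ hi => hi) hm
  have hx : x₁ = x₂ := Subtype.ext (h2.symm.trans h1)
  subst hx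
  have h3 : ρ' (g₂⁻¹ * g₁) (k x₁) = k x₁ :=
    A'.apply_eq_of_mem_closure (fun i hi => hz x₁ i hi) hm
  apply Subtype.ext
  change ρ' g₁ (k x₁) = ρ' g₂ (k x₁)
  rw [apply_mul] at h3
  nth_rewrite 2 [← h3]
  rw [apply_apply_inv]

/-- A continuous map between the tables of two reflection actions which respects the walls extends
equivariantly and continuously to the unions of the translates of the tables. -/
theorem exists_extension (A : ReflectionAction t ρ h) (A' : ReflectionAction t ρ' h')
    (k : wallTable h → wallTable h') (hk : Continuous k)
    (hz : ∀ x i, h i x.1 = 0 → h' i (k x).1 = 0) :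
    ∃ K : translates ρ (wallTable h) → translates ρ' (wallTable h'), Continuous K ∧
      ∀ g x, K (translate ρ g x) = translate ρ' g (k x) := by
  choose γ ξ hγ using fun y : translates ρ (wallTable h) => exists_eq_translate y
  let K := fun y => translate ρ' (γ y) (k (ξ y))
  have hK : ∀ g x, K (translate ρ g x) = translate ρ' g (k x) := fun g x =>
    A.translate_eq_of_translate_eq A' hz (hγ (translate ρ g x)).symm
  refine ⟨K, ?_, hK⟩
  rw [continuous_iff_continuousAt]
  intro y₀
  obtain ⟨g, x₀, rfl⟩ := exists_eq_translate y₀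
  obtain ⟨i, hi⟩ := A.mem_gallery_of_mem_table x₀.2
  set V := gallery t ρ h i with hV
  -- Continuity is checked on one gallery: fold it onto the table along the i-th wall, apply k, and
  -- unfold. Both branches agree on the wall because the reflections fix it.
  have hfold : ∀ v : V, (if h i v.1 ≤ 0 then v.1 else ρ (t i) v.1) ∈ wallTable h := by
    intro v
    split_ifs with hle
    · exact mem_table_of_mem_gallery (fun j hj => (v.2 j hj).1) hle
    · exact mem_table_of_mem_gallery (fun j hj => (v.2 j hj).2)
        (by rw [A.wall_apply]; linarith)
  let fold : V → wallTable h := fun v => ⟨_, hfold v⟩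
  have hwc : Continuous fun v : V => h i v.1 := (A.continuous_wall i).comp continuous_subtype_val
  have hfc : Continuous fold := by
    refine Continuous.subtype_mk ?_ _
    exact Continuous.if_le continuous_subtype_val
      ((ρ (t i)).continuous.comp continuous_subtype_val) hwc continuous_const
      fun v hv => (A.fixed i _ hv).symm
  have hkc : Continuous fun v : V => (k (fold v)).1 :=
    continuous_subtype_val.comp (hk.comp hfc)
  let F : V → X' := fun v => if h i v.1 ≤ 0 then (k (fold v)).1 else ρ' (t i) (k (fold v)).1
  have hF : Continuous F := by
    refine Continuous.if_le hkc ((ρ' (t i)).continuous.comp hkc) hwc continuous_const ?_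
    intro v hv
    refine (A'.fixed i _ (hz _ i ?_)).symm
    change h i (if h i v.1 ≤ 0 then v.1 else ρ (t i) v.1) = 0
    rw [if_pos hv.le, hv]
  let O : Set (translates ρ (wallTable h)) := {y | ρ g⁻¹ y.1 ∈ V}
  have hO : IsOpen O := (A.isOpen_gallery i).preimage
    ((ρ g⁻¹).continuous.comp continuous_subtype_val)
  have hx₀ : translate ρ g x₀ ∈ O := by
    change ρ g⁻¹ (ρ g x₀) ∈ V
    rwa [apply_inv_apply]
  have hform : ∀ y : O, (K y.1).1 = ρ' g (F ⟨ρ g⁻¹ y.1.1, y.2⟩) := by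
    intro y
    set v : V := ⟨ρ g⁻¹ y.1.1, y.2⟩
    by_cases hle : h i v.1 ≤ 0
    · have hfv : ((fold v : wallTable h) : X) = v.1 := if_pos hle
      have : y.1 = translate ρ g (fold v) := by
        apply Subtype.ext
        change y.1.1 = ρ g (fold v).1
        rw [hfv]; exact (apply_apply_inv g _).symm
      rw [this, hK]
      change ρ' g _ = ρ' g (F v)
      simp only [F, if_pos hle]
    · have hfv : ((fold v : wallTable h) : X) = ρ (t i) v.1 := if_neg hle
      have : y.1 = translate ρ (g * t i) (fold v) := by
        apply Subtype.ext
        change y.1.1 = ρ (g * t i) (fold v).1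
        rw [hfv, apply_mul, A.apply_apply]; exact (apply_apply_inv g _).symm
      rw [this, hK]
      change ρ' (g * t i) _ = ρ' g (F v)
      simp only [F, if_neg hle]
      rw [apply_mul]
  have hcont : ContinuousOn (fun y => (K y).1) O := by
    rw [continuousOn_iff_continuous_domRestrict]
    have : O.domRestrict (fun y => (K y).1) =
        fun y : O => ρ' g (F ⟨ρ g⁻¹ y.1.1, y.2⟩) := funext hform
    rw [this]
    refine (ρ' g).continuous.comp (hF.comp (Continuous.subtype_mk ?_ _))
    exact (ρ g⁻¹).continuous.comp (continuous_subtype_val.comp continuous_subtype_val)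
  exact Topology.IsInducing.subtypeVal.continuousAt_iff.2 (hcont.continuousAt (hO.mem_nhds hx₀))

/-- A wall preserving homeomorphism between the tables of two reflection actions extends to an
equivariant homeomorphism between the unions of the translates of the tables. -/
theorem exists_homeomorph (A : ReflectionAction t ρ h) (A' : ReflectionAction t ρ' h')
    (k : wallTable h ≃ₜ wallTable h') (hz : ∀ x i, h i x.1 = 0 ↔ h' i (k x).1 = 0) :
    ∃ K : translates ρ (wallTable h) ≃ₜ translates ρ' (wallTable h'),
      ∀ g x, ((K ⟨ρ g x.1, apply_mem_translates g x.2⟩ : translates ρ' (wallTable h')) : X') =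
        ρ' g (K x).1 := by
  obtain ⟨K, hKc, hK⟩ := A.exists_extension A' k k.continuous fun x i => (hz x i).1
  obtain ⟨L, hLc, hL⟩ := A'.exists_extension A k.symm k.symm.continuous fun x i hx => by
    rw [hz]; simpa using hx
  refine ⟨⟨⟨K, L, fun y => ?_, fun y => ?_⟩, hKc, hLc⟩, fun g y => ?_⟩
  · obtain ⟨g, x, rfl⟩ := exists_eq_translate y
    rw [hK, hL, k.symm_apply_apply]
  · obtain ⟨g, x, rfl⟩ := exists_eq_translate y
    rw [hL, hK, k.apply_symm_apply]
  · obtain ⟨g', x, rfl⟩ := exists_eq_translate y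
    have : (⟨ρ g (translate ρ g' x).1, apply_mem_translates g (translate ρ g' x).2⟩ :
        translates ρ (wallTable h)) = translate ρ (g * g') x := by
      apply Subtype.ext
      change ρ g (ρ g' x) = ρ (g * g') x
      rw [apply_mul]
    change (K _).1 = ρ' g (K _).1
    rw [this, hK, hK]
    change ρ' (g * g') _ = ρ' g (ρ' g' _)
    rw [apply_mul]

end ReflectionAction

end

/-! ### Descent to the closed chamber, and continuous roots of monotone functions. -/

noncomputable section

open Filter in
/-- Descent: if crossing a wall from its positive side increases one of three bounded coordinates,
and the coordinates satisfy mild nondegeneracy conditions, then every orbit meets the closed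
chamber. -/
theorem ReflectionAction.exists_apply_nonpos {G X : Type*} [Group G] [TopologicalSpace X]
    {t : Fin 3 → G} {ρ : G →* (X ≃ₜ X)} {h : Fin 3 → X → ℝ} (A : ReflectionAction t ρ h)
    (c : Fin 3 → X → ℝ) (hc : ∀ i, Continuous (c i)) (hb : ∀ i x, c i x ≤ 0)
    (hlim : ∀ (x : ℕ → X) (L : Fin 3 → ℝ), (∀ i, Tendsto (fun n => c i (x n)) atTop (𝓝 (L i))) →
      ∃ y, Tendsto x atTop (𝓝 y))
    (hstep : ∀ i x, c i (ρ (t i) x) = c i x + h i x)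
    (hstep' : ∀ i j x, j ≠ i → c j (ρ (t i) x) = c j x)
    (hpos : ∀ i j x, j ≠ i → 0 < h i x → c j x ≠ 0)
    (hcorner : ∀ i j k x, i ≠ j → k ≠ i → k ≠ j → h i x = 0 → h j x = 0 → c k x = 0)
    (hne : ∀ x, ∃ i, h i x ≠ 0) (x : X) : ∃ g, ∀ i, h i (ρ g x) ≤ 0 := by
  -- If the orbit avoids the closed chamber, there is always a further wall to cross from its
  -- positive side, which yields an infinite path y with letters κ.
  by_contra! hcon
  choose ι hι using hcon
  let γ : ℕ → G := fun n => Nat.rec 1 (fun _ g => t (ι g) * g) n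
  have hγ : ∀ n, γ (n + 1) = t (ι (γ n)) * γ n := fun n => rfl
  let y : ℕ → X := fun n => ρ (γ n) x
  let κ : ℕ → Fin 3 := fun n => ι (γ n)
  have hy : ∀ n, y (n + 1) = ρ (t (κ n)) (y n) := fun n => by
    simp only [y, κ, hγ, apply_mul]
  have hpos' : ∀ n, 0 < h (κ n) (y n) := fun n => hι (γ n)
  have hmono : ∀ i, Monotone fun n => c i (y n) := fun i => by
    refine monotone_nat_of_le_succ fun n => ?_
    simp only [hy]
    by_cases hi : i = κ n
    · subst hi; rw [hstep]; linarith [hpos' n]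
    · rw [hstep' _ _ _ hi]
  have hL : ∀ i, ∃ L, Tendsto (fun n => c i (y n)) atTop (𝓝 L) := fun i =>
    ⟨_, tendsto_atTop_ciSup (hmono i) ⟨0, by rintro _ ⟨n, rfl⟩; exact hb _ _⟩⟩
  choose L hL using hL
  obtain ⟨z, hz⟩ := hlim y L hL
  have hcz : ∀ i, c i z = L i := fun i =>
    tendsto_nhds_unique (((hc i).tendsto z).comp hz) (hL i)
  -- One step changes the sum of the three coordinates by the value of the crossed wall function, so
  -- these values are differences of a convergent sequence.
  have hdiff : Tendsto (fun n => h (κ n) (y n)) atTop (𝓝 0) := by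
    have h1 : Tendsto (fun n => ∑ i, (c i (y (n + 1)) - c i (y n))) atTop (𝓝 (∑ _i : Fin 3, 0)) := by
      refine tendsto_finsetSum _ fun i _ => ?_
      simpa using ((tendsto_add_atTop_iff_nat 1).2 (hL i)).sub (hL i)
    have h2 : (fun n => ∑ i, (c i (y (n + 1)) - c i (y n))) = fun n => h (κ n) (y n) := by
      funext n
      rw [Finset.sum_eq_single (κ n)]
      · rw [hy, hstep]; ring
      · intro i _ hi; rw [hy, hstep' _ _ _ hi, sub_self]
      · simp
    rw [h2] at h1
    simpa using h1
  have hzero : ∀ i, (∃ᶠ n in atTop, κ n = i) → h i z = 0 := fun i hi => by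
    refine tendsto_nhds_unique_of_frequently_eq (((A.continuous_wall i).tendsto z).comp hz) hdiff ?_
    exact hi.mono fun n hn => by simp [hn]
  have hchange : ∀ n, κ (n + 1) ≠ κ n := fun n he => by
    have h1 := hpos' (n + 1)
    rw [he, hy, A.wall_apply] at h1
    linarith [hpos' n]
  have pigeon : ∀ p : ℕ → Fin 3 → Prop, (∃ᶠ n in atTop, ∃ i, p n i) →
      ∃ i, ∃ᶠ n in atTop, p n i := by
    intro p hp
    by_contra! hcon
    exact hp ((eventually_all.2 hcon).mono fun n hn => by simpa using hn)
  obtain ⟨i, hi⟩ := pigeon (fun n i => κ n = i) (Frequently.of_forall fun n => ⟨κ n, rfl⟩)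
  -- Consecutive letters differ, so some pair i ≠ j follows each other infinitely often and the
  -- limit lies on both walls.
  obtain ⟨j, hj⟩ := pigeon (fun n j => κ n = i ∧ κ (n + 1) = j) (hi.mono fun n hn => ⟨_, hn, rfl⟩)
  have hij : i ≠ j := by
    obtain ⟨n, h1, h2⟩ := hj.exists
    exact fun he => hchange n (by rw [h1, h2, he])
  have hj' : ∃ᶠ n in atTop, κ n = j := by
    rw [frequently_atTop] at hj ⊢
    intro a
    obtain ⟨n, hn, h1⟩ := hj a
    exact ⟨n + 1, by omega, h1.2⟩
  obtain ⟨k, hki, hkj, hk⟩ : ∃ k : Fin 3, k ≠ i ∧ k ≠ j ∧ ∀ l, l = i ∨ l = j ∨ l = k := by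
    clear hi hj hj'
    revert i j; decide
  have hck := hcorner i j k z hij hki hkj (hzero i hi) (hzero j hj')
  -- If the third letter recurs, all three walls contain the limit. If not, its coordinate is
  -- eventually constant, hence equal to its limit value 0, which `hpos` forbids.
  by_cases hkf : ∃ᶠ n in atTop, κ n = k
  · obtain ⟨l, hl⟩ := hne z
    rcases hk l with rfl | rfl | rfl
    · exact hl (hzero _ hi)
    · exact hl (hzero _ hj')
    · exact hl (hzero _ hkf)
  · rw [not_frequently, eventually_atTop] at hkf
    obtain ⟨N, hN⟩ := hkf
    have hconst : ∀ n ≥ N, c k (y n) = c k (y N) := by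
      intro n hn
      induction n, hn using Nat.le_induction with
      | base => rfl
      | succ n hn ih => rw [hy, hstep' _ _ _ (fun he => hN n hn he.symm), ih]
    have h1 : Tendsto (fun n => c k (y n)) atTop (𝓝 (c k (y N))) :=
      tendsto_const_nhds.congr' (eventually_atTop.2 ⟨N, fun n hn => (hconst n hn).symm⟩)
    have h2 := tendsto_nhds_unique (hL k) h1
    exact hpos _ k (y N) (fun he => hN N le_rfl he.symm) (hpos' N) (by rw [← h2, ← hcz, hck])

/-- A continuous function which is uniformly strictly increasing in its last variable has a unique
zero, depending continuously on the parameters. -/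
theorem exists_continuous_root {Z : Type*} [TopologicalSpace Z] (F : Z → ℝ → ℝ)
    (hF : Continuous fun v : Z × ℝ => F v.1 v.2) {ε : ℝ} (hε : 0 < ε)
    (hmono : ∀ z s s', s ≤ s' → ε * (s' - s) ≤ F z s' - F z s) :
    ∃ r : Z → ℝ, Continuous r ∧ ∀ z s, F z s = 0 ↔ s = r z := by
  have hz : ∀ z, Continuous (F z) := fun z => hF.comp (by fun_prop : Continuous fun s => (z, s))
  have hinj : ∀ z s s', F z s = F z s' → s = s' := by
    intro z s s' he
    rcases le_total s s' with hs | hs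
    · have := hmono z s s' hs; nlinarith
    · have := hmono z s' s hs; nlinarith
  have hex : ∀ z, ∃ s, F z s = 0 := by
    intro z
    set a := F z 0
    -- With slope at least ε, a function with value a at 0 has its root within distance |a| / ε of
    -- 0.
    have h1 : F z (-|a| / ε) ≤ 0 := by
      have := hmono z (-|a| / ε) 0 (by have := abs_nonneg a; rw [neg_div]; simp; positivity)
      have h2 : ε * (0 - -|a| / ε) = |a| := by field_simp; ring
      rw [h2] at this
      linarith [le_abs_self a]
    have h3 : 0 ≤ F z (|a| / ε) := by
      have := hmono z 0 (|a| / ε) (by positivity)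
      have h2 : ε * (|a| / ε - 0) = |a| := by field_simp; ring
      rw [h2] at this
      linarith [neg_abs_le a]
    exact mem_range_of_exists_le_of_exists_ge (hz z) ⟨_, h1⟩ ⟨_, h3⟩
  choose r hr using hex
  refine ⟨r, ?_, fun z s => ⟨fun h => hinj z s _ (h.trans (hr z).symm), fun h => h ▸ hr z⟩⟩
  rw [continuous_iff_continuousAt]
  intro z₀
  have hg : Filter.Tendsto (fun z => |F z (r z₀)| / ε) (𝓝 z₀) (𝓝 0) := by
    have h1 : Continuous fun z => |F z (r z₀)| / ε :=
      (continuous_abs.comp (hF.comp (by fun_prop : Continuous fun z => (z, r z₀)))).div_const ε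
    simpa [hr] using h1.tendsto z₀
  refine tendsto_iff_dist_tendsto_zero.2 (squeeze_zero (fun _ => dist_nonneg) (fun z => ?_) hg)
  rw [le_div_iff₀ hε, Real.dist_eq]
  rcases le_total (r z) (r z₀) with hs | hs
  · have := hmono z _ _ hs
    rw [hr, sub_zero] at this
    rw [abs_sub_comm, abs_of_nonneg (sub_nonneg.2 hs), mul_comm]
    exact this.trans (le_abs_self _)
  · have := hmono z _ _ hs
    rw [hr, zero_sub] at this
    rw [abs_of_nonneg (sub_nonneg.2 hs), mul_comm]
    exact this.trans (neg_le_abs _)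

end

noncomputable section

/-! ### The skeleton in nonnegative coordinates -/

/-- `max (-a, 0)` for a valuation `a`. -/
def negVal (a : WithTop ℝ) : ℝ := max (-(a.untopD 0)) 0

theorem negVal_nonneg (a : WithTop ℝ) : 0 ≤ negVal a := le_max_right _ _

/-- The maximum of the tropical monomials in the single variable `uⱼ`, with opposite signs. -/
def soloMax (p : Fin 3 → ℝ) (j : Fin 3) (u : Fin 3 → ℝ) : ℝ := max (2 * u j) (p j + u j)

/-- The maximum of the tropical monomials not involving `uᵢ`, with opposite signs. -/
def flipMax (p : Fin 3 → ℝ) (D : ℝ) (i : Fin 3) (u : Fin 3 → ℝ) : ℝ :=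
  max D (max (soloMax p (i + 1) u) (soloMax p (i + 2) u))

theorem coe_neg_max (s t : ℝ) :
    ((-(max s t) : ℝ) : WithTop ℝ) = min ((-s : ℝ) : WithTop ℝ) ((-t : ℝ) : WithTop ℝ) := by
  rw [← WithTop.coe_min, WithTop.coe_inj]
  rcases max_cases s t with h | h <;> rcases min_cases (-s) (-t) with h' | h' <;> linarith

/-- For x ≤ 0 a nonnegative valuation is irrelevant, since then a + x ≥ 2x. The default value 0 in
`negVal` treats ∞ in the same way. -/
theorem coe_neg_soloMax (a : WithTop ℝ) {x : ℝ} (hx : x ≤ 0) :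
    ((-(max (2 * -x) (negVal a + -x)) : ℝ) : WithTop ℝ) =
      min ((2 * x : ℝ) : WithTop ℝ) (a + (x : WithTop ℝ)) := by
  induction a using WithTop.recTopCoe with
  | top =>
    have : max (2 * -x) (negVal ⊤ + -x) = -(2 * x) := by
      rw [max_eq_left (by simp [negVal]; linarith)]; ring
    rw [this]; simp
  | coe a =>
    norm_cast
    simp only [negVal, WithTop.untopD_coe]
    rcases max_cases (-a) 0 with h | h <;>
      rcases max_cases (2 * -x) (max (-a) 0 + -x) with h' | h' <;>
      rcases min_cases (2 * x) (a + x) with h'' | h'' <;> linarith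

/-- The additional 0 does no harm later: wherever this is applied the minimum also contains some
2x_i ≤ 0. -/
theorem coe_neg_negVal (d : WithTop ℝ) : ((-(negVal d) : ℝ) : WithTop ℝ) = min d 0 := by
  induction d using WithTop.recTopCoe with
  | top => simp [negVal]
  | coe d =>
    norm_cast
    simp only [negVal, WithTop.untopD_coe]
    rcases max_cases (-d) 0 with h | h <;> rcases min_cases d 0 with h' | h' <;> linarith

theorem neg_pairMin (p q r : WithTop ℝ) {y z : ℝ} (hy : y ≤ 0) (hz : z ≤ 0) :
    -pairMin p q r y z =
      max (negVal r) (max (max (2 * -y) (negVal p + -y)) (max (2 * -z) (negVal q + -z))) := by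
  rw [neg_eq_iff_eq_neg, ← WithTop.coe_inj, coe_pairMin, coe_neg_max, coe_neg_max,
    coe_neg_soloMax p hy, coe_neg_soloMax q hz, coe_neg_negVal]
  have h0 : ((2 * y : ℝ) : WithTop ℝ) = min 0 ((2 * y : ℝ) : WithTop ℝ) := by
    rw [min_eq_right]
    norm_cast
    linarith
  nth_rewrite 1 [h0]
  ac_rfl

variable {a b c d : WithTop ℝ}

/-- Adding the inequalities x₀ + x₁ + x₂ ≤ 2x_i for two indices leaves 2x_k ≤ 0 for the third. -/
theorem sk_nonpos {x : Fin 3 → ℝ} (hx : x ∈ Sk a b c d) (i : Fin 3) : x i ≤ 0 := by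
  have h := ((mem_Sk_iff a b c d x).1 hx).le
  simp only [le_min_iff, WithTop.coe_le_coe] at h
  obtain ⟨h0, h1, h2, -⟩ := h
  fin_cases i
  · change x 0 ≤ 0; linarith
  · change x 1 ≤ 0; linarith
  · change x 2 ≤ 0; linarith

/-- The nonnegative parameters attached to the linear coefficients. -/
def linVal (a b c : WithTop ℝ) : Fin 3 → ℝ := ![negVal a, negVal b, negVal c]

theorem linVal_nonneg (a b c : WithTop ℝ) (i : Fin 3) : 0 ≤ linVal a b c i := by
  fin_cases i <;> exact negVal_nonneg _

/-- The defining equation of the skeleton in nonnegative coordinates. -/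
def IsSkPoint (p : Fin 3 → ℝ) (D : ℝ) (u : Fin 3 → ℝ) : Prop :=
  u 0 + u 1 + u 2 = max D (max (soloMax p 0 u) (max (soloMax p 1 u) (soloMax p 2 u)))

theorem IsSkPoint.nonneg {p : Fin 3 → ℝ} {D : ℝ} {u : Fin 3 → ℝ} (hu : IsSkPoint p D u)
    (i : Fin 3) : 0 ≤ u i := by
  have h := hu.ge
  simp only [soloMax, max_le_iff] at h
  obtain ⟨-, ⟨h0, -⟩, ⟨h1, -⟩, h2, -⟩ := h
  fin_cases i
  · change 0 ≤ u 0; linarith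
  · change 0 ≤ u 1; linarith
  · change 0 ≤ u 2; linarith

theorem mem_Sk_iff_of_nonpos {x : Fin 3 → ℝ} (hx : ∀ i, x i ≤ 0) :
    x ∈ Sk a b c d ↔ IsSkPoint (linVal a b c) (negVal d) (-x) := by
  have h0 : ((2 * x 0 : ℝ) : WithTop ℝ) = min 0 ((2 * x 0 : ℝ) : WithTop ℝ) := by
    rw [min_eq_right]
    norm_cast
    linarith [hx 0]
  have e0 := coe_neg_soloMax a (hx 0)
  have e1 := coe_neg_soloMax b (hx 1)
  have e2 := coe_neg_soloMax c (hx 2)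
  have key : min (min 0 ((2 * x 0 : ℝ) : WithTop ℝ)) (min ((2 * x 1 : ℝ) : WithTop ℝ)
      (min ((2 * x 2 : ℝ) : WithTop ℝ) (min (a + (x 0 : WithTop ℝ))
        (min (b + (x 1 : WithTop ℝ)) (min (c + (x 2 : WithTop ℝ)) d))))) =
      ((-(max (negVal d) (max (soloMax (linVal a b c) 0 (-x)) (max (soloMax (linVal a b c) 1 (-x))
        (soloMax (linVal a b c) 2 (-x))))) : ℝ) : WithTop ℝ) := by
    rw [coe_neg_max, coe_neg_max, coe_neg_max]
    simp only [soloMax, linVal, Pi.neg_apply, Matrix.cons_val_zero, Matrix.cons_val_one,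
      Matrix.cons_val]
    rw [e0, e1, e2, coe_neg_negVal]
    ac_rfl
  rw [mem_Sk_iff, h0, key, WithTop.coe_inj, IsSkPoint]
  simp only [Pi.neg_apply]
  constructor <;> intro h <;> linarith

theorem mem_Sk_iff_neg {u : Fin 3 → ℝ} :
    -u ∈ Sk a b c d ↔ IsSkPoint (linVal a b c) (negVal d) u := by
  constructor
  · intro h
    have := (mem_Sk_iff_of_nonpos (sk_nonpos h)).1 h
    rwa [neg_neg] at this
  · intro h
    rw [mem_Sk_iff_of_nonpos (fun i => by simpa using h.nonneg i), neg_neg]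
    exact h

theorem neg_tropVieta_self {x : Fin 3 → ℝ} (hx : ∀ i, x i ≤ 0) (i : Fin 3) :
    -tropVieta a b c d i x i = flipMax (linVal a b c) (negVal d) i (-x) - -x i := by
  fin_cases i
  · simp [tropVieta, flipMax, soloMax, linVal]
    have := neg_pairMin b c d (hx 1) (hx 2)
    simp at this
    rw [← this]
    ring
  · simp [tropVieta, flipMax, soloMax, linVal]
    rw [max_comm (max (-(2 * x 2)) _)]
    have := neg_pairMin a c d (hx 0) (hx 2)
    simp at this
    rw [← this]
    ring
  · simp [tropVieta, flipMax, soloMax, linVal]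
    have := neg_pairMin a b d (hx 0) (hx 1)
    simp at this
    rw [← this]
    ring

theorem tropVieta_of_ne (x : Fin 3 → ℝ) {i j : Fin 3} (hij : j ≠ i) :
    tropVieta a b c d i x j = x j := by
  fin_cases i <;> fin_cases j <;> simp_all [tropVieta]

end

/-! ### Wall functions and their incidences. -/

noncomputable section

theorem eq_add_one_or_eq_add_two {i j : Fin 3} (h : j ≠ i) : j = i + 1 ∨ j = i + 2 := by
  revert i j; decide

theorem add_one_ne (i : Fin 3) : i + 1 ≠ i := by revert i; decide

theorem add_two_ne (i : Fin 3) : i + 2 ≠ i := by revert i; decide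

theorem add_two_ne_add_one (i : Fin 3) : i + 2 ≠ i + 1 := by revert i; decide

section Real

variable {p : Fin 3 → ℝ} {D : ℝ} {u v : Fin 3 → ℝ}

theorem isSkPoint_iff (i : Fin 3) : IsSkPoint p D u ↔
    u i + u (i + 1) + u (i + 2) = max (soloMax p i u) (flipMax p D i u) := by
  unfold IsSkPoint flipMax
  fin_cases i
  · change _ ↔ u 0 + u 1 + u 2 = max (soloMax p 0 u) (max D (max (soloMax p 1 u) (soloMax p 2 u)))
    rw [max_left_comm]
  · change _ ↔ u 1 + u 2 + u 0 = max (soloMax p 1 u) (max D (max (soloMax p 2 u) (soloMax p 0 u)))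
    rw [show u 1 + u 2 + u 0 = u 0 + u 1 + u 2 by ring]
    refine Eq.congr rfl ?_
    ac_rfl
  · change _ ↔ u 2 + u 0 + u 1 = max (soloMax p 2 u) (max D (max (soloMax p 0 u) (soloMax p 1 u)))
    rw [show u 2 + u 0 + u 1 = u 0 + u 1 + u 2 by ring]
    refine Eq.congr rfl ?_
    ac_rfl

theorem le_flipMax (p : Fin 3 → ℝ) (D : ℝ) (u : Fin 3 → ℝ) (i : Fin 3) : D ≤ flipMax p D i u :=
  le_max_left _ _

theorem soloMax_le_flipMax {i j : Fin 3} (h : j ≠ i) : soloMax p j u ≤ flipMax p D i u := by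
  rcases eq_add_one_or_eq_add_two h with rfl | rfl
  · exact (le_max_left _ _).trans (le_max_right _ _)
  · exact (le_max_right _ _).trans (le_max_right _ _)

theorem two_mul_le_soloMax (p : Fin 3 → ℝ) (j : Fin 3) (u : Fin 3 → ℝ) : 2 * u j ≤ soloMax p j u :=
  le_max_left _ _

theorem add_le_soloMax (p : Fin 3 → ℝ) (j : Fin 3) (u : Fin 3 → ℝ) : p j + u j ≤ soloMax p j u :=
  le_max_right _ _

theorem two_mul_le_flipMax {i j : Fin 3} (h : j ≠ i) : 2 * u j ≤ flipMax p D i u :=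
  (two_mul_le_soloMax p j u).trans (soloMax_le_flipMax h)

theorem add_le_flipMax {i j : Fin 3} (h : j ≠ i) : p j + u j ≤ flipMax p D i u :=
  (add_le_soloMax p j u).trans (soloMax_le_flipMax h)

theorem flipMax_congr {i : Fin 3} (h : ∀ j, j ≠ i → u j = v j) :
    flipMax p D i u = flipMax p D i v := by
  simp only [flipMax, soloMax, h _ (add_one_ne i), h _ (add_two_ne i)]

theorem flipMax_lt_iff {i : Fin 3} {s : ℝ} :
    flipMax p D i u < s ↔ D < s ∧ ∀ j, j ≠ i → 2 * u j < s ∧ p j + u j < s := by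
  simp only [flipMax, soloMax, max_lt_iff]
  constructor
  · rintro ⟨h0, h1, h2⟩
    refine ⟨h0, fun j hj => ?_⟩
    rcases eq_add_one_or_eq_add_two hj with rfl | rfl
    · exact h1
    · exact h2
  · rintro ⟨h0, h⟩
    exact ⟨h0, h _ (add_one_ne i), h _ (add_two_ne i)⟩

theorem flipMax_le_iff {i : Fin 3} {s : ℝ} :
    flipMax p D i u ≤ s ↔ D ≤ s ∧ ∀ j, j ≠ i → 2 * u j ≤ s ∧ p j + u j ≤ s := by
  simp only [flipMax, soloMax, max_le_iff]
  constructor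
  · rintro ⟨h0, h1, h2⟩
    refine ⟨h0, fun j hj => ?_⟩
    rcases eq_add_one_or_eq_add_two hj with rfl | rfl
    · exact h1
    · exact h2
  · rintro ⟨h0, h⟩
    exact ⟨h0, h _ (add_one_ne i), h _ (add_two_ne i)⟩

theorem continuous_flipMax (p : Fin 3 → ℝ) (D : ℝ) (i : Fin 3) : Continuous (flipMax p D i) := by
  unfold flipMax soloMax; fun_prop

/-- The wall function of the `i`-th involution in nonnegative coordinates. -/
def wall (p : Fin 3 → ℝ) (D : ℝ) (i : Fin 3) (u : Fin 3 → ℝ) : ℝ := 2 * u i - flipMax p D i u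

/-- The chain is 2u_j ≤ m_i < 2u_i ≤ m_j. -/
theorem wall_neg_of_pos {i j : Fin 3} (hij : i ≠ j) (h : 0 < wall p D i u) : wall p D j u < 0 := by
  have h1 : 2 * u j ≤ flipMax p D i u := two_mul_le_flipMax hij.symm
  have h2 : 2 * u i ≤ flipMax p D j u := two_mul_le_flipMax hij
  unfold wall at *
  linarith

/-- The corner where two walls meet is a ray of the cone `2 uᵢ = 2 uⱼ = ∑ u`. -/
theorem IsSkPoint.corner (hu : IsSkPoint p D u) {i j k : Fin 3} (hij : i ≠ j) (hki : k ≠ i)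
    (hkj : k ≠ j) (hi : 0 ≤ wall p D i u) (hj : 0 ≤ wall p D j u) : u i = u j ∧ u k = 0 := by
  have h1 : 2 * u j ≤ flipMax p D i u := two_mul_le_flipMax hij.symm
  have h2 : 2 * u i ≤ flipMax p D j u := two_mul_le_flipMax hij
  have h3 : p i + u i ≤ flipMax p D j u := add_le_flipMax hij
  unfold wall at *
  have h5 : u i = u j := by linarith
  have h4 : u i + u (i + 1) + u (i + 2) = u i + u j + u k := by
    rcases eq_add_one_or_eq_add_two hij.symm with rfl | rfl <;>
      rcases eq_add_one_or_eq_add_two hki with rfl | rfl <;> first | exact absurd rfl hkj | ring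
  have h6 := (isSkPoint_iff i).1 hu
  have h7 : max (soloMax p i u) (flipMax p D i u) = 2 * u i := by
    apply le_antisymm
    · exact max_le (max_le le_rfl (by linarith)) (by linarith)
    · exact (two_mul_le_soloMax p i u).trans (le_max_left _ _)
  exact ⟨h5, by linarith⟩

/-- If u_j = 0, then 2u_i ≤ u_i + u_k gives u_i ≤ u_k, against 2u_k ≤ m_i < 2u_i. This is the
nondegeneracy condition `hpos` of the descent. -/
theorem IsSkPoint.ne_zero_of_wall_pos (hu : IsSkPoint p D u) {i j : Fin 3} (hj : j ≠ i)
    (hi : 0 < wall p D i u) : u j ≠ 0 := by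
  obtain ⟨k, hki, hkj⟩ : ∃ k : Fin 3, k ≠ i ∧ k ≠ j := by
    clear hi; revert i j; decide
  have h1 : 2 * u k ≤ flipMax p D i u := two_mul_le_flipMax hki
  have h4 : u i + u (i + 1) + u (i + 2) = u i + u j + u k := by
    rcases eq_add_one_or_eq_add_two hj with rfl | rfl <;>
      rcases eq_add_one_or_eq_add_two hki with rfl | rfl <;> first | exact absurd rfl hkj | ring
  have h6 := (isSkPoint_iff i).1 hu
  have h7 : 2 * u i ≤ max (soloMax p i u) (flipMax p D i u) :=
    (two_mul_le_soloMax p i u).trans (le_max_left _ _)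
  unfold wall at *
  intro h0
  linarith

/-- Three walls meet only at u = 0, where all m_i would vanish; a positive parameter prevents this.
-/
theorem IsSkPoint.exists_wall_ne_zero (hu : IsSkPoint p D u) (hne : 0 < D ∨ ∃ i, 0 < p i) :
    ∃ i, wall p D i u ≠ 0 := by
  by_contra! hcon
  have hz : ∀ k, u k = 0 := by
    intro k
    obtain ⟨i, j, hij, hki, hkj⟩ : ∃ i j : Fin 3, i ≠ j ∧ k ≠ i ∧ k ≠ j := by revert k; decide
    exact (hu.corner hij hki hkj (hcon i).ge (hcon j).ge).2
  have hm : ∀ i, flipMax p D i u = 0 := fun i => by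
    have := hcon i
    unfold wall at this
    linarith [hz i]
  rcases hne with h | ⟨i, h⟩
  · linarith [le_flipMax p D u 0, hm 0]
  · have h1 : p i + u i ≤ flipMax p D (i + 1) u := add_le_flipMax (add_one_ne i).symm
    linarith [hz i, hm (i + 1)]

/-- Here m_i ≤ 2u_i, so the terms without u_i are not needed in the maximum. -/
theorem IsSkPoint.sum_eq_soloMax (hu : IsSkPoint p D u) {i : Fin 3} (hi : 0 ≤ wall p D i u) :
    u 0 + u 1 + u 2 = soloMax p i u := by
  have h6 := (isSkPoint_iff i).1 hu
  have h7 := two_mul_le_soloMax p i u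
  unfold wall at hi
  rw [max_eq_left (by linarith)] at h6
  rw [← h6]
  fin_cases i
  · rfl
  · change _ = u 1 + u 2 + u 0; ring
  · change _ = u 2 + u 0 + u 1; ring

/-- A far away point in the interior of the `i`-th quadratic cell. -/
def farPoint (p : Fin 3 → ℝ) (D : ℝ) (i : Fin 3) : Fin 3 → ℝ :=
  fun j => if j = i then 2 * (1 + D + p 0 + p 1 + p 2) else 1 + D + p 0 + p 1 + p 2

theorem lt_farPoint (hp : ∀ i, 0 ≤ p i) (hD : 0 ≤ D) (j : Fin 3) :
    p j < 1 + D + p 0 + p 1 + p 2 := by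
  have := hp 0; have := hp 1; have := hp 2
  fin_cases j
  · change p 0 < _; linarith
  · change p 1 < _; linarith
  · change p 2 < _; linarith

theorem wall_farPoint (hp : ∀ i, 0 ≤ p i) (hD : 0 ≤ D) (i : Fin 3) :
    0 < wall p D i (farPoint p D i) := by
  have h : flipMax p D i (farPoint p D i) < 2 * farPoint p D i i := by
    rw [flipMax_lt_iff]
    have := lt_farPoint hp hD i
    have := hp i
    have := hp 0; have := hp 1; have := hp 2
    refine ⟨by simp only [farPoint, if_true]; linarith, fun j hj => ?_⟩
    have := lt_farPoint hp hD j
    simp only [farPoint, if_true, if_neg hj]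
    constructor <;> linarith
  unfold wall
  linarith

theorem isSkPoint_farPoint (hp : ∀ i, 0 ≤ p i) (hD : 0 ≤ D) (i : Fin 3) :
    IsSkPoint p D (farPoint p D i) := by
  rw [isSkPoint_iff i]
  have h1 := wall_farPoint hp hD i
  have h2 := lt_farPoint hp hD i
  have h3 := hp i
  unfold wall at h1
  rw [max_eq_left (by linarith [two_mul_le_soloMax p i (farPoint p D i)]), soloMax, max_eq_left]
  · simp only [farPoint, if_true, if_neg (add_one_ne i), if_neg (add_two_ne i)]; ring
  · simp only [farPoint, if_true]; linarith

end Real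

/-! ### The Vieta involutions as a reflection action. -/

section Action

variable {a b c d : WithTop ℝ}

/-- The wall functions on the skeleton. -/
def skWall (a b c d : WithTop ℝ) (i : Fin 3) (x : Sk a b c d) : ℝ :=
  wall (linVal a b c) (negVal d) i (-x.1)

theorem isSkPoint_neg (x : Sk a b c d) : IsSkPoint (linVal a b c) (negVal d) (-x.1) :=
  mem_Sk_iff_neg.1 (by rw [neg_neg]; exact x.2)

theorem neg_skVieta_self (i : Fin 3) (x : Sk a b c d) :
    -(skVieta a b c d i x).1 i = flipMax (linVal a b c) (negVal d) i (-x.1) - -x.1 i :=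
  neg_tropVieta_self (sk_nonpos x.2) i

theorem skVieta_of_ne {i j : Fin 3} (hij : j ≠ i) (x : Sk a b c d) :
    (skVieta a b c d i x).1 j = x.1 j :=
  tropVieta_of_ne x.1 hij

theorem flipMax_skVieta (i : Fin 3) (x : Sk a b c d) :
    flipMax (linVal a b c) (negVal d) i (-(skVieta a b c d i x).1) =
      flipMax (linVal a b c) (negVal d) i (-x.1) :=
  flipMax_congr fun j hj => by simp [skVieta_of_ne hj]

theorem skWall_skVieta (i : Fin 3) (x : Sk a b c d) :
    skWall a b c d i (skVieta a b c d i x) = -skWall a b c d i x := by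
  have h := neg_skVieta_self i x
  simp only [skWall, wall, flipMax_skVieta, Pi.neg_apply] at *
  rw [h]; ring

theorem skVieta_eq_self_iff (i : Fin 3) (x : Sk a b c d) :
    skVieta a b c d i x = x ↔ skWall a b c d i x = 0 := by
  have h := neg_skVieta_self i x
  constructor
  · intro he
    rw [he] at h
    simp only [skWall, wall, Pi.neg_apply]
    linarith
  · intro h0
    simp only [skWall, wall, Pi.neg_apply] at h0
    apply Subtype.ext
    funext j
    by_cases hj : j = i
    · subst hj; linarith
    · exact skVieta_of_ne hj x

theorem continuous_skWall (i : Fin 3) : Continuous (skWall a b c d i) := by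
  have h : Continuous fun x : Sk a b c d => -x.1 := continuous_subtype_val.neg
  have := (continuous_flipMax (linVal a b c) (negVal d) i).comp h
  unfold skWall wall
  exact (continuous_const.mul ((continuous_apply i).comp h)).sub this

theorem vietaGen_mul_self (i : Fin 3) : vietaGen a b c d i * vietaGen a b c d i = 1 := by
  apply Subtype.ext
  apply Homeomorph.ext
  intro x
  exact Subtype.ext (tropVieta_tropVieta a b c d i x)

theorem closure_range_eq_top {G : Type*} [Group G] {H : Subgroup G} {ι : Type*} {f : ι → H}
    (hf : Subgroup.closure (range fun i => (f i : G)) = H) : Subgroup.closure (range f) = ⊤ := by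
  apply Subgroup.map_injective H.subtype_injective
  rw [MonoidHom.map_closure, ← range_comp, ← MonoidHom.range_eq_map, Subgroup.range_subtype]
  exact hf

theorem closure_vietaGen : Subgroup.closure (range (vietaGen a b c d)) = ⊤ :=
  closure_range_eq_top rfl

theorem skAction (a b c d : WithTop ℝ) :
    ReflectionAction (vietaGen a b c d) (vietaGroup a b c d).subtype (skWall a b c d) where
  continuous_wall := continuous_skWall
  closure_eq_top := closure_vietaGen
  mul_self := vietaGen_mul_self
  wall_apply := skWall_skVieta
  fixed i x h := (skVieta_eq_self_iff i x).2 h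
  neg_of_pos _ _ _ hij h := wall_neg_of_pos hij h

/-- A point of the skeleton with prescribed nonnegative coordinates. -/
def IsSkPoint.toSk {u : Fin 3 → ℝ} (hu : IsSkPoint (linVal a b c) (negVal d) u) : Sk a b c d :=
  ⟨-u, mem_Sk_iff_neg.2 hu⟩

theorem exists_skWall_pos (i : Fin 3) : ∃ x, 0 < skWall a b c d i x := by
  refine ⟨(isSkPoint_farPoint (linVal_nonneg a b c) (negVal_nonneg d) i).toSk, ?_⟩
  simp only [skWall, IsSkPoint.toSk, neg_neg]
  exact wall_farPoint (linVal_nonneg a b c) (negVal_nonneg d) i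

theorem freeInvolution_mul_self (i : Fin 3) :
    (PresentedGroup.of i : FreeInvolutionGroup) * PresentedGroup.of i = 1 := by
  have h : PresentedGroup.mk (Set.range fun i : Fin 3 => FreeGroup.of i ^ 2)
      (FreeGroup.of i ^ 2) = 1 :=
    PresentedGroup.one_of_mem (mem_range_self i)
  rw [map_pow, sq] at h
  exact h

/-- A group generated by three reflections with disjoint half-spaces is the free product of the
groups of order two which they generate. -/
theorem ReflectionAction.exists_freeInvolution_equiv {G X : Type*} [Group G] [TopologicalSpace X]
    {t : Fin 3 → G} {ρ : G →* (X ≃ₜ X)} {h : Fin 3 → X → ℝ} (A : ReflectionAction t ρ h)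
    (hne : ∀ i, ∃ x, 0 < h i x) :
    ∃ e : FreeInvolutionGroup ≃* G, ∀ i, e (PresentedGroup.of i) = t i := by
  have hrel : ∀ r ∈ Set.range fun i : Fin 3 => FreeGroup.of i ^ 2, FreeGroup.lift t r = 1 := by
    rintro _ ⟨i, rfl⟩
    simp [sq, A.mul_self]
  let φ : FreeInvolutionGroup →* G := PresentedGroup.toGroup hrel
  have hφ : ∀ i, φ (PresentedGroup.of i) = t i := fun i => PresentedGroup.toGroup.of hrel
  -- The presented group acts through φ and satisfies the same axioms, so its own action is
  -- faithful; therefore φ is injective.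
  have B : ReflectionAction (fun i => (PresentedGroup.of i : FreeInvolutionGroup)) (ρ.comp φ) h :=
    { continuous_wall := A.continuous_wall
      closure_eq_top := PresentedGroup.closure_range_of _
      mul_self := freeInvolution_mul_self
      wall_apply := fun i x => by simpa [hφ] using A.wall_apply i x
      fixed := fun i x hx => by simpa [hφ] using A.fixed i x hx
      neg_of_pos := A.neg_of_pos }
  have hinj : Function.Injective φ := by
    have := B.injective hne
    rw [MonoidHom.coe_comp] at this
    exact this.of_comp
  have hsurj : Function.Surjective φ := by
    rw [← MonoidHom.range_eq_top, eq_top_iff, ← A.closure_eq_top, Subgroup.closure_le]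
    rintro _ ⟨i, rfl⟩
    exact ⟨_, hφ i⟩
  exact ⟨MulEquiv.ofBijective φ ⟨hinj, hsurj⟩, hφ⟩

end Action

end

/-! ### Global charts, half-spaces and their uniqueness. -/

noncomputable section

theorem max_le_max_add {s t s' t' k : ℝ} (h : s' ≤ s + k) (h' : t' ≤ t + k) :
    max s' t' ≤ max s t + k :=
  max_le (h.trans (by linarith [le_max_left s t])) (h'.trans (by linarith [le_max_right s t]))

/-- The vector with the entries `α, β, γ` at the places `i, i + 1, i + 2`. -/
def vecAt (i : Fin 3) (α β γ : ℝ) : Fin 3 → ℝ :=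
  fun j => if j = i then α else if j = i + 1 then β else γ

theorem vecAt_self (i : Fin 3) (α β γ : ℝ) : vecAt i α β γ i = α := if_pos rfl

theorem vecAt_add_one (i : Fin 3) (α β γ : ℝ) : vecAt i α β γ (i + 1) = β := by
  simp [vecAt]

theorem vecAt_add_two (i : Fin 3) (α β γ : ℝ) : vecAt i α β γ (i + 2) = γ := by
  simp [vecAt]

theorem eq_vecAt (i : Fin 3) {u : Fin 3 → ℝ} {α β γ : ℝ} (h0 : u i = α) (h1 : u (i + 1) = β)
    (h2 : u (i + 2) = γ) : u = vecAt i α β γ := by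
  funext j
  by_cases hj : j = i
  · subst hj; rw [vecAt_self, h0]
  · rcases eq_add_one_or_eq_add_two hj with rfl | rfl
    · rw [vecAt_add_one, h1]
    · rw [vecAt_add_two, h2]

theorem continuous_vecAt {Z : Type*} [TopologicalSpace Z] (i : Fin 3) {α β γ : Z → ℝ}
    (hα : Continuous α) (hβ : Continuous β) (hγ : Continuous γ) :
    Continuous fun z => vecAt i (α z) (β z) (γ z) := by
  refine continuous_pi fun j => ?_
  by_cases hj : j = i
  · subst hj; simpa only [vecAt_self] using hα
  · rcases eq_add_one_or_eq_add_two hj with rfl | rfl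
    · simpa only [vecAt_add_one] using hβ
    · simpa only [vecAt_add_two] using hγ

/-- `flipMax` as a function of the two remaining coordinates `w + q` and `w`. -/
def sliceMax (p : Fin 3 → ℝ) (D : ℝ) (i : Fin 3) (q w : ℝ) : ℝ :=
  max D (max (max (2 * (w + q)) (p (i + 1) + (w + q))) (max (2 * w) (p (i + 2) + w)))

theorem flipMax_vecAt (p : Fin 3 → ℝ) (D : ℝ) (i : Fin 3) (α q w : ℝ) :
    flipMax p D i (vecAt i α (w + q) w) = sliceMax p D i q w := by
  simp only [flipMax, soloMax, sliceMax, vecAt_add_one, vecAt_add_two]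

/-- Taking u_i out of the maximum leaves u_i, m - u_i and p_i. The first two are (m ± s) / 2, so
their maximum is (m + |s|) / 2. -/
theorem isSkPoint_vecAt_iff (p : Fin 3 → ℝ) (D : ℝ) (i : Fin 3) (s q w : ℝ) :
    IsSkPoint p D (vecAt i ((sliceMax p D i q w + s) / 2) (w + q) w) ↔
      2 * w + q - max ((sliceMax p D i q w + |s|) / 2) (p i) = 0 := by
  rw [isSkPoint_iff i, flipMax_vecAt, soloMax, vecAt_self, vecAt_add_one, vecAt_add_two]
  set m := sliceMax p D i q w
  have hm : max (max (2 * ((m + s) / 2)) (p i + (m + s) / 2)) m =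
      (m + s) / 2 + max ((m + |s|) / 2) (p i) := by
    rcases abs_cases s with ⟨h, h'⟩ | ⟨h, h'⟩ <;> rw [h]
    · rw [max_eq_left (le_max_of_le_left (by linarith)), ← max_add_add_left]
      congr 1 <;> ring
    · rw [max_right_comm, max_eq_right (by linarith : 2 * ((m + s) / 2) ≤ m), ← max_add_add_left]
      congr 1 <;> ring
  rw [hm]
  constructor <;> intro h <;> linarith

variable {a b c d : WithTop ℝ}

/-- The wall function `h i` and the difference of the two coordinates fixed by the `i`-th
involution are global coordinates on the skeleton. -/
theorem exists_chart (a b c d : WithTop ℝ) (i : Fin 3) :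
    ∃ φ : Sk a b c d ≃ₜ ℝ × ℝ, ∀ x, (φ x).1 = skWall a b c d i x := by
  set p := linVal a b c with hp
  set D := negVal d with hD
  let F : ℝ × ℝ → ℝ → ℝ := fun z w =>
    2 * w + z.2 - max ((sliceMax p D i z.2 w + |z.1|) / 2) (p i)
  have hF : Continuous fun v : (ℝ × ℝ) × ℝ => F v.1 v.2 := by
    unfold F sliceMax; fun_prop
  -- `sliceMax` grows at rate at most 2 in w, so the subtracted maximum grows at rate at most 1,
  -- against the rate 2 of the leading term.
  have hmono : ∀ z s s', s ≤ s' → 1 * (s' - s) ≤ F z s' - F z s := by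
    intro z s s' hs
    have h1 : sliceMax p D i z.2 s' ≤ sliceMax p D i z.2 s + 2 * (s' - s) := by
      refine max_le_max_add ?_ (max_le_max_add (max_le_max_add ?_ ?_) (max_le_max_add ?_ ?_)) <;>
        linarith
    have h2 : max ((sliceMax p D i z.2 s' + |z.1|) / 2) (p i) ≤
        max ((sliceMax p D i z.2 s + |z.1|) / 2) (p i) + (s' - s) := by
      refine max_le_max_add ?_ ?_ <;> linarith
    simp only [F]
    linarith
  obtain ⟨r, hrc, hr⟩ := exists_continuous_root F hF one_pos hmono
  let V : ℝ × ℝ → Fin 3 → ℝ := fun z =>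
    vecAt i ((sliceMax p D i z.2 (r z) + z.1) / 2) (r z + z.2) (r z)
  have hV : ∀ z, IsSkPoint p D (V z) := fun z =>
    (isSkPoint_vecAt_iff p D i z.1 z.2 (r z)).2 ((hr z (r z)).2 rfl)
  let f : Sk a b c d → ℝ × ℝ := fun x => (skWall a b c d i x, -x.1 (i + 1) - -x.1 (i + 2))
  have hVx : ∀ x : Sk a b c d, V (f x) = -x.1 := by
    intro x
    have e : -x.1 = vecAt i ((sliceMax p D i (f x).2 (-x.1 (i + 2)) + (f x).1) / 2)
        (-x.1 (i + 2) + (f x).2) (-x.1 (i + 2)) := by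
      have e1 : -x.1 = vecAt i (-x.1 i) (-x.1 (i + 2) + (f x).2) (-x.1 (i + 2)) := by
        refine eq_vecAt i rfl ?_ rfl
        simp only [Pi.neg_apply, f]; ring
      have e2 := flipMax_vecAt p D i (-x.1 i) (f x).2 (-x.1 (i + 2))
      rw [← e1] at e2
      have e3 : (f x).1 = 2 * -x.1 i - flipMax p D i (-x.1) := rfl
      rw [e2] at e3
      rw [e3]
      convert e1 using 2
      ring
    have h1 := (isSkPoint_neg x)
    rw [← hp, ← hD, e, isSkPoint_vecAt_iff] at h1
    have h2 := (hr (f x) (-x.1 (i + 2))).1 h1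
    simp only [V]
    rw [← h2]
    exact e.symm
  let φ : Sk a b c d ≃ₜ ℝ × ℝ :=
    { toFun := f
      invFun := fun z => (hV z).toSk
      left_inv := fun x => by
        apply Subtype.ext
        change -V (f x) = x.1
        rw [hVx, neg_neg]
      right_inv := fun z => by
        have e1 : ∀ j, -(hV z).toSk.1 j = V z j := fun j => by simp [IsSkPoint.toSk]
        have e2 : -(hV z).toSk.1 = V z := funext e1
        apply Prod.ext
        · change 2 * -(hV z).toSk.1 i - flipMax p D i (-(hV z).toSk.1) = z.1
          rw [e1, e2]
          simp only [V]
          rw [flipMax_vecAt, vecAt_self]; ring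
        · change -(hV z).toSk.1 (i + 1) - -(hV z).toSk.1 (i + 2) = z.2
          rw [e1, e1]
          simp only [V]
          rw [vecAt_add_one, vecAt_add_two]; ring
      continuous_toFun := by
        have h : ∀ j, Continuous fun x : Sk a b c d => -x.1 j := fun j =>
          ((continuous_apply j).comp continuous_subtype_val).neg
        exact (continuous_skWall i).prodMk ((h (i + 1)).sub (h (i + 2)))
      continuous_invFun := by
        refine Continuous.subtype_mk (Continuous.neg ?_) _
        refine continuous_vecAt i ?_ (hrc.add continuous_snd) hrc
        unfold sliceMax; fun_prop }
  exact ⟨φ, fun x => rfl⟩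

theorem closure_fst_pos : closure {p : ℝ × ℝ | 0 < p.1} = {p | 0 ≤ p.1} := by
  have h : {p : ℝ × ℝ | 0 < p.1} = Ioi 0 ×ˢ univ := by ext; simp
  rw [h, closure_prod_eq, closure_Ioi, closure_univ]
  ext; simp

theorem interior_fst_nonneg : interior {p : ℝ × ℝ | 0 ≤ p.1} = {p | 0 < p.1} := by
  have h : {p : ℝ × ℝ | 0 ≤ p.1} = Ici 0 ×ˢ univ := by ext; simp
  rw [h, interior_prod_eq, interior_Ici, interior_univ]
  ext; simp

/-- The open half-space of the skeleton on the positive side of the `i`-th wall. -/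
def skHalf (a b c d : WithTop ℝ) (i : Fin 3) : Set (Sk a b c d) := {x | 0 < skWall a b c d i x}

/-- Continuity gives only one inclusion. That every wall point is a limit of points of the
half-space is seen in the chart, where the wall is a line. -/
theorem closure_skHalf (i : Fin 3) : closure (skHalf a b c d i) = {x | 0 ≤ skWall a b c d i x} := by
  obtain ⟨φ, hφ⟩ := exists_chart a b c d i
  have h : skHalf a b c d i = φ ⁻¹' {p | 0 < p.1} := by ext x; simp [skHalf, hφ]
  rw [h, ← φ.preimage_closure, closure_fst_pos]
  ext x; simp [hφ]

theorem interior_closure_skHalf (i : Fin 3) :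
    interior (closure (skHalf a b c d i)) = skHalf a b c d i := by
  obtain ⟨φ, hφ⟩ := exists_chart a b c d i
  have h : {x | 0 ≤ skWall a b c d i x} = φ ⁻¹' {p | 0 ≤ p.1} := by ext x; simp [hφ]
  rw [closure_skHalf, h, ← φ.preimage_interior, interior_fst_nonneg]
  ext x; simp [hφ, skHalf]

theorem isOpen_skHalf (i : Fin 3) : IsOpen (skHalf a b c d i) :=
  isOpen_lt continuous_const (continuous_skWall i)

theorem frontier_skHalf (i : Fin 3) :
    frontier (skHalf a b c d i) = {x | skWall a b c d i x = 0} := by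
  rw [(isOpen_skHalf i).frontier_eq, closure_skHalf]
  ext x
  simp only [skHalf, mem_sdiff, mem_ofPred_eq, not_lt]
  exact ⟨fun h => le_antisymm h.2 h.1, fun h => ⟨h.ge, h.le⟩⟩

theorem mem_quadCell_iff {i : Fin 3} {x : Sk a b c d} :
    x ∈ quadCell a b c d i ↔ -x.1 0 + -x.1 1 + -x.1 2 = 2 * -x.1 i := by
  change x.1 0 + x.1 1 + x.1 2 = 2 * x.1 i ↔ _
  constructor <;> intro h <;> linarith

/-- On this cell 2u_i is the full maximum and so dominates m_i. -/
theorem quadCell_subset (i : Fin 3) : quadCell a b c d i ⊆ {x | 0 ≤ skWall a b c d i x} := by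
  intro x hx
  rw [mem_quadCell_iff] at hx
  have h := (isSkPoint_iff i).1 (isSkPoint_neg x)
  have h1 : -x.1 i + -x.1 (i + 1) + -x.1 (i + 2) = -x.1 0 + -x.1 1 + -x.1 2 := by
    fin_cases i
    · rfl
    · change -x.1 1 + -x.1 2 + -x.1 0 = _; ring
    · change -x.1 2 + -x.1 0 + -x.1 1 = _; ring
  simp only [Pi.neg_apply] at h
  have h2 := le_max_right (soloMax (linVal a b c) i (-x.1))
    (flipMax (linVal a b c) (negVal d) i (-x.1))
  change 0 ≤ 2 * -x.1 i - flipMax (linVal a b c) (negVal d) i (-x.1)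
  linarith

theorem skHalf_subset_cells (i : Fin 3) :
    skHalf a b c d i ⊆ quadCell a b c d i ∪ linCell a b c d i := by
  intro x hx
  have h1 := (isSkPoint_neg x).sum_eq_soloMax (i := i) (le_of_lt hx)
  simp only [Pi.neg_apply] at h1
  rcases le_total (linVal a b c i + -x.1 i) (2 * -x.1 i) with h | h
  · left
    rw [mem_quadCell_iff, h1]
    exact max_eq_left h
  · by_cases h' : linVal a b c i + -x.1 i = 2 * -x.1 i
    · left
      rw [mem_quadCell_iff, h1]
      exact max_eq_left h'.le
    · right
      have e : ((x.1 0 + x.1 1 + x.1 2 : ℝ) : WithTop ℝ) =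
          ((-(soloMax (linVal a b c) i (-x.1)) : ℝ) : WithTop ℝ) := by
        rw [WithTop.coe_inj]; linarith
      change ((x.1 0 + x.1 1 + x.1 2 : ℝ) : WithTop ℝ) = _
      have h0 := sk_nonpos x.2 i
      -- A strict inequality 2u_i < p_i + u_i forces p_i > u_i ≥ 0. Hence the truncation in `negVal`
      -- is inactive and the term is a genuine tropical monomial with finite coefficient.
      have key : ∀ e : WithTop ℝ, negVal e + -x.1 i ≠ 2 * -x.1 i →
          2 * -x.1 i ≤ negVal e + -x.1 i →
          ((-(max (2 * -x.1 i) (negVal e + -x.1 i)) : ℝ) : WithTop ℝ) =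
            e + (x.1 i : WithTop ℝ) := by
        intro e he he'
        rw [coe_neg_soloMax e h0, min_eq_right]
        have hlt : 2 * -x.1 i < negVal e + -x.1 i := lt_of_le_of_ne he' he.symm
        induction e using WithTop.recTopCoe with
        | top => simp [negVal] at hlt; linarith
        | coe e =>
          norm_cast
          simp only [negVal, WithTop.untopD_coe] at hlt
          rcases max_cases (-e) 0 with h2 | h2 <;> linarith
      rw [e]
      fin_cases i
      · exact key a h' h
      · exact key b h' h
      · exact key c h' h

theorem isVietaDomains_skHalf (a b c d : WithTop ℝ) :
    IsVietaDomains a b c d (skHalf a b c d) where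
  halfSpace i := by
    obtain ⟨φ, hφ⟩ := exists_chart a b c d i
    refine ⟨φ, ?_⟩
    have h : skHalf a b c d i = φ ⁻¹' {p | 0 < p.1} := by ext x; simp [skHalf, hφ]
    rw [h, image_preimage_eq _ φ.surjective]
  image i := by
    rw [closure_skHalf]
    ext x
    simp only [mem_image, mem_compl_iff, mem_ofPred_eq, not_le, skHalf]
    constructor
    · rintro ⟨y, hy, rfl⟩
      rw [skWall_skVieta]; linarith
    · intro hx
      refine ⟨skVieta a b c d i x, ?_, Subtype.ext (tropVieta_tropVieta a b c d i x)⟩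
      rw [skWall_skVieta]; linarith
  frontier_eq i := by
    rw [frontier_skHalf]
    ext x
    exact (skVieta_eq_self_iff i x).symm
  subset_cells := skHalf_subset_cells
  interior_subset i := by
    rw [← interior_closure_skHalf, closure_skHalf]
    exact interior_mono (quadCell_subset i)
  disjoint i j hij := by
    rw [Set.disjoint_left]
    intro x hi hj
    exact lt_asymm hj ((skAction a b c d).neg_of_pos i j x hij hi)

/-- Provides a point common to all candidates for D_i, which fixes the side of the wall. -/
theorem interior_quadCell_nonempty (i : Fin 3) : (interior (quadCell a b c d i)).Nonempty := by
  have hp := linVal_nonneg a b c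
  have hD := negVal_nonneg d
  let x : Sk a b c d := (isSkPoint_farPoint hp hD i).toSk
  have hx : -x.1 = farPoint (linVal a b c) (negVal d) i := by simp [x, IsSkPoint.toSk]
  have hc : Continuous fun y : Sk a b c d => -y.1 i :=
    ((continuous_apply i).comp continuous_subtype_val).neg
  let O : Set (Sk a b c d) := skHalf a b c d i ∩ {y | linVal a b c i < -y.1 i}
  have hO : IsOpen O := (isOpen_skHalf i).inter (isOpen_lt continuous_const hc)
  refine ⟨x, mem_interior.2 ⟨O, ?_, hO, ?_, ?_⟩⟩
  · rintro y ⟨hy, hy'⟩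
    rw [mem_ofPred_eq] at hy'
    rw [mem_quadCell_iff]
    have := (isSkPoint_neg y).sum_eq_soloMax (i := i) (le_of_lt hy)
    simp only [Pi.neg_apply, soloMax] at this
    rw [this, max_eq_left (by linarith)]
  · change 0 < wall (linVal a b c) (negVal d) i (-x.1)
    rw [hx]; exact wall_farPoint hp hD i
  · have h1 := lt_farPoint hp hD i
    have h2 := hp i
    have h3 : -x.1 i = farPoint (linVal a b c) (negVal d) i i := congrFun hx i
    rw [mem_ofPred_eq, h3]
    simp only [farPoint, if_true]
    linarith

theorem isPreconnected_halfPlane : IsPreconnected {p : ℝ × ℝ | 0 < p.1} := by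
  have h : {p : ℝ × ℝ | 0 < p.1} = Ioi 0 ×ˢ univ := by ext; simp
  rw [h]
  exact isPreconnected_Ioi.prod isPreconnected_univ

theorem IsVietaDomains.isOpen {D : Fin 3 → Set (Sk a b c d)} (h : IsVietaDomains a b c d D)
    (i : Fin 3) : IsOpen (D i) := by
  obtain ⟨φ, hφ⟩ := h.halfSpace i
  rw [← φ.isOpen_image, hφ]
  exact isOpen_lt continuous_const continuous_fst

theorem IsVietaDomains.isPreconnected {D : Fin 3 → Set (Sk a b c d)}
    (h : IsVietaDomains a b c d D) (i : Fin 3) : IsPreconnected (D i) := by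
  obtain ⟨φ, hφ⟩ := h.halfSpace i
  have : D i = φ.symm '' {p | 0 < p.1} := by
    rw [← hφ, image_image]; simp
  rw [this]
  exact isPreconnected_halfPlane.image _ φ.symm.continuous.continuousOn

/-- Both sets have the fixed set of s_i as frontier. The connected set D i avoids it, so it lies in
D' i or in its exterior, and it meets D' i in the interior of the quadratic cell. -/
theorem IsVietaDomains.subset {D D' : Fin 3 → Set (Sk a b c d)} (h : IsVietaDomains a b c d D)
    (h' : IsVietaDomains a b c d D') (i : Fin 3) : D i ⊆ D' i := by
  obtain ⟨x, hx⟩ := interior_quadCell_nonempty (a := a) (b := b) (c := c) (d := d) i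
  by_contra hn
  obtain ⟨y, hy, hy'⟩ := not_subset.1 hn
  have hfr : frontier (D' i) = frontier (D i) := by rw [h'.frontier_eq, h.frontier_eq]
  have hsub : D i ⊆ D' i ∪ (closure (D' i))ᶜ := by
    intro z hz
    by_contra hcon
    simp only [mem_union, mem_compl_iff, not_or, not_not] at hcon
    have h1 : z ∈ frontier (D' i) := by
      rw [(h'.isOpen i).frontier_eq]; exact ⟨hcon.2, hcon.1⟩
    rw [hfr, (h.isOpen i).frontier_eq] at h1
    exact h1.2 hz
  obtain ⟨z, -, hz, hz'⟩ := h.isPreconnected i _ _ (h'.isOpen i) isClosed_closure.isOpen_compl hsub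
    ⟨x, h.interior_subset i hx, h'.interior_subset i hx⟩
    ⟨y, hy, (hsub hy).resolve_left hy'⟩
  exact hz' (subset_closure hz)

theorem IsVietaDomains.eq_skHalf {D : Fin 3 → Set (Sk a b c d)} (h : IsVietaDomains a b c d D) :
    D = skHalf a b c d :=
  funext fun i => (h.subset (isVietaDomains_skHalf a b c d) i).antisymm
    ((isVietaDomains_skHalf a b c d).subset h i)

theorem isPingPong_skHalf (a b c d : WithTop ℝ) :
    IsPingPong (skVieta a b c d) (skHalf a b c d) where
  isOpen := isOpen_skHalf
  disjoint := (isVietaDomains_skHalf a b c d).disjoint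
  image_subset i j hij := by
    rintro _ ⟨x, hx, rfl⟩
    have := (skAction a b c d).neg_of_pos i j x hij hx
    change 0 < skWall a b c d j (skVieta a b c d j x)
    rw [skWall_skVieta]; linarith
  fixes_frontier i x hx := by
    rw [frontier_skHalf] at hx
    exact (skVieta_eq_self_iff i x).2 hx
  image_eq := (isVietaDomains_skHalf a b c d).image

theorem pingPongTable_skHalf : pingPongTable (skHalf a b c d) = wallTable (skWall a b c d) := by
  ext x
  simp only [pingPongTable, pingPongNet, closure_skHalf, frontier_skHalf, mem_union, mem_compl_iff,
    mem_iUnion, mem_sdiff, mem_ofPred_eq, not_exists, not_le, wallTable, exists_prop, not_and]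
  constructor
  · rintro (h | ⟨i, hi, h⟩)
    · exact ⟨fun i => (h i).le, fun i j hi _ => absurd hi (h i).ne⟩
    · refine ⟨fun j => ?_, fun j k hj hk => ?_⟩
      · by_cases hj : j = i
        · exact hj ▸ hi.le
        · exact (h j hj).le
      · have hji : j = i := by
          by_contra hne
          exact (h j hne).ne hj
        have hki : k = i := by
          by_contra hne
          exact (h k hne).ne hk
        exact hji.trans hki.symm
  · rintro ⟨h, h'⟩
    by_cases hz : ∃ i, skWall a b c d i x = 0
    · obtain ⟨i, hi⟩ := hz
      exact Or.inr ⟨i, hi, fun j hj => lt_of_le_of_ne (h j) fun h0 => hj (h' _ _ h0 hi)⟩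
    · push Not at hz
      exact Or.inl fun i => lt_of_le_of_ne (h i) (hz i)

theorem vietaOrbit_eq (T : Set (Sk a b c d)) :
    vietaOrbit a b c d T = translates (vietaGroup a b c d).subtype T := rfl

end

/-! ### The orbit of the table is dense; its complement consists of translated corners. -/

noncomputable section

variable {a b c d : WithTop ℝ}

theorem isClosed_Sk (a b c d : WithTop ℝ) : IsClosed (Sk a b c d) := by
  have h : Sk a b c d = {x | IsSkPoint (linVal a b c) (negVal d) (-x)} := by
    ext x
    rw [mem_ofPred_eq, ← mem_Sk_iff_neg, neg_neg]
  rw [h]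
  unfold IsSkPoint soloMax
  exact isClosed_eq (by fun_prop) (by fun_prop)

/-- The monotonicity behind the descent: reflecting a point with h_i > 0 raises the nonpositive
coordinate x_i. -/
theorem skVieta_self (i : Fin 3) (x : Sk a b c d) :
    (skVieta a b c d i x).1 i = x.1 i + skWall a b c d i x := by
  have h := neg_skVieta_self i x
  simp only [skWall, wall, Pi.neg_apply]
  linarith

/-- The corner `k` of the closed chamber, where the two walls other than the `k`-th one meet. -/
def skCorner (a b c d : WithTop ℝ) (k : Fin 3) : Set (Sk a b c d) :=
  {x | ∀ i, i ≠ k → skWall a b c d i x = 0}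

theorem exists_ne_ne (i k : Fin 3) : ∃ j : Fin 3, j ≠ i ∧ j ≠ k := by
  revert i k; decide

theorem exists_third {i j : Fin 3} (hij : i ≠ j) :
    ∃ k : Fin 3, k ≠ i ∧ k ≠ j ∧ ∀ l, l ≠ k → l = i ∨ l = j := by
  revert i j; decide

theorem exists_skWall_ne_zero (hne : 0 < negVal d ∨ ∃ i, 0 < linVal a b c i) (x : Sk a b c d) :
    ∃ i, skWall a b c d i x ≠ 0 :=
  (isSkPoint_neg x).exists_wall_ne_zero hne

/-- In the meromorphic case every orbit meets the closed chamber. -/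
theorem exists_apply_skWall_nonpos (hne : 0 < negVal d ∨ ∃ i, 0 < linVal a b c i)
    (x : Sk a b c d) : ∃ g : vietaGroup a b c d, ∀ i, skWall a b c d i (g.1 x) ≤ 0 := by
  refine (skAction a b c d).exists_apply_nonpos (fun i x => x.1 i)
    (fun i => (continuous_apply i).comp continuous_subtype_val) (fun i x => sk_nonpos x.2 i)
    ?_ skVieta_self (fun i j x hj => skVieta_of_ne hj x) ?_ ?_ (exists_skWall_ne_zero hne) x
  · intro y L hL
    have h1 : Filter.Tendsto (fun n => (y n).1) Filter.atTop (𝓝 L) := tendsto_pi_nhds.2 hL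
    have h2 : L ∈ Sk a b c d := (isClosed_Sk a b c d).mem_of_tendsto h1
      (Filter.Eventually.of_forall fun n => (y n).2)
    exact ⟨⟨L, h2⟩, tendsto_subtype_rng.2 h1⟩
  · intro i j x hj hx h0
    exact (isSkPoint_neg x).ne_zero_of_wall_pos hj hx (by simp only [Pi.neg_apply, h0, neg_zero])
  · intro i j k x hij hki hkj hi hj
    have := ((isSkPoint_neg x).corner hij hki hkj (le_of_eq hi.symm) (le_of_eq hj.symm)).2
    simpa using this

/-- The open subset swept out by the table. -/
def skDomain (a b c d : WithTop ℝ) : Set (Sk a b c d) :=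
  translates (vietaGroup a b c d).subtype (wallTable (skWall a b c d))

theorem skCorner_nonpos {k : Fin 3} {x : Sk a b c d} (hx : x ∈ skCorner a b c d k) (i : Fin 3) :
    skWall a b c d i x ≤ 0 := by
  by_cases hi : i = k
  · subst hi
    by_contra! h
    have := (skAction a b c d).neg_of_pos i (i + 1) x (add_one_ne i).symm h
    linarith [hx (i + 1) (add_one_ne i)]
  · exact (hx i hi).le

/-- Corners belong to the closed chamber, where orbits do not repeat, so a translate of a table
point could only be a corner if that table point were on two walls. -/
theorem disjoint_skCorner_skDomain {k : Fin 3} {x : Sk a b c d} (hx : x ∈ skCorner a b c d k) :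
    x ∉ skDomain a b c d := by
  rintro ⟨g, y, hy, rfl⟩
  have h1 := (skAction a b c d).apply_mem_table_iff hy.1 (skCorner_nonpos hx)
  rw [h1] at hx
  exact add_two_ne_add_one k (hy.2 _ _ (hx _ (add_two_ne k)) (hx _ (add_one_ne k)))

/-- The group element represented by a word. -/
def vietaWord (a b c d : WithTop ℝ) (w : List (Fin 3)) : vietaGroup a b c d :=
  (w.map (vietaGen a b c d)).prod

theorem compl_skDomain (hne : 0 < negVal d ∨ ∃ i, 0 < linVal a b c i) :
    (skDomain a b c d)ᶜ = ⋃ q : {q : Fin 3 × List (Fin 3) // ReducedWord {i | i ≠ q.1} q.2},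
      (vietaWord a b c d q.1.2).1 '' skCorner a b c d q.1.1 := by
  have A := skAction a b c d
  ext y
  simp only [mem_compl_iff, mem_iUnion]
  constructor
  · intro hy
    obtain ⟨g, hg⟩ := exists_apply_skWall_nonpos hne y
    have h1 : g.1 y ∉ wallTable (skWall a b c d) := fun h =>
      hy ⟨g⁻¹, g.1 y, h, ReflectionAction.apply_inv_apply (ρ := (vietaGroup a b c d).subtype) g y⟩
    have h2 : ∃ i j, skWall a b c d i (g.1 y) = 0 ∧ skWall a b c d j (g.1 y) = 0 ∧ i ≠ j := by
      by_contra! hcon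
      exact h1 ⟨hg, hcon⟩
    obtain ⟨i, j, hi, hj, hij⟩ := h2
    obtain ⟨k, hki, hkj, hk⟩ := exists_third hij
    have hc : g.1 y ∈ skCorner a b c d k := by
      intro l hl
      rcases hk l hl with rfl | rfl <;> assumption
    -- The reflections in the walls i ≠ k fix the corner, so the right factor z can be dropped and
    -- w, if nonempty, ends in k. This normal form is what makes the image a ray.
    obtain ⟨w, z, hw, hz, he⟩ := exists_reducedWord A.mul_self A.closure_eq_top {i | i ≠ k} g⁻¹
    refine ⟨⟨⟨k, w⟩, hw⟩, g.1 y, hc, ?_⟩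
    have h3 : z.1 (g.1 y) = g.1 y := A.apply_eq_of_mem_closure (fun i hi => hc i hi) hz
    have h4 := ReflectionAction.apply_inv_apply (ρ := (vietaGroup a b c d).subtype) g y
    rw [he, ReflectionAction.apply_mul] at h4
    change (vietaWord a b c d w).1 (z.1 (g.1 y)) = y at h4
    rwa [h3] at h4
  · rintro ⟨⟨⟨k, w⟩, hw⟩, x, hx, rfl⟩ hy
    exact disjoint_skCorner_skDomain hx (ReflectionAction.mem_translates_of_apply
      (ρ := (vietaGroup a b c d).subtype) (vietaWord a b c d w) hy)

theorem isClosed_skCorner (k : Fin 3) : IsClosed (skCorner a b c d k) := by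
  have : skCorner a b c d k = ⋂ i, ⋂ (_ : i ≠ k), {x | skWall a b c d i x = 0} := by
    ext; simp [skCorner]
  rw [this]
  exact isClosed_iInter fun i => isClosed_iInter fun _ =>
    isClosed_eq (continuous_skWall i) continuous_const

theorem interior_skCorner (k : Fin 3) : interior (skCorner a b c d k) = ∅ := by
  have h : skCorner a b c d k ⊆ frontier (skHalf a b c d (k + 1)) := by
    rw [frontier_skHalf]
    intro x hx
    exact hx _ (add_one_ne k)
  have h1 : interior (frontier (skHalf a b c d (k + 1))) = ∅ := by
    rw [← frontier_compl]
    exact interior_frontier (isOpen_skHalf _).isClosed_compl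
  exact subset_empty_iff.1 (h1 ▸ interior_mono h)

/-- Baire: the complement is a countable union of closed sets, each the image of a corner and hence
without interior. -/
theorem dense_skDomain (hne : 0 < negVal d ∨ ∃ i, 0 < linVal a b c i) :
    Dense (skDomain a b c d) := by
  have : CompleteSpace (Sk a b c d) := (isClosed_Sk a b c d).completeSpace_coe
  rw [← compl_compl (skDomain a b c d), compl_skDomain hne, compl_iUnion]
  refine dense_iInter_of_isOpen (fun q => ?_) (fun q => ?_)
  · rw [isOpen_compl_iff, Homeomorph.isClosed_image]
    exact isClosed_skCorner _
  · rw [← interior_eq_empty_iff_dense_compl, ← Homeomorph.image_interior, interior_skCorner,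
      image_empty]

/-! ### The complementary rays -/

/-- The maximum m_i lies between the term 2u_j and the total maximum, which equals 2u_j on this
cell. Hence s_i is linear there and carries the j-th cell into the i-th one. -/
theorem skVieta_of_quadCell {i j : Fin 3} (hij : i ≠ j) {x : Sk a b c d}
    (hx : x ∈ quadCell a b c d j) :
    (skVieta a b c d i x).1 = Function.update x.1 i (2 * x.1 j - x.1 i) ∧
      skVieta a b c d i x ∈ quadCell a b c d i := by
  have h1 := (isSkPoint_iff i).1 (isSkPoint_neg x)
  have h2 : 2 * (-x.1) j ≤ flipMax (linVal a b c) (negVal d) i (-x.1) :=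
    two_mul_le_flipMax hij.symm
  have h3 := le_max_right (soloMax (linVal a b c) i (-x.1))
    (flipMax (linVal a b c) (negVal d) i (-x.1))
  have h4 : ∀ y : Fin 3 → ℝ, y i + y (i + 1) + y (i + 2) = y 0 + y 1 + y 2 := by
    intro y
    fin_cases i
    · rfl
    · change y 1 + y 2 + y 0 = _; ring
    · change y 2 + y 0 + y 1 = _; ring
  have hx' : x.1 0 + x.1 1 + x.1 2 = 2 * x.1 j := hx
  have h5 := h4 x.1
  simp only [Pi.neg_apply] at *
  have h6 : flipMax (linVal a b c) (negVal d) i (-x.1) = -(2 * x.1 j) := by linarith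
  have h7 := neg_skVieta_self i x
  have h8 : (skVieta a b c d i x).1 = Function.update x.1 i (2 * x.1 j - x.1 i) := by
    funext l
    by_cases hl : l = i
    · subst hl; rw [Function.update_self]; linarith
    · rw [Function.update_of_ne hl, skVieta_of_ne hl]
  refine ⟨h8, ?_⟩
  change (skVieta a b c d i x).1 0 + (skVieta a b c d i x).1 1 + (skVieta a b c d i x).1 2 =
    2 * (skVieta a b c d i x).1 i
  rw [← h4, h8, Function.update_self, Function.update_of_ne (add_one_ne i),
    Function.update_of_ne (add_two_ne i)]
  linarith

theorem isRay_image_skVieta {i j : Fin 3} (hij : i ≠ j) {R : Set (Sk a b c d)}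
    (hR : R ⊆ quadCell a b c d j) (hray : IsRay (Subtype.val '' R)) :
    IsRay (Subtype.val '' (skVieta a b c d i '' R)) := by
  obtain ⟨p, v, hv, he⟩ := hray
  let L : (Fin 3 → ℝ) → Fin 3 → ℝ := fun x => Function.update x i (2 * x j - x i)
  have hL : ∀ t : ℝ, L (p + t • v) = L p + t • L v := by
    intro t
    funext l
    by_cases hl : l = i
    · subst hl; simp [L]; ring
    · simp [L, Function.update_of_ne hl]
  refine ⟨L p, L v, ?_, ?_⟩
  · intro h0
    apply hv
    have h1 : ∀ l, l ≠ i → v l = 0 := fun l hl => by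
      have := congrFun h0 l
      simpa [L, Function.update_of_ne hl] using this
    funext l
    by_cases hl : l = i
    · subst hl
      have := congrFun h0 l
      simpa [L, h1 j hij.symm] using this
    · exact h1 l hl
  · have h1 : Subtype.val '' (skVieta a b c d i '' R) = L '' (Subtype.val '' R) := by
      rw [image_image, image_image]
      exact image_congr fun x hx => (skVieta_of_quadCell hij (hR hx)).1
    rw [h1, he]
    ext x
    constructor
    · rintro ⟨_, ⟨t, ht, rfl⟩, rfl⟩
      exact ⟨t, ht, hL t⟩
    · rintro ⟨t, ht, rfl⟩
      exact ⟨_, ⟨t, ht, rfl⟩, hL t⟩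

theorem skCorner_subset_quadCell {j k : Fin 3} (hjk : j ≠ k) :
    skCorner a b c d k ⊆ quadCell a b c d j := by
  intro x hx
  obtain ⟨i, hij, hik⟩ : ∃ i : Fin 3, j ≠ i ∧ i ≠ k := by
    clear hx; revert j k; decide
  have h := (isSkPoint_neg x).corner hij hjk.symm hik.symm (hx j hjk).ge (hx i hik).ge
  simp only [Pi.neg_apply] at h
  change x.1 0 + x.1 1 + x.1 2 = 2 * x.1 j
  have h1 : x.1 0 + x.1 1 + x.1 2 = x.1 j + x.1 i + x.1 k := by
    clear h hx
    fin_cases i <;> fin_cases j <;> fin_cases k <;> simp at hij hjk hik ⊢ <;> ring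
  linarith [h.1, h.2]

theorem isRay_skCorner (k : Fin 3) : IsRay (Subtype.val '' skCorner a b c d k) := by
  set p := linVal a b c with hp
  set D := negVal d with hD
  have hp0 := linVal_nonneg a b c
  -- On the ray u = s(0, 1, 1), with 0 at place k, the walls i ≠ k vanish exactly when no term
  -- exceeds 2s. The terms p_{k+1} + s, p_{k+2} + s, p_k and D give the four bounds on s.
  set T := max (max (p (k + 1)) (p (k + 2))) (max (p k / 2) (D / 2)) with hT
  have hT0 : 0 ≤ T := le_max_of_le_left (le_max_of_le_left (hp0 _))
  set v := vecAt k 0 1 1 with hv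
  have hs : ∀ s, s • v = vecAt k 0 s s := fun s =>
    eq_vecAt k (by simp [hv, vecAt_self]) (by simp [hv, vecAt_add_one])
      (by simp [hv, vecAt_add_two])
  have hmax : ∀ s, T ≤ s ↔ (p (k + 1) ≤ s ∧ p (k + 2) ≤ s) ∧ p k / 2 ≤ s ∧ D / 2 ≤ s := by
    intro s; simp only [hT, max_le_iff]
  refine ⟨-(T • v), -v, ?_, ?_⟩
  · intro h0
    have := congrFun h0 (k + 1)
    simp [hv, vecAt_add_one] at this
  · ext y
    constructor
    · rintro ⟨x, hx, rfl⟩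
      have hc := (isSkPoint_neg x).corner (add_two_ne_add_one k).symm (add_one_ne k).symm
        (add_two_ne k).symm (hx _ (add_one_ne k)).ge (hx _ (add_two_ne k)).ge
      have hw : 2 * (-x.1) (k + 1) - flipMax p D (k + 1) (-x.1) = 0 := hx _ (add_one_ne k)
      have hw' : 2 * (-x.1) (k + 2) - flipMax p D (k + 2) (-x.1) = 0 := hx _ (add_two_ne k)
      have g1 : D ≤ flipMax p D (k + 1) (-x.1) := le_flipMax _ _ _ _
      have g2 : p k + (-x.1) k ≤ flipMax p D (k + 1) (-x.1) := add_le_flipMax (add_one_ne k).symm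
      have g3 : p (k + 2) + (-x.1) (k + 2) ≤ flipMax p D (k + 1) (-x.1) :=
        add_le_flipMax (add_two_ne_add_one k)
      have g4 : p (k + 1) + (-x.1) (k + 1) ≤ flipMax p D (k + 2) (-x.1) :=
        add_le_flipMax (add_two_ne_add_one k).symm
      have hTs : T ≤ (-x.1) (k + 1) := by
        rw [hmax]; refine ⟨⟨?_, ?_⟩, ?_, ?_⟩ <;> linarith
      have : -x.1 = (-x.1) (k + 1) • v := by
        rw [hs]; exact eq_vecAt k hc.2 rfl hc.1.symm
      refine ⟨(-x.1) (k + 1) - T, by linarith, (neg_eq_iff_eq_neg.1 this).trans ?_⟩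
      module
    · rintro ⟨s, hs0, rfl⟩
      set r := T + s with hr
      have hrT : T ≤ r := by linarith
      obtain ⟨⟨b1, b2⟩, b3, b4⟩ := (hmax r).1 hrT
      have hpt : IsSkPoint p D (r • v) := by
        rw [hs, isSkPoint_iff k]
        simp only [flipMax, soloMax, vecAt_self, vecAt_add_one, vecAt_add_two]
        apply le_antisymm
        · exact le_max_of_le_right (le_max_of_le_right (le_max_of_le_left
            (le_max_of_le_left (by linarith))))
        · simp only [max_le_iff]; refine ⟨⟨?_, ?_⟩, ?_, ⟨?_, ?_⟩, ?_, ?_⟩ <;> linarith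
      refine ⟨hpt.toSk, ?_, ?_⟩
      · have hw : ∀ i, i ≠ k → wall p D i (r • v) = 0 := by
          intro i hi
          have hri : (r • v) i = r := by
            rw [hs]
            rcases eq_add_one_or_eq_add_two hi with rfl | rfl
            · exact vecAt_add_one _ _ _ _
            · exact vecAt_add_two _ _ _ _
          have : flipMax p D i (r • v) = 2 * r := by
            apply le_antisymm
            · rw [flipMax_le_iff]
              refine ⟨by linarith, fun j hj => ?_⟩
              by_cases hjk : j = k
              · subst hjk
                rw [hs, vecAt_self]; constructor <;> linarith
              · rw [hs]
                rcases eq_add_one_or_eq_add_two hjk with rfl | rfl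
                · rw [vecAt_add_one]; constructor <;> linarith
                · rw [vecAt_add_two]; constructor <;> linarith
            · obtain ⟨j, hji, hjk⟩ : ∃ j : Fin 3, j ≠ i ∧ j ≠ k := exists_ne_ne i k
              have hrj : (r • v) j = r := by
                rw [hs]
                rcases eq_add_one_or_eq_add_two hjk with rfl | rfl
                · exact vecAt_add_one _ _ _ _
                · exact vecAt_add_two _ _ _ _
              have := two_mul_le_flipMax (p := p) (D := D) (u := r • v) hji
              rwa [hrj] at this
          rw [wall, hri, this, sub_self]
        intro i hi
        change wall p D i (- -(r • v)) = 0
        rw [neg_neg]; exact hw i hi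
      · change -(r • v) = _
        rw [hr]; module

/-- Corner k lies in the quadratic cells of the other two indices and the first letter to act is k.
As neighbouring letters differ, every letter acts on the quadratic cell of a different index, hence
linearly. -/
theorem isRay_vietaWord (k : Fin 3) {w : List (Fin 3)} (hw : ReducedWord {i | i ≠ k} w) :
    IsRay (Subtype.val '' ((vietaWord a b c d w).1 '' skCorner a b c d k)) ∧
      ∀ i l, w = i :: l → (vietaWord a b c d w).1 '' skCorner a b c d k ⊆ quadCell a b c d i := by
  have hcons : ∀ i l, (vietaWord a b c d (i :: l)).1 '' skCorner a b c d k =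
      skVieta a b c d i '' ((vietaWord a b c d l).1 '' skCorner a b c d k) := by
    intro i l
    rw [image_image]; rfl
  have hnil : (vietaWord a b c d []).1 '' skCorner a b c d k = skCorner a b c d k := by
    change id '' _ = _
    exact image_id _
  induction hw with
  | nil => exact ⟨by rw [hnil]; exact isRay_skCorner k, fun i l hl => by cases hl⟩
  | @single i hi =>
    have hik : i = k := by simpa using hi
    subst hik
    have hq := skCorner_subset_quadCell (a := a) (b := b) (c := c) (d := d) (add_one_ne i)
    rw [hcons, hnil]
    refine ⟨isRay_image_skVieta (add_one_ne i).symm hq (isRay_skCorner i), ?_⟩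
    intro i' l hl
    cases hl
    rintro _ ⟨x, hx, rfl⟩
    exact (skVieta_of_quadCell (add_one_ne i).symm (hq hx)).2
  | @cons i j l hij _ ih =>
    have hq := ih.2 j l rfl
    rw [hcons]
    refine ⟨isRay_image_skVieta hij hq ih.1, ?_⟩
    intro i' l' hl
    cases hl
    rintro _ ⟨x, hx, rfl⟩
    exact (skVieta_of_quadCell hij (hq hx)).2

theorem exists_rays (hne : 0 < negVal d ∨ ∃ i, 0 < linVal a b c i) :
    ∃ 𝓡 : Set (Set (Fin 3 → ℝ)), 𝓡.Countable ∧ (∀ R ∈ 𝓡, IsRay R) ∧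
      Subtype.val '' (skDomain a b c d)ᶜ = ⋃₀ 𝓡 := by
  refine ⟨range fun q : {q : Fin 3 × List (Fin 3) // ReducedWord {i | i ≠ q.1} q.2} =>
    Subtype.val '' ((vietaWord a b c d q.1.2).1 '' skCorner a b c d q.1.1),
    countable_range _, ?_, ?_⟩
  · rintro _ ⟨⟨⟨k, w⟩, hw⟩, rfl⟩
    exact (isRay_vietaWord k hw).1
  · rw [compl_skDomain hne, image_iUnion, sUnion_range]

end

noncomputable section

/-! ### The triangle group acting on the upper half-plane -/

/-- Homogeneous coordinates on the hyperbolic plane, normalized by `λ₁λ₂ + λ₂λ₃ + λ₃λ₁ = 1`, in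
which the sides of the ideal triangle with vertices `0, 1, ∞` are the coordinate lines. -/
def triCoord (i : Fin 3) (z : ℍ) : ℝ :=
  ![(1 - z.re) / z.im, (z.re ^ 2 + z.im ^ 2 - z.re) / z.im, z.re / z.im] i

theorem triCoord_zero (z : ℍ) : triCoord 0 z = (1 - z.re) / z.im := rfl

theorem triCoord_one (z : ℍ) : triCoord 1 z = (z.re ^ 2 + z.im ^ 2 - z.re) / z.im := rfl

theorem triCoord_two (z : ℍ) : triCoord 2 z = z.re / z.im := rfl

theorem continuous_triCoord (i : Fin 3) : Continuous (triCoord i) := by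
  fin_cases i
  · change Continuous fun z : ℍ => (1 - z.re) / z.im
    exact Continuous.div (by fun_prop) (by fun_prop) fun z => z.im_ne_zero
  · change Continuous fun z : ℍ => (z.re ^ 2 + z.im ^ 2 - z.re) / z.im
    exact Continuous.div (by fun_prop) (by fun_prop) fun z => z.im_ne_zero
  · change Continuous fun z : ℍ => z.re / z.im
    exact Continuous.div (by fun_prop) (by fun_prop) fun z => z.im_ne_zero

theorem re_triReflection_zero (z : ℍ) : (triReflection 0 • z).re = 2 - z.re := by
  rw [re_smul]
  simp [num, denom, triReflection]
  ring

theorem im_triReflection_zero (z : ℍ) : (triReflection 0 • z).im = z.im := by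
  rw [im_smul]
  simp [num, denom, triReflection, abs_of_pos z.im_pos]

theorem re_triReflection_two (z : ℍ) : (triReflection 2 • z).re = -z.re := by
  rw [re_smul]
  simp [num, denom, triReflection]

theorem im_triReflection_two (z : ℍ) : (triReflection 2 • z).im = z.im := by
  rw [im_smul]
  simp [num, denom, triReflection, abs_of_pos z.im_pos]

/-- The denominator of the second reflection. -/
def flipDenom (z : ℍ) : ℝ := (2 * z.re - 1) ^ 2 + (2 * z.im) ^ 2

theorem flipDenom_pos (z : ℍ) : 0 < flipDenom z := by
  have := z.im_pos
  unfold flipDenom; positivity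

theorem re_triReflection_one (z : ℍ) :
    (triReflection 1 • z).re = (2 * (z.re ^ 2 + z.im ^ 2) - z.re) / flipDenom z := by
  rw [re_smul]
  simp [num, denom, triReflection, flipDenom, Complex.div_re, Complex.normSq_apply]
  rw [← add_div]
  congr 1 <;> ring

theorem im_triReflection_one (z : ℍ) : (triReflection 1 • z).im = z.im / flipDenom z := by
  rw [im_smul_eq_div_normSq]
  simp [denom, triReflection, flipDenom, Complex.normSq_apply]
  congr 1; ring

theorem triCoord_triReflection_self (i : Fin 3) (z : ℍ) :
    triCoord i (triReflection i • z) = -triCoord i z := by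
  have h1 := z.im_ne_zero
  have h2 := (flipDenom_pos z).ne'
  fin_cases i
  · change triCoord 0 (triReflection 0 • z) = -triCoord 0 z
    rw [triCoord_zero, triCoord_zero, re_triReflection_zero, im_triReflection_zero]
    ring
  · change triCoord 1 (triReflection 1 • z) = -triCoord 1 z
    rw [triCoord_one, triCoord_one, re_triReflection_one, im_triReflection_one]
    field_simp
    unfold flipDenom
    ring
  · change triCoord 2 (triReflection 2 • z) = -triCoord 2 z
    rw [triCoord_two, triCoord_two, re_triReflection_two, im_triReflection_two]
    ring

/-- In these coordinates the reflections are linear maps preserving λ₀λ₁ + λ₁λ₂ + λ₂λ₀. -/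
theorem triCoord_triReflection_of_ne {i j : Fin 3} (hij : j ≠ i) (z : ℍ) :
    triCoord j (triReflection i • z) = triCoord j z + 2 * triCoord i z := by
  have h1 := z.im_ne_zero
  have h2 := (flipDenom_pos z).ne'
  fin_cases i <;> fin_cases j
  · exact absurd rfl hij
  · change triCoord 1 (triReflection 0 • z) = triCoord 1 z + 2 * triCoord 0 z
    rw [triCoord_one, triCoord_one, triCoord_zero, re_triReflection_zero, im_triReflection_zero]
    ring
  · change triCoord 2 (triReflection 0 • z) = triCoord 2 z + 2 * triCoord 0 z
    rw [triCoord_two, triCoord_two, triCoord_zero, re_triReflection_zero, im_triReflection_zero]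
    ring
  · change triCoord 0 (triReflection 1 • z) = triCoord 0 z + 2 * triCoord 1 z
    rw [triCoord_zero, triCoord_zero, triCoord_one, re_triReflection_one, im_triReflection_one]
    field_simp
    unfold flipDenom
    ring
  · exact absurd rfl hij
  · change triCoord 2 (triReflection 1 • z) = triCoord 2 z + 2 * triCoord 1 z
    rw [triCoord_two, triCoord_two, triCoord_one, re_triReflection_one, im_triReflection_one]
    field_simp
    ring
  · change triCoord 0 (triReflection 2 • z) = triCoord 0 z + 2 * triCoord 2 z
    rw [triCoord_zero, triCoord_zero, triCoord_two, re_triReflection_two, im_triReflection_two]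
    ring
  · change triCoord 1 (triReflection 2 • z) = triCoord 1 z + 2 * triCoord 2 z
    rw [triCoord_one, triCoord_one, triCoord_two, re_triReflection_two, im_triReflection_two]
    ring
  · exact absurd rfl hij

theorem triCoord_add_zero_one (z : ℍ) :
    triCoord 0 z + triCoord 1 z = ((z.re - 1) ^ 2 + z.im ^ 2) / z.im := by
  rw [triCoord_zero, triCoord_one]; ring

theorem triCoord_add_one_two (z : ℍ) :
    triCoord 1 z + triCoord 2 z = (z.re ^ 2 + z.im ^ 2) / z.im := by
  rw [triCoord_one, triCoord_two]; ring

theorem triCoord_add_two_zero (z : ℍ) : triCoord 2 z + triCoord 0 z = 1 / z.im := by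
  rw [triCoord_two, triCoord_zero]; ring

/-- Each pair sum is 1 / Im z or |z - v|² / Im z, for the cusp v at which the two sides meet. So no
two walls meet inside the plane. -/
theorem triCoord_add_pos {i j : Fin 3} (hij : i ≠ j) (z : ℍ) : 0 < triCoord i z + triCoord j z := by
  have h0 := z.im_pos
  have h01 : 0 < triCoord 0 z + triCoord 1 z := by rw [triCoord_add_zero_one]; positivity
  have h12 : 0 < triCoord 1 z + triCoord 2 z := by rw [triCoord_add_one_two]; positivity
  have h20 : 0 < triCoord 2 z + triCoord 0 z := by rw [triCoord_add_two_zero]; positivity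
  fin_cases i <;> fin_cases j
  · exact absurd rfl hij
  · exact h01
  · change 0 < triCoord 0 z + triCoord 2 z; linarith
  · change 0 < triCoord 1 z + triCoord 0 z; linarith
  · exact absurd rfl hij
  · exact h12
  · exact h20
  · change 0 < triCoord 2 z + triCoord 1 z; linarith
  · exact absurd rfl hij

theorem triCoord_quadratic (z : ℍ) :
    triCoord 0 z * triCoord 1 z + triCoord 1 z * triCoord 2 z + triCoord 2 z * triCoord 0 z = 1 := by
  have := z.im_ne_zero
  rw [triCoord_zero, triCoord_one, triCoord_two]
  field_simp
  ring

/-- The wall functions of the triangle group. -/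
def triWall (i : Fin 3) (z : ℍ) : ℝ := -triCoord i z

theorem triReflection_mul_self (i : Fin 3) : triReflection i * triReflection i = 1 := by
  apply Units.ext
  ext k l
  fin_cases i <;> fin_cases k <;> fin_cases l <;>
    simp [triReflection, Matrix.mul_apply, Fin.sum_univ_two]

theorem closure_triGen : Subgroup.closure (range triGen) = ⊤ := closure_range_eq_top rfl

/-- The action of the triangle group on the upper half-plane by homeomorphisms. -/
def triHom : triangleGroup →* (ℍ ≃ₜ ℍ) where
  toFun g :=
    { toFun := fun z => g.1 • z
      invFun := fun z => g.1⁻¹ • z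
      left_inv := fun z => inv_smul_smul g.1 z
      right_inv := fun z => smul_inv_smul g.1 z
      continuous_toFun := continuous_const_smul g.1
      continuous_invFun := continuous_const_smul g.1⁻¹ }
  map_one' := Homeomorph.ext fun z => one_smul (GL (Fin 2) ℝ) z
  map_mul' g g' := Homeomorph.ext fun z => mul_smul g.1 g'.1 z

theorem triReflection_smul_eq_self {i : Fin 3} {z : ℍ} (h : triCoord i z = 0) :
    triReflection i • z = z := by
  have h1 := z.im_ne_zero
  have h2 := (flipDenom_pos z).ne'
  fin_cases i
  · change triCoord 0 z = 0 at h
    rw [triCoord_zero, div_eq_zero_iff, or_iff_left h1] at h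
    refine UpperHalfPlane.ext_re_im ?_ (im_triReflection_zero z)
    change (triReflection 0 • z).re = _
    rw [re_triReflection_zero]; linarith
  · change triCoord 1 z = 0 at h
    rw [triCoord_one, div_eq_zero_iff, or_iff_left h1] at h
    have h3 : flipDenom z = 1 := by unfold flipDenom; linarith
    apply UpperHalfPlane.ext_re_im
    · change (triReflection 1 • z).re = _
      rw [re_triReflection_one, h3]; linarith
    · change (triReflection 1 • z).im = _
      rw [im_triReflection_one, h3, div_one]
  · change triCoord 2 z = 0 at h
    rw [triCoord_two, div_eq_zero_iff, or_iff_left h1] at h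
    refine UpperHalfPlane.ext_re_im ?_ (im_triReflection_two z)
    change (triReflection 2 • z).re = _
    rw [re_triReflection_two]; linarith

theorem triAction : ReflectionAction triGen triHom triWall where
  continuous_wall i := (continuous_triCoord i).neg
  closure_eq_top := closure_triGen
  mul_self i := Subtype.ext (triReflection_mul_self i)
  wall_apply i z := congrArg Neg.neg (triCoord_triReflection_self i z)
  fixed _ _ h := triReflection_smul_eq_self (neg_eq_zero.1 h)
  neg_of_pos i j z hij h := by
    have := triCoord_add_pos hij z
    unfold triWall at *
    linarith

theorem exists_triWall_pos (i : Fin 3) : ∃ z, 0 < triWall i z := by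
  let z₀ : ℍ := ⟨⟨1 / 2, 1⟩, one_pos⟩
  have hre : z₀.re = 1 / 2 := rfl
  have him : z₀.im = 1 := rfl
  have h0 : 0 < triCoord i z₀ := by
    fin_cases i
    · change 0 < triCoord 0 z₀; rw [triCoord_zero, hre, him]; norm_num
    · change 0 < triCoord 1 z₀; rw [triCoord_one, hre, him]; norm_num
    · change 0 < triCoord 2 z₀; rw [triCoord_two, hre, him]; norm_num
  refine ⟨triHom (triGen i) z₀, ?_⟩
  rw [triAction.wall_apply]
  simpa [triWall] using h0

open Filter in
theorem exists_apply_triWall_nonpos (z : ℍ) :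
    ∃ g : triangleGroup, ∀ i, triWall i (triHom g z) ≤ 0 := by
  -- Reflecting in side i adds 4λ_i to λ_{i+1} + λ_{i+2}, whence the factor 1/4, and fixes the other
  -- two pair sums. The condition on corners is vacuous.
  refine triAction.exists_apply_nonpos
    (fun i z => -(triCoord (i + 1) z + triCoord (i + 2) z) / 4)
    (fun i => (((continuous_triCoord _).add (continuous_triCoord _)).neg).div_const 4)
    (fun i z => ?_) ?_ (fun i z => ?_) (fun i j z hij => ?_) (fun i j z _ _ => ?_)
    (fun i j k z hij hki hkj hi hj => ?_) (fun z => ?_) z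
  · have := triCoord_add_pos (add_two_ne_add_one i).symm z
    linarith
  · intro x L hL
    have h0 : Tendsto (fun n => ((x n).re ^ 2 + (x n).im ^ 2) / (x n).im) atTop
        (𝓝 (-4 * L 0)) := by
      refine ((hL 0).const_mul (-4)).congr fun n => ?_
      rw [← triCoord_add_one_two]
      change -4 * (-(triCoord 1 _ + triCoord 2 _) / 4) = _
      ring
    have h1 : Tendsto (fun n => 1 / (x n).im) atTop (𝓝 (-4 * L 1)) := by
      refine ((hL 1).const_mul (-4)).congr fun n => ?_
      rw [← triCoord_add_two_zero]
      change -4 * (-(triCoord 2 _ + triCoord 0 _) / 4) = _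
      ring
    have h2 : Tendsto (fun n => (((x n).re - 1) ^ 2 + (x n).im ^ 2) / (x n).im) atTop
        (𝓝 (-4 * L 2)) := by
      refine ((hL 2).const_mul (-4)).congr fun n => ?_
      rw [← triCoord_add_zero_one]
      change -4 * (-(triCoord 0 _ + triCoord 1 _) / 4) = _
      ring
    -- The product of |z|² / Im z and 1 / Im z is at least 1, so 1 / Im z cannot tend to 0 and the
    -- limit stays in the upper half-plane.
    have h01 : 1 ≤ (-4 * L 0) * (-4 * L 1) := by
      refine ge_of_tendsto' (h0.mul h1) fun n => ?_
      have := (x n).im_pos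
      rw [div_mul_div_comm, le_div_iff₀ (by positivity)]
      nlinarith [sq_nonneg (x n).re]
    have hL1 : -4 * L 1 ≠ 0 := fun h => by rw [h] at h01; linarith
    have him : Tendsto (fun n => (x n).im) atTop (𝓝 (-4 * L 1)⁻¹) :=
      (h1.inv₀ hL1).congr fun n => by simp
    have hLpos : 0 < (-4 * L 1)⁻¹ := by
      have : 0 ≤ (-4 * L 1)⁻¹ := ge_of_tendsto' him fun n => (x n).im_pos.le
      exact lt_of_le_of_ne this (inv_ne_zero hL1).symm
    have hre : Tendsto (fun n => (x n).re) atTop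
        (𝓝 (((-4 * L 0 - -4 * L 2) * (-4 * L 1)⁻¹ + 1) / 2)) := by
      refine ((((h0.sub h2).mul him).add_const 1).div_const 2).congr fun n => ?_
      have := (x n).im_ne_zero
      field_simp
      ring
    refine ⟨⟨⟨((-4 * L 0 - -4 * L 2) * (-4 * L 1)⁻¹ + 1) / 2, (-4 * L 1)⁻¹⟩, hLpos⟩, ?_⟩
    rw [isEmbedding_coe.tendsto_nhds_iff]
    have := ((Complex.continuous_ofReal.tendsto _).comp hre).add
      (((Complex.continuous_ofReal.tendsto _).comp him).mul_const Complex.I)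
    rw [← Complex.mk_eq_add_mul_I] at this
    refine this.congr fun n => ?_
    simp only [Function.comp_apply]
    rw [← Complex.mk_eq_add_mul_I]; rfl
  · change -(triCoord (i + 1) (triReflection i • z) + triCoord (i + 2) (triReflection i • z)) / 4 = _
    rw [triCoord_triReflection_of_ne (add_one_ne i), triCoord_triReflection_of_ne (add_two_ne i)]
    unfold triWall; ring
  · have key : ∀ k, k ≠ i → triCoord k (triReflection i • z) + triCoord i (triReflection i • z) =
        triCoord k z + triCoord i z := by
      intro k hk
      rw [triCoord_triReflection_of_ne hk, triCoord_triReflection_self]; ring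
    change -(triCoord (j + 1) (triReflection i • z) + triCoord (j + 2) (triReflection i • z)) / 4 = _
    rcases eq_add_one_or_eq_add_two hij.symm with h | h
    · have := key (j + 2) (h ▸ add_two_ne_add_one j)
      rw [h] at this
      rw [h]; linarith
    · have := key (j + 1) (h ▸ (add_two_ne_add_one j).symm)
      rw [h] at this
      rw [h]; linarith
  · have := triCoord_add_pos (add_two_ne_add_one j).symm z
    intro h; linarith
  · have := triCoord_add_pos hij z
    unfold triWall at hi hj
    linarith
  · by_contra! hcon
    have := triCoord_add_pos (zero_ne_one (α := Fin 3)) z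
    have h0 := hcon 0
    have h1 := hcon 1
    unfold triWall at h0 h1
    linarith

theorem triWall_eq (i j : Fin 3) (z : ℍ) (hi : triWall i z = 0) (hj : triWall j z = 0) : i = j := by
  by_contra hij
  have := triCoord_add_pos hij z
  unfold triWall at hi hj
  linarith

theorem translates_triWall : translates triHom (wallTable triWall) = univ := by
  refine eq_univ_of_forall fun z => ?_
  obtain ⟨g, hg⟩ := exists_apply_triWall_nonpos z
  exact ReflectionAction.mem_translates_of_apply g
    ⟨1, _, ⟨hg, fun i j => triWall_eq i j _⟩, by simp⟩

/-- Makes Γ itself act on the hyperbolic plane, so that the two actions compared have the same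
group. -/
theorem ReflectionAction.comp_equiv {G G' X : Type*} [Group G] [Group G'] [TopologicalSpace X]
    {t : Fin 3 → G} {ρ : G →* (X ≃ₜ X)} {h : Fin 3 → X → ℝ} (A : ReflectionAction t ρ h)
    (f : G' ≃* G) {t' : Fin 3 → G'} (ht : ∀ i, f (t' i) = t i) :
    ReflectionAction t' (ρ.comp f.toMonoidHom) h where
  continuous_wall := A.continuous_wall
  closure_eq_top := by
    apply Subgroup.map_injective (f := f.toMonoidHom) f.injective
    have h1 : (fun i => f.toMonoidHom (t' i)) = t := funext ht
    rw [MonoidHom.map_closure, ← range_comp, Function.comp_def, h1, A.closure_eq_top]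
    exact (Subgroup.map_top_of_surjective _ f.surjective).symm
  mul_self i := f.injective (by simp [ht, A.mul_self])
  wall_apply i x := by simpa [ht] using A.wall_apply i x
  fixed i x hx := by simpa [ht] using A.fixed i x hx
  neg_of_pos := A.neg_of_pos

theorem translates_comp_equiv {G G' X : Type*} [Group G] [Group G'] [TopologicalSpace X]
    (ρ : G →* (X ≃ₜ X)) (f : G' ≃* G) (T : Set X) :
    translates (ρ.comp f.toMonoidHom) T = translates ρ T := by
  ext y
  constructor
  · rintro ⟨g, x, hx, rfl⟩; exact ⟨f g, x, hx, rfl⟩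
  · rintro ⟨g, x, hx, rfl⟩; exact ⟨f.symm g, x, hx, by simp⟩

/-- The point of the upper half-plane with given homogeneous coordinates. -/
def ofTriCoord (g : Fin 3 → ℝ) (h : 0 < g 2 + g 0)
    (h' : 0 < g 0 * g 1 + g 1 * g 2 + g 2 * g 0) : ℍ :=
  ⟨⟨g 2 / (g 2 + g 0), √(g 0 * g 1 + g 1 * g 2 + g 2 * g 0) / (g 2 + g 0)⟩,
    div_pos (Real.sqrt_pos.2 h') h⟩

theorem triCoord_ofTriCoord (g : Fin 3 → ℝ) (h : 0 < g 2 + g 0)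
    (h' : 0 < g 0 * g 1 + g 1 * g 2 + g 2 * g 0) (i : Fin 3) :
    triCoord i (ofTriCoord g h h') = g i / √(g 0 * g 1 + g 1 * g 2 + g 2 * g 0) := by
  have h1 := Real.sqrt_pos.2 h'
  have h2 := Real.sq_sqrt h'.le
  set s := √(g 0 * g 1 + g 1 * g 2 + g 2 * g 0)
  have hre : (ofTriCoord g h h').re = g 2 / (g 2 + g 0) := rfl
  have him : (ofTriCoord g h h').im = s / (g 2 + g 0) := rfl
  fin_cases i
  · change triCoord 0 _ = g 0 / s
    rw [triCoord_zero, hre, him]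
    field_simp
    ring
  · change triCoord 1 _ = g 1 / s
    rw [triCoord_one, hre, him]
    field_simp
    rw [h2]; ring
  · change triCoord 2 _ = g 2 / s
    rw [triCoord_two, hre, him]
    field_simp

theorem eq_of_triCoord_eq {z z' : ℍ} (h : ∀ i, triCoord i z = triCoord i z') : z = z' := by
  have h0 : 1 / z.im = 1 / z'.im := by
    rw [← triCoord_add_two_zero, ← triCoord_add_two_zero, h, h]
  have him : z.im = z'.im := by
    have := z.im_ne_zero; have := z'.im_ne_zero
    field_simp at h0; exact h0.symm
  have hre : z.re = z'.re := by
    have h2 := h 2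
    have := z'.im_ne_zero
    rw [triCoord_two, triCoord_two, him] at h2
    field_simp at h2; exact h2
  exact UpperHalfPlane.ext_re_im hre him

/-- Homogeneous coordinates which are proportional are equal. -/
theorem eq_of_triCoord_eq_mul {z z' : ℍ} {s : ℝ} (hs : 0 < s)
    (h : ∀ i, triCoord i z = s * triCoord i z') : z = z' := by
  have h1 := triCoord_quadratic z
  have h2 := triCoord_quadratic z'
  rw [h, h, h] at h1
  have h3 : s ^ 2 = 1 := by linear_combination h1 - s ^ 2 * h2
  have h4 : s = 1 := by nlinarith
  exact eq_of_triCoord_eq fun i => by rw [h, h4, one_mul]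

end

noncomputable section

/-! ### The ping-pong table and the ideal triangle -/

/-- The value which the sum of the coordinates `y₁, y₂, y₃` proportional to
`λ₂ + λ₃, λ₃ + λ₁, λ₁ + λ₂` must have at a point of the table. -/
def tableHeight (y₁ y₂ y₃ p₁ p₂ p₃ D : ℝ) : ℝ :=
  -- In the linear cell of p₁ the point has u₁ = y₁ and u₂, u₃ = (p₁ ± (y₂ - y₃)) / 2, and the
  -- height is m₁. There 2u₂ and 2u₃ give p₁ + |y₂ - y₃|, while p₂ + u₂ and p₃ + u₃ are entries of
  -- the last two minima. Each minimum joins the entries of two cells competing for one pair of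
  -- indices.
  max D (max (max (p₁ + |y₂ - y₃|) (max (p₂ + |y₃ - y₁|) (p₃ + |y₁ - y₂|)))
    (max (min (p₃ + p₂ / 2 + (y₃ - y₁) / 2) (p₂ + p₃ / 2 + (y₂ - y₁) / 2))
      (max (min (p₁ + p₃ / 2 + (y₁ - y₂) / 2) (p₃ + p₁ / 2 + (y₃ - y₂) / 2))
        (min (p₂ + p₁ / 2 + (y₂ - y₃) / 2) (p₁ + p₂ / 2 + (y₁ - y₃) / 2)))))

theorem tableHeight_rotate (y₁ y₂ y₃ p₁ p₂ p₃ D : ℝ) :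
    tableHeight y₂ y₃ y₁ p₂ p₃ p₁ D = tableHeight y₁ y₂ y₃ p₁ p₂ p₃ D := by
  unfold tableHeight
  ac_rfl

theorem tableHeight_swap (y₁ y₂ y₃ p₁ p₂ p₃ D : ℝ) :
    tableHeight y₁ y₃ y₂ p₁ p₃ p₂ D = tableHeight y₁ y₂ y₃ p₁ p₂ p₃ D := by
  unfold tableHeight
  rw [abs_sub_comm y₃ y₂, abs_sub_comm y₂ y₁, abs_sub_comm y₁ y₃]
  ac_rfl

theorem tableHeight_bounds {y₁ y₂ y₃ p₁ p₂ p₃ D τ : ℝ}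
    (h : τ = tableHeight y₁ y₂ y₃ p₁ p₂ p₃ D) :
    D ≤ τ ∧ p₁ + |y₂ - y₃| ≤ τ ∧ p₂ + |y₃ - y₁| ≤ τ ∧ p₃ + |y₁ - y₂| ≤ τ ∧
      (p₃ + p₂ / 2 + (y₃ - y₁) / 2 ≤ τ ∨ p₂ + p₃ / 2 + (y₂ - y₁) / 2 ≤ τ) ∧
      (p₁ + p₃ / 2 + (y₁ - y₂) / 2 ≤ τ ∨ p₃ + p₁ / 2 + (y₃ - y₂) / 2 ≤ τ) ∧
      (p₂ + p₁ / 2 + (y₂ - y₃) / 2 ≤ τ ∨ p₁ + p₂ / 2 + (y₁ - y₃) / 2 ≤ τ) := by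
  have := h.ge
  simp only [tableHeight, max_le_iff, min_le_iff] at this
  obtain ⟨h0, ⟨h1, h2, h3⟩, h4, h5, h6⟩ := this
  exact ⟨h0, h1, h2, h3, h4, h5, h6⟩

theorem tableHeight_attained {y₁ y₂ y₃ p₁ p₂ p₃ D τ : ℝ}
    (h : τ = tableHeight y₁ y₂ y₃ p₁ p₂ p₃ D) :
    τ ≤ D ∨ (τ ≤ p₁ + |y₂ - y₃| ∨ τ ≤ p₂ + |y₃ - y₁| ∨ τ ≤ p₃ + |y₁ - y₂|) ∨
      (τ ≤ p₃ + p₂ / 2 + (y₃ - y₁) / 2 ∧ τ ≤ p₂ + p₃ / 2 + (y₂ - y₁) / 2) ∨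
      (τ ≤ p₁ + p₃ / 2 + (y₁ - y₂) / 2 ∧ τ ≤ p₃ + p₁ / 2 + (y₃ - y₂) / 2) ∨
      (τ ≤ p₂ + p₁ / 2 + (y₂ - y₃) / 2 ∧ τ ≤ p₁ + p₂ / 2 + (y₁ - y₃) / 2) := by
  have := h.le
  simpa only [tableHeight, le_max_iff, le_min_iff] using this

section Direct

variable {y₁ y₂ y₃ p₁ p₂ p₃ D : ℝ}

theorem flip_of_central (h₁ : y₁ ≤ y₂ + y₃) (h₂ : y₂ ≤ y₃ + y₁) (h₃ : y₃ ≤ y₁ + y₂)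
    (hτ : y₁ + y₂ + y₃ = tableHeight y₁ y₂ y₃ p₁ p₂ p₃ D)
    (hp₁ : p₁ ≤ y₂ + y₃) (hp₂ : p₂ ≤ y₃ + y₁) (hp₃ : p₃ ≤ y₁ + y₂) :
    max D (max (max (2 * y₂) (p₂ + y₂)) (max (2 * y₃) (p₃ + y₃))) = y₁ + y₂ + y₃ := by
  have hb := tableHeight_bounds hτ
  apply le_antisymm
  · simp only [max_le_iff]
    refine ⟨hb.1, ⟨?_, ?_⟩, ?_, ?_⟩ <;> linarith
  · simp only [le_max_iff]
    by_contra! hcon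
    obtain ⟨c0, ⟨c1, c2⟩, c3, c4⟩ := hcon
    rcases tableHeight_attained hτ with h | (h | h | h) | ⟨h, h'⟩ | ⟨h, h'⟩ | ⟨h, h'⟩
    · linarith
    · rcases abs_cases (y₂ - y₃) with ⟨e, -⟩ | ⟨e, -⟩ <;> linarith
    · rcases abs_cases (y₃ - y₁) with ⟨e, -⟩ | ⟨e, -⟩ <;> linarith
    · rcases abs_cases (y₁ - y₂) with ⟨e, -⟩ | ⟨e, -⟩ <;> linarith
    · linarith
    · linarith
    · linarith

/-- The terms of m₁ are bounded by the height. Conversely, whichever entry attains the height, y₂ +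
y₃ < p₁ and the triangle inequalities force D or one of these terms to attain it too. -/
theorem flip_of_corr (h₁ : y₁ ≤ y₂ + y₃) (h₃ : y₃ ≤ y₁ + y₂)
    (hτ : y₁ + y₂ + y₃ = tableHeight y₁ y₂ y₃ p₁ p₂ p₃ D) (hp₁ : y₂ + y₃ < p₁) :
    max D (max (max (2 * ((p₁ + y₂ - y₃) / 2)) (p₂ + (p₁ + y₂ - y₃) / 2))
      (max (2 * ((p₁ + y₃ - y₂) / 2)) (p₃ + (p₁ + y₃ - y₂) / 2))) = y₁ + y₂ + y₃ := by
  obtain ⟨b0, b1, b2, b3, b4, b5, b6⟩ := tableHeight_bounds hτ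
  have a1 := le_abs_self (y₂ - y₃)
  have a2 := neg_abs_le (y₂ - y₃)
  apply le_antisymm
  · simp only [max_le_iff]
    refine ⟨b0, ⟨?_, ?_⟩, ?_, ?_⟩
    · linarith
    · rcases b6 with b | b <;> linarith
    · linarith
    · rcases b5 with b | b <;> linarith
  · simp only [le_max_iff]
    by_contra! hcon
    obtain ⟨c0, ⟨c1, c2⟩, c3, c4⟩ := hcon
    rcases tableHeight_attained hτ with h | (h | h | h) | ⟨h, h'⟩ | ⟨h, h'⟩ | ⟨h, h'⟩
    · linarith
    · rcases abs_cases (y₂ - y₃) with ⟨e, -⟩ | ⟨e, -⟩ <;> linarith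
    · rcases abs_cases (y₃ - y₁) with ⟨e, -⟩ | ⟨e, -⟩ <;> linarith
    · rcases abs_cases (y₁ - y₂) with ⟨e, -⟩ | ⟨e, -⟩ <;> linarith
    · linarith
    · linarith
    · linarith

theorem flip_next_of_corr (h₁ : y₁ ≤ y₂ + y₃) (h₃ : y₃ ≤ y₁ + y₂)
    (hD : D ≤ y₁ + y₂ + y₃) (hp₁ : y₂ + y₃ < p₁) (hp₃ : p₃ ≤ y₁ + y₂) :
    max D (max (max (2 * ((p₁ + y₃ - y₂) / 2)) (p₃ + (p₁ + y₃ - y₂) / 2))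
      (max (2 * y₁) (p₁ + y₁))) = p₁ + y₁ := by
  apply le_antisymm
  · simp only [max_le_iff]
    refine ⟨by linarith, ⟨?_, ?_⟩, by linarith, le_rfl⟩ <;> linarith
  · exact le_max_of_le_right (le_max_of_le_right (le_max_right _ _))

/-- If p₁ and p₂ both exceeded the opposite sums, both entries of the minimum attached to this pair
would exceed the height. So at most one correction is active. -/
theorem not_two_corr (hτ : y₁ + y₂ + y₃ = tableHeight y₁ y₂ y₃ p₁ p₂ p₃ D)
    (hp₁ : y₂ + y₃ < p₁) : p₂ ≤ y₃ + y₁ := by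
  obtain ⟨-, -, -, -, -, -, b6⟩ := tableHeight_bounds hτ
  by_contra!
  rcases b6 with b | b <;> linarith

end Direct

/-- The correction to the coordinates `y` which comes from the linear term with index `i`. -/
def tableCorr (p y : Fin 3 → ℝ) (i : Fin 3) : ℝ := max 0 ((p i - y (i + 1) - y (i + 2)) / 2)

/-- The point of the table with given coordinates `y`. -/
def tablePoint (p y : Fin 3 → ℝ) (i : Fin 3) : ℝ :=
  y i + tableCorr p y (i + 1) + tableCorr p y (i + 2)

theorem flipMax_add_one (p : Fin 3 → ℝ) (D : ℝ) (i : Fin 3) (u : Fin 3 → ℝ) :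
    flipMax p D (i + 1) u = max D (max (soloMax p (i + 2) u) (soloMax p i u)) := by
  fin_cases i <;> rfl

theorem flipMax_add_two (p : Fin 3 → ℝ) (D : ℝ) (i : Fin 3) (u : Fin 3 → ℝ) :
    flipMax p D (i + 2) u = max D (max (soloMax p i u) (soloMax p (i + 1) u)) := by
  fin_cases i <;> rfl

theorem tableCorr_add_one (p y : Fin 3 → ℝ) (i : Fin 3) :
    tableCorr p y (i + 1) = max 0 ((p (i + 1) - y (i + 2) - y i) / 2) := by
  fin_cases i <;> rfl

theorem tableCorr_add_two (p y : Fin 3 → ℝ) (i : Fin 3) :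
    tableCorr p y (i + 2) = max 0 ((p (i + 2) - y i - y (i + 1)) / 2) := by
  fin_cases i <;> rfl

theorem tablePoint_add_one (p y : Fin 3 → ℝ) (i : Fin 3) :
    tablePoint p y (i + 1) = y (i + 1) + tableCorr p y (i + 2) + tableCorr p y i := by
  fin_cases i <;> rfl

theorem tablePoint_add_two (p y : Fin 3 → ℝ) (i : Fin 3) :
    tablePoint p y (i + 2) = y (i + 2) + tableCorr p y i + tableCorr p y (i + 1) := by
  fin_cases i <;> rfl

/-- The equation for the height, starting at an arbitrary index. -/
theorem tableHeight_cyclic {p y : Fin 3 → ℝ} {D : ℝ}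
    (hτ : y 0 + y 1 + y 2 = tableHeight (y 0) (y 1) (y 2) (p 0) (p 1) (p 2) D) (i : Fin 3) :
    y i + y (i + 1) + y (i + 2) = tableHeight (y i) (y (i + 1)) (y (i + 2))
      (p i) (p (i + 1)) (p (i + 2)) D := by
  fin_cases i
  · exact hτ
  · change y 1 + y 2 + y 0 = tableHeight (y 1) (y 2) (y 0) (p 1) (p 2) (p 0) D
    rw [tableHeight_rotate, ← hτ]; ring
  · change y 2 + y 0 + y 1 = tableHeight (y 2) (y 0) (y 1) (p 2) (p 0) (p 1) D
    rw [← tableHeight_rotate, ← hτ]; ring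

/-- The properties of the point of the table with coordinates `y`, seen from the index `i`. -/
def TableSpec (p : Fin 3 → ℝ) (D : ℝ) (y u : Fin 3 → ℝ) (i : Fin 3) : Prop :=
  IsSkPoint p D u ∧ wall p D i u = y i - y (i + 1) - y (i + 2) ∧
    wall p D (i + 1) u = y (i + 1) - y (i + 2) - y i ∧
    wall p D (i + 2) u = y (i + 2) - y i - y (i + 1)

theorem TableSpec.wall_eq {p y u : Fin 3 → ℝ} {D : ℝ} {i : Fin 3} (h : TableSpec p D y u i)
    (j : Fin 3) : wall p D j u = y j - y (j + 1) - y (j + 2) := by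
  obtain ⟨-, h0, h1, h2⟩ := h
  by_cases hj : j = i
  · rw [hj, h0]
  · rcases eq_add_one_or_eq_add_two hj with rfl | rfl
    · rw [h1]; fin_cases i <;> rfl
    · rw [h2]; fin_cases i <;> rfl

theorem tableSpec_of_corr {p y : Fin 3 → ℝ} {D : ℝ} {i : Fin 3}
    (h₁ : y i ≤ y (i + 1) + y (i + 2)) (h₂ : y (i + 1) ≤ y (i + 2) + y i)
    (h₃ : y (i + 2) ≤ y i + y (i + 1))
    (hτ : y i + y (i + 1) + y (i + 2) = tableHeight (y i) (y (i + 1)) (y (i + 2))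
      (p i) (p (i + 1)) (p (i + 2)) D) (hp : y (i + 1) + y (i + 2) < p i) :
    TableSpec p D y (tablePoint p y) i := by
  have hτ' : y i + y (i + 2) + y (i + 1) = tableHeight (y i) (y (i + 2)) (y (i + 1))
      (p i) (p (i + 2)) (p (i + 1)) D := by
    rw [tableHeight_swap, ← hτ]; ring
  have hp2 := not_two_corr hτ hp
  have hp3 := not_two_corr hτ' (by linarith)
  have hD := (tableHeight_bounds hτ).1
  have c0 : tableCorr p y i = (p i - y (i + 1) - y (i + 2)) / 2 := max_eq_right (by linarith)
  have c1 : tableCorr p y (i + 1) = 0 := by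
    rw [tableCorr_add_one, max_eq_left (by linarith)]
  have c2 : tableCorr p y (i + 2) = 0 := by
    rw [tableCorr_add_two, max_eq_left (by linarith)]
  have v0 : tablePoint p y i = y i := by
    unfold tablePoint; rw [c1, c2]; ring
  have v1 : tablePoint p y (i + 1) = (p i + y (i + 1) - y (i + 2)) / 2 := by
    rw [tablePoint_add_one, c0, c2]; ring
  have v2 : tablePoint p y (i + 2) = (p i + y (i + 2) - y (i + 1)) / 2 := by
    rw [tablePoint_add_two, c0, c1]; ring
  have e0 : flipMax p D i (tablePoint p y) = y i + y (i + 1) + y (i + 2) := by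
    unfold flipMax soloMax
    rw [v1, v2]
    exact flip_of_corr h₁ h₃ hτ hp
  have e1 : flipMax p D (i + 1) (tablePoint p y) = p i + y i := by
    rw [flipMax_add_one, soloMax, soloMax, v0, v2]
    exact flip_next_of_corr h₁ h₃ hD hp (by linarith)
  have e2 : flipMax p D (i + 2) (tablePoint p y) = p i + y i := by
    rw [flipMax_add_two, soloMax, soloMax, v0, v1, max_comm (max (2 * y i) _)]
    exact flip_next_of_corr (by linarith) (by linarith) (by linarith) (by linarith) (by linarith)
  refine ⟨?_, ?_, ?_, ?_⟩
  · rw [isSkPoint_iff i, e0, soloMax, v0, v1, v2, max_eq_left, max_eq_right] <;>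
      [ring; linarith; exact le_max_of_le_right (by linarith)]
  · rw [wall, e0, v0]; ring
  · rw [wall, e1, v1]; ring
  · rw [wall, e2, v2]; ring

theorem tableSpec_of_central {p y : Fin 3 → ℝ} {D : ℝ} {i : Fin 3}
    (h₁ : y i ≤ y (i + 1) + y (i + 2)) (h₂ : y (i + 1) ≤ y (i + 2) + y i)
    (h₃ : y (i + 2) ≤ y i + y (i + 1))
    (hτ : y i + y (i + 1) + y (i + 2) = tableHeight (y i) (y (i + 1)) (y (i + 2))
      (p i) (p (i + 1)) (p (i + 2)) D) (hp₁ : p i ≤ y (i + 1) + y (i + 2))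
    (hp₂ : p (i + 1) ≤ y (i + 2) + y i) (hp₃ : p (i + 2) ≤ y i + y (i + 1)) :
    TableSpec p D y (tablePoint p y) i := by
  have hτ1 : y (i + 1) + y (i + 2) + y i = tableHeight (y (i + 1)) (y (i + 2)) (y i)
      (p (i + 1)) (p (i + 2)) (p i) D := by
    rw [tableHeight_rotate, ← hτ]; ring
  have hτ2 : y (i + 2) + y i + y (i + 1) = tableHeight (y (i + 2)) (y i) (y (i + 1))
      (p (i + 2)) (p i) (p (i + 1)) D := by
    rw [← tableHeight_rotate, ← hτ]; ring
  have c0 : tableCorr p y i = 0 := max_eq_left (by linarith)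
  have c1 : tableCorr p y (i + 1) = 0 := by
    rw [tableCorr_add_one, max_eq_left (by linarith)]
  have c2 : tableCorr p y (i + 2) = 0 := by
    rw [tableCorr_add_two, max_eq_left (by linarith)]
  have v0 : tablePoint p y i = y i := by
    unfold tablePoint; rw [c1, c2]; ring
  have v1 : tablePoint p y (i + 1) = y (i + 1) := by
    rw [tablePoint_add_one, c0, c2]; ring
  have v2 : tablePoint p y (i + 2) = y (i + 2) := by
    rw [tablePoint_add_two, c0, c1]; ring
  have e0 : flipMax p D i (tablePoint p y) = y i + y (i + 1) + y (i + 2) := by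
    unfold flipMax soloMax
    rw [v1, v2]
    exact flip_of_central h₁ h₂ h₃ hτ hp₁ hp₂ hp₃
  have e1 : flipMax p D (i + 1) (tablePoint p y) = y (i + 1) + y (i + 2) + y i := by
    rw [flipMax_add_one, soloMax, soloMax, v0, v2]
    exact flip_of_central h₂ h₃ h₁ hτ1 hp₂ hp₃ hp₁
  have e2 : flipMax p D (i + 2) (tablePoint p y) = y (i + 2) + y i + y (i + 1) := by
    rw [flipMax_add_two, soloMax, soloMax, v0, v1]
    exact flip_of_central h₃ h₁ h₂ hτ2 hp₃ hp₁ hp₂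
  refine ⟨?_, ?_, ?_, ?_⟩
  · rw [isSkPoint_iff i, e0, soloMax, v0, v1, v2, max_eq_right]
    exact max_le (by linarith) (by linarith)
  · rw [wall, e0, v0]; ring
  · rw [wall, e1, v1]; ring
  · rw [wall, e2, v2]; ring

/-- The vector y encodes the walls through h_i = y_i - y_{i+1} - y_{i+2}. Depending on whether a
correction is active, the point lies in a linear cell or is y itself. -/
theorem tablePoint_spec {p y : Fin 3 → ℝ} {D : ℝ} (h : ∀ i, y i ≤ y (i + 1) + y (i + 2))
    (hτ : y 0 + y 1 + y 2 = tableHeight (y 0) (y 1) (y 2) (p 0) (p 1) (p 2) D) :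
    IsSkPoint p D (tablePoint p y) ∧
      ∀ i, wall p D i (tablePoint p y) = y i - y (i + 1) - y (i + 2) := by
  have h' : ∀ i, y (i + 1) ≤ y (i + 2) + y i := fun i => by
    have := h (i + 1)
    fin_cases i <;> exact this
  have h'' : ∀ i, y (i + 2) ≤ y i + y (i + 1) := fun i => by
    have := h (i + 2)
    fin_cases i <;> exact this
  by_cases hc : ∃ i, y (i + 1) + y (i + 2) < p i
  · obtain ⟨i, hi⟩ := hc
    have := tableSpec_of_corr (h i) (h' i) (h'' i) (tableHeight_cyclic hτ i) hi
    exact ⟨this.1, this.wall_eq⟩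
  · push Not at hc
    have := tableSpec_of_central (h 0) (h' 0) (h'' 0) (tableHeight_cyclic hτ 0) (hc 0) (hc 1) (hc 2)
    exact ⟨this.1, this.wall_eq⟩

section Converse

variable {u₁ u₂ u₃ p₁ p₂ p₃ D : ℝ}

theorem tableHeight_of_central (hD : u₁ + u₂ + u₃ = D) (h₁ : 2 * u₁ ≤ D) (h₂ : 2 * u₂ ≤ D)
    (h₃ : 2 * u₃ ≤ D) (k₁ : p₁ + u₁ ≤ D) (k₂ : p₂ + u₂ ≤ D) (k₃ : p₃ + u₃ ≤ D) :
    u₁ + u₂ + u₃ = tableHeight u₁ u₂ u₃ p₁ p₂ p₃ D := by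
  apply le_antisymm
  · exact le_max_of_le_left hD.le
  · simp only [tableHeight, max_le_iff, min_le_iff]
    refine ⟨hD.ge, ⟨?_, ?_, ?_⟩, .inl ?_, .inl ?_, .inl ?_⟩
    · rcases abs_cases (u₂ - u₃) with ⟨e, -⟩ | ⟨e, -⟩ <;> linarith
    · rcases abs_cases (u₃ - u₁) with ⟨e, -⟩ | ⟨e, -⟩ <;> linarith
    · rcases abs_cases (u₁ - u₂) with ⟨e, -⟩ | ⟨e, -⟩ <;> linarith
    · linarith
    · linarith
    · linarith

theorem tableHeight_of_linear {m y₂ y₃ : ℝ} (hS : u₂ + u₃ = p₁)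
    (k₁ : 2 * u₁ ≤ m) (k₂ : 2 * u₂ ≤ p₁ + u₁) (k₃ : 2 * u₃ ≤ p₁ + u₁)
    (l₂ : p₂ + u₂ ≤ p₁ + u₁) (l₃ : p₃ + u₃ ≤ p₁ + u₁)
    (hm : m = max D (max (max (2 * u₂) (p₂ + u₂)) (max (2 * u₃) (p₃ + u₃))))
    (hy₂ : 2 * y₂ = m - u₁ + u₂ - u₃) (hy₃ : 2 * y₃ = m - u₁ + u₃ - u₂) :
    u₁ + y₂ + y₃ = tableHeight u₁ y₂ y₃ p₁ p₂ p₃ D := by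
  have hτ : u₁ + y₂ + y₃ = m := by linarith
  have hge := hm.ge
  simp only [max_le_iff] at hge
  obtain ⟨g0, ⟨g1, g2⟩, g3, g4⟩ := hge
  have hle := hm.le
  simp only [le_max_iff] at hle
  rw [hτ]
  apply le_antisymm
  · simp only [tableHeight, le_max_iff, le_min_iff]
    rcases hle with h | (h | h) | (h | h)
    · exact .inl h
    · refine .inr (.inl (.inl ?_))
      linarith [le_abs_self (y₂ - y₃)]
    · refine .inr (.inr (.inr (.inr ⟨?_, ?_⟩))) <;> linarith
    · refine .inr (.inl (.inl ?_))
      linarith [neg_abs_le (y₂ - y₃)]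
    · refine .inr (.inr (.inr (.inl ⟨?_, ?_⟩))) <;> linarith
  · simp only [tableHeight, max_le_iff, min_le_iff]
    refine ⟨g0, ⟨?_, ?_, ?_⟩, .inl ?_, .inr ?_, .inl ?_⟩
    · rcases abs_cases (y₂ - y₃) with ⟨e, -⟩ | ⟨e, -⟩ <;> linarith
    · rcases abs_cases (y₃ - u₁) with ⟨e, -⟩ | ⟨e, -⟩ <;> linarith
    · rcases abs_cases (u₁ - y₂) with ⟨e, -⟩ | ⟨e, -⟩ <;> linarith
    · linarith
    · linarith
    · linarith

end Converse

section Inverse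

variable {p u y : Fin 3 → ℝ} {D : ℝ}

theorem flipMax_le_sum (hu : IsSkPoint p D u) (i j : Fin 3) :
    flipMax p D j u ≤ u i + u (i + 1) + u (i + 2) := by
  have h1 := (isSkPoint_iff i).1 hu
  have h2 := (isSkPoint_iff j).1 hu
  have h3 : u i + u (i + 1) + u (i + 2) = u j + u (j + 1) + u (j + 2) := by
    have : ∀ k : Fin 3, u k + u (k + 1) + u (k + 2) = u 0 + u 1 + u 2 := fun k => by
      fin_cases k
      · rfl
      · change u 1 + u 2 + u 0 = _; ring
      · change u 2 + u 0 + u 1 = _; ring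
    rw [this, this j]
  rw [h3, h2]
  exact le_max_right _ _

theorem tableHeight_of_cyclic {i : Fin 3}
    (hτ : y i + y (i + 1) + y (i + 2) = tableHeight (y i) (y (i + 1)) (y (i + 2))
      (p i) (p (i + 1)) (p (i + 2)) D) :
    y 0 + y 1 + y 2 = tableHeight (y 0) (y 1) (y 2) (p 0) (p 1) (p 2) D := by
  fin_cases i
  · exact hτ
  · change y 1 + y 2 + y 0 = tableHeight (y 1) (y 2) (y 0) (p 1) (p 2) (p 0) D at hτ
    rw [tableHeight_rotate] at hτ
    rw [← hτ]; ring
  · change y 2 + y 0 + y 1 = tableHeight (y 2) (y 0) (y 1) (p 2) (p 0) (p 1) D at hτ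
    rw [← tableHeight_rotate] at hτ
    rw [← hτ]; ring

/-- Every m_j is squeezed between D and the sum, so h_j = 2u_j - D, which gives y = u. -/
theorem eq_tablePoint_of_const (hu : IsSkPoint p D u) (hw : ∀ i, wall p D i u ≤ 0)
    (hy : ∀ i, 2 * y i = -(wall p D (i + 1) u + wall p D (i + 2) u))
    (hS : u 0 + u 1 + u 2 = D) :
    y 0 + y 1 + y 2 = tableHeight (y 0) (y 1) (y 2) (p 0) (p 1) (p 2) D ∧
      tablePoint p y = u := by
  have hm : ∀ j, flipMax p D j u = D := fun j =>
    le_antisymm ((flipMax_le_sum hu 0 j).trans_eq hS) (le_flipMax p D u j)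
  simp only [wall, hm] at hw hy
  have hyu : y = u := by
    ext i
    have := hy i
    fin_cases i
    · change 2 * y 0 = -(2 * u 1 - D + (2 * u 2 - D)) at this
      change y 0 = u 0; linarith
    · change 2 * y 1 = -(2 * u 2 - D + (2 * u 0 - D)) at this
      change y 1 = u 1; linarith
    · change 2 * y 2 = -(2 * u 0 - D + (2 * u 1 - D)) at this
      change y 2 = u 2; linarith
  subst hyu
  have k : ∀ j, p j + y j ≤ D := fun j => by
    rw [← hm (j + 1)]; exact add_le_flipMax (add_one_ne j).symm
  refine ⟨tableHeight_of_central hS (by linarith [hw 0]) (by linarith [hw 1])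
    (by linarith [hw 2]) (k 0) (k 1) (k 2), ?_⟩
  have hc : ∀ i, tableCorr p y i = 0 := fun i => by
    refine max_eq_left ?_
    have := k i
    have hS' : y i + y (i + 1) + y (i + 2) = D := by
      rw [← hS]
      fin_cases i
      · rfl
      · change y 1 + y 2 + y 0 = _; ring
      · change y 2 + y 0 + y 1 = _; ring
    linarith
  ext i
  rw [tablePoint, hc, hc]; ring

/-- Here m_{i+1} and m_{i+2} equal p_i + u_i, so y_i = u_i. The other two coordinates of u differ
from those of y by the i-th correction, and the height is m_i. -/
theorem eq_tablePoint_of_linear (hu : IsSkPoint p D u) (hw : ∀ i, wall p D i u ≤ 0)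
    (hy : ∀ i, 2 * y i = -(wall p D (i + 1) u + wall p D (i + 2) u)) {i : Fin 3}
    (hS : u (i + 1) + u (i + 2) = p i) :
    y 0 + y 1 + y 2 = tableHeight (y 0) (y 1) (y 2) (p 0) (p 1) (p 2) D ∧
      tablePoint p y = u := by
  have m1 : flipMax p D (i + 1) u = p i + u i :=
    le_antisymm ((flipMax_le_sum hu i (i + 1)).trans (by linarith))
      (add_le_flipMax (add_one_ne i).symm)
  have m2 : flipMax p D (i + 2) u = p i + u i :=
    le_antisymm ((flipMax_le_sum hu i (i + 2)).trans (by linarith))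
      (add_le_flipMax (add_two_ne i).symm)
  have m0 := flipMax_le_sum hu i i
  have k2 : 2 * u (i + 1) ≤ p i + u i := m2 ▸ two_mul_le_flipMax (add_two_ne_add_one i).symm
  have k3 : 2 * u (i + 2) ≤ p i + u i := m1 ▸ two_mul_le_flipMax (add_two_ne_add_one i)
  have l2 : p (i + 1) + u (i + 1) ≤ p i + u i := m2 ▸ add_le_flipMax (add_two_ne_add_one i).symm
  have l3 : p (i + 2) + u (i + 2) ≤ p i + u i := m1 ▸ add_le_flipMax (add_two_ne_add_one i)
  have n2 : p (i + 1) + u (i + 1) ≤ flipMax p D i u := add_le_flipMax (add_one_ne i)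
  have n3 : p (i + 2) + u (i + 2) ≤ flipMax p D i u := add_le_flipMax (add_two_ne i)
  have hw0 := hw i
  have y0 := hy i
  have y1 : 2 * y (i + 1) = -(wall p D (i + 2) u + wall p D i u) := by
    rw [hy]; fin_cases i <;> rfl
  have y2 : 2 * y (i + 2) = -(wall p D i u + wall p D (i + 1) u) := by
    rw [hy]; fin_cases i <;> rfl
  unfold wall at hw0 y0 y1 y2
  rw [m1, m2] at y0
  rw [m2] at y1
  rw [m1] at y2
  have hyu : y i = u i := by linarith
  refine ⟨tableHeight_of_cyclic (i := i) ?_, ?_⟩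
  · rw [hyu]
    exact tableHeight_of_linear (m := flipMax p D i u) hS (by linarith) k2 k3 l2 l3 rfl
      (by linarith) (by linarith)
  have c0 : tableCorr p y i = (p i - y (i + 1) - y (i + 2)) / 2 := max_eq_right (by linarith)
  have c1 : tableCorr p y (i + 1) = 0 := by
    rw [tableCorr_add_one, max_eq_left (by linarith)]
  have c2 : tableCorr p y (i + 2) = 0 := by
    rw [tableCorr_add_two, max_eq_left (by linarith)]
  ext j
  by_cases hj : j = i
  · rw [hj, tablePoint, c1, c2]; linarith
  · rcases eq_add_one_or_eq_add_two hj with rfl | rfl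
    · rw [tablePoint_add_one, c0, c2]; linarith
    · rw [tablePoint_add_two, c0, c1]; linarith

/-- A point of the table is determined by its distances to the walls. -/
theorem eq_tablePoint (hu : IsSkPoint p D u) (hw : ∀ i, wall p D i u ≤ 0)
    (hw' : ∀ i j, wall p D i u = 0 → wall p D j u = 0 → i = j)
    (hy : ∀ i, 2 * y i = -(wall p D (i + 1) u + wall p D (i + 2) u)) :
    y 0 + y 1 + y 2 = tableHeight (y 0) (y 1) (y 2) (p 0) (p 1) (p 2) D ∧
      tablePoint p y = u := by
  have hmain : ∃ i, u i + u (i + 1) + u (i + 2) = D ∨ u (i + 1) + u (i + 2) = p i := by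
    -- A quadratic cell meets the closed chamber only in its wall, where m_i is the sum. If 2u_j
    -- attained m_i, then h_j = 0 too and the point would be a corner; so D or some p_j + u_j
    -- attains it.
    have quad : ∀ i, u i + u (i + 1) + u (i + 2) ≤ 2 * u i →
        ∃ i, u i + u (i + 1) + u (i + 2) = D ∨ u (i + 1) + u (i + 2) = p i := by
      intro i hi
      have h1 := flipMax_le_sum hu i i
      have h2 := hw i
      have hwi : wall p D i u = 0 := le_antisymm h2 (by unfold wall; linarith)
      have hm : flipMax p D i u = u i + u (i + 1) + u (i + 2) := by
        unfold wall at h2 hwi; linarith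
      have solo : ∀ j, j ≠ i → flipMax p D i u = soloMax p j u →
          u (j + 1) + u (j + 2) = p j := by
        intro j hj hs
        have h3 := (isSkPoint_iff j).1 hu
        have h4 : u j + u (j + 1) + u (j + 2) = u i + u (i + 1) + u (i + 2) := by
          rcases eq_add_one_or_eq_add_two hj with rfl | rfl
          · fin_cases i
            · change u 1 + u 2 + u 0 = u 0 + u 1 + u 2; ring
            · change u 2 + u 0 + u 1 = u 1 + u 2 + u 0; ring
            · change u 0 + u 1 + u 2 = u 2 + u 0 + u 1; ring
          · fin_cases i
            · change u 2 + u 0 + u 1 = u 0 + u 1 + u 2; ring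
            · change u 0 + u 1 + u 2 = u 1 + u 2 + u 0; ring
            · change u 1 + u 2 + u 0 = u 2 + u 0 + u 1; ring
        rcases max_choice (2 * u j) (p j + u j) with e | e
        · have h5 := flipMax_le_sum hu i j
          have h6 := hw j
          rw [soloMax, e] at hs
          exact absurd (hw' j i (le_antisymm h6 (by unfold wall; linarith)) hwi) hj
        · rw [soloMax, e] at hs
          linarith
      rcases max_choice D (max (soloMax p (i + 1) u) (soloMax p (i + 2) u)) with e | e
      · exact ⟨i, .inl (hm.symm.trans e)⟩
      · rcases max_choice (soloMax p (i + 1) u) (soloMax p (i + 2) u) with e' | e'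
        · exact ⟨i + 1, .inr (solo _ (add_one_ne i) (e.trans e'))⟩
        · exact ⟨i + 2, .inr (solo _ (add_two_ne i) (e.trans e'))⟩
    have solo : ∀ i, u i + u (i + 1) + u (i + 2) = soloMax p i u →
        ∃ i, u i + u (i + 1) + u (i + 2) = D ∨ u (i + 1) + u (i + 2) = p i := by
      intro i hi
      rcases max_choice (2 * u i) (p i + u i) with e | e
      · exact quad i (by rw [hi, soloMax, e])
      · refine ⟨i, .inr ?_⟩
        rw [soloMax, e] at hi; linarith
    have h0 : u 0 + u 1 + u 2 =
        max D (max (soloMax p 0 u) (max (soloMax p 1 u) (soloMax p 2 u))) := hu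
    rcases max_choice D (max (soloMax p 0 u) (max (soloMax p 1 u) (soloMax p 2 u))) with e | e
    · exact ⟨0, .inl (h0.trans e)⟩
    rcases max_choice (soloMax p 0 u) (max (soloMax p 1 u) (soloMax p 2 u)) with e' | e'
    · exact solo 0 (h0.trans (e.trans e'))
    rcases max_choice (soloMax p 1 u) (soloMax p 2 u) with e'' | e''
    · refine solo 1 ?_
      change u 1 + u 2 + u 0 = _
      rw [← e'', ← e', ← e, ← h0]; ring
    · refine solo 2 ?_
      change u 2 + u 0 + u 1 = _
      rw [← e'', ← e', ← e, ← h0]; ring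
  obtain ⟨i, h | h⟩ := hmain
  · refine eq_tablePoint_of_const hu hw hy ?_
    rw [← h]
    fin_cases i
    · rfl
    · change _ = u 1 + u 2 + u 0; ring
    · change _ = u 2 + u 0 + u 1; ring
  · exact eq_tablePoint_of_linear hu hw hy h

end Inverse

end

/-! ### The radius of the table in each direction, and the homeomorphism with the ideal triangle. -/

noncomputable section

section Radius

/-- The height depends on y only through differences, each entry with slope at most 1 in one of
them. -/
theorem tableHeight_le_add {y₁ y₂ y₃ y₁' y₂' y₃' p₁ p₂ p₃ D k : ℝ}
    (h₁ : |(y₂' - y₃') - (y₂ - y₃)| ≤ k) (h₂ : |(y₃' - y₁') - (y₃ - y₁)| ≤ k)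
    (h₃ : |(y₁' - y₂') - (y₁ - y₂)| ≤ k) :
    tableHeight y₁' y₂' y₃' p₁ p₂ p₃ D ≤ tableHeight y₁ y₂ y₃ p₁ p₂ p₃ D + k := by
  obtain ⟨b0, b1, b2, b3, b4, b5, b6⟩ := tableHeight_bounds
    (rfl : tableHeight y₁ y₂ y₃ p₁ p₂ p₃ D = _)
  have hk : 0 ≤ k := (abs_nonneg _).trans h₁
  have t1 := abs_sub_abs_le_abs_sub (y₂' - y₃') (y₂ - y₃)
  have t2 := abs_sub_abs_le_abs_sub (y₃' - y₁') (y₃ - y₁)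
  have t3 := abs_sub_abs_le_abs_sub (y₁' - y₂') (y₁ - y₂)
  rw [abs_le] at h₁ h₂ h₃
  conv_lhs => unfold tableHeight
  simp only [max_le_iff, min_le_iff]
  refine ⟨by linarith, ⟨?_, ?_, ?_⟩, ?_, ?_, ?_⟩
  · linarith [abs_le.2 h₁]
  · linarith [abs_le.2 h₂]
  · linarith [abs_le.2 h₃]
  · exact b4.imp (fun _ => by linarith) (fun _ => by linarith)
  · exact b5.imp (fun _ => by linarith) (fun _ => by linarith)
  · exact b6.imp (fun _ => by linarith) (fun _ => by linarith)

theorem Continuous.tableHeight {Z : Type*} [TopologicalSpace Z] {y : Z → Fin 3 → ℝ}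
    (hy : Continuous y) (p₁ p₂ p₃ D : ℝ) :
    Continuous fun z => tableHeight (y z 0) (y z 1) (y z 2) p₁ p₂ p₃ D := by
  unfold _root_.tableHeight
  fun_prop

theorem continuous_tablePoint (p : Fin 3 → ℝ) : Continuous (tablePoint p) := by
  unfold tablePoint tableCorr
  fun_prop

/-- The coordinates of the table in the direction given by a point of the ideal triangle. -/
def triDir (z : ℍ) (i : Fin 3) : ℝ := (triCoord (i + 1) z + triCoord (i + 2) z) / 2

theorem continuous_triDir : Continuous triDir := by
  unfold triDir
  have := continuous_triCoord
  fun_prop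

theorem triCoord_nonneg (z : wallTable triWall) (i : Fin 3) : 0 ≤ triCoord i z.1 := by
  have := z.2.1 i
  unfold triWall at this
  linarith

theorem exists_tableRadius {p : Fin 3 → ℝ} {D : ℝ} (hne : 0 < D ∨ ∃ i, 0 < p i) :
    ∃ r : wallTable triWall → ℝ, Continuous r ∧ (∀ z, 0 < r z) ∧ ∀ z s,
      (s • triDir z.1) 0 + (s • triDir z.1) 1 + (s • triDir z.1) 2 =
        tableHeight ((s • triDir z.1) 0) ((s • triDir z.1) 1) ((s • triDir z.1) 2)
          (p 0) (p 1) (p 2) D ↔ s = r z := by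
  set F : wallTable triWall → ℝ → ℝ := fun z s =>
    (s • triDir z.1) 0 + (s • triDir z.1) 1 + (s • triDir z.1) 2 -
      tableHeight ((s • triDir z.1) 0) ((s • triDir z.1) 1) ((s • triDir z.1) 2)
          (p 0) (p 1) (p 2) D with hFdef
  have hc : Continuous fun v : wallTable triWall × ℝ => v.2 • triDir v.1.1 :=
    continuous_snd.smul (continuous_triDir.comp (continuous_subtype_val.comp continuous_fst))
  have hF : Continuous fun v : wallTable triWall × ℝ => F v.1 v.2 := by
    have h := fun i => (continuous_apply i).comp hc
    exact (((h 0).add (h 1)).add (h 2)).sub (hc.tableHeight _ _ _ _)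
  have hmono : ∀ z s s', s ≤ s' → (1 / 2) * (s' - s) ≤ F z s' - F z s := by
    intro z s s' hs
    have g0 := triCoord_nonneg z 0
    have g1 := triCoord_nonneg z 1
    have g2 := triCoord_nonneg z 2
    have hq := triCoord_quadratic z.1
    have d0 : triDir z.1 0 = (triCoord 1 z.1 + triCoord 2 z.1) / 2 := rfl
    have d1 : triDir z.1 1 = (triCoord 2 z.1 + triCoord 0 z.1) / 2 := rfl
    have d2 : triDir z.1 2 = (triCoord 0 z.1 + triCoord 1 z.1) / 2 := rfl
    simp only [hFdef, Pi.smul_apply, smul_eq_mul, d0, d1, d2]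
    set l0 := triCoord 0 z.1
    set l1 := triCoord 1 z.1
    set l2 := triCoord 2 z.1
    -- Along the ray the sum grows at rate l0 + l1 + l2 and the height at most half as fast. The
    -- normalization gives (l0 + l1 + l2)² ≥ 3, hence a slope of at least 1/2.
    have hsum : 1 ≤ l0 + l1 + l2 := by
      nlinarith [sq_nonneg (l0 - l1), sq_nonneg (l1 - l2), sq_nonneg (l0 - l2)]
    have hs' : 0 ≤ s' - s := by linarith
    have e0 := mul_nonneg hs' g0
    have e1 := mul_nonneg hs' g1
    have e2 := mul_nonneg hs' g2
    have hle : tableHeight (s' * ((l1 + l2) / 2)) (s' * ((l2 + l0) / 2)) (s' * ((l0 + l1) / 2))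
        (p 0) (p 1) (p 2) D ≤ tableHeight (s * ((l1 + l2) / 2)) (s * ((l2 + l0) / 2))
        (s * ((l0 + l1) / 2)) (p 0) (p 1) (p 2) D + (s' - s) * (l0 + l1 + l2) / 2 := by
      apply tableHeight_le_add <;> rw [abs_le] <;> constructor <;> linarith
    have := mul_le_mul_of_nonneg_left hsum hs'
    linarith
  obtain ⟨r, hr, hr'⟩ := exists_continuous_root F hF (by norm_num) hmono
  refine ⟨r, hr, fun z => ?_, fun z s => by rw [← hr', ← sub_eq_zero]⟩
  -- At radius 0 the height is positive because some parameter is; so the root is positive.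
  have h0 : F z 0 < 0 := by
    have : 0 < tableHeight 0 0 0 (p 0) (p 1) (p 2) D := by
      obtain ⟨b0, b1, b2, b3, -⟩ := tableHeight_bounds
        (rfl : tableHeight 0 0 0 (p 0) (p 1) (p 2) D = _)
      simp only [sub_self, abs_zero, add_zero] at b1 b2 b3
      rcases hne with h | ⟨i, h⟩
      · linarith
      · fin_cases i
        · exact h.trans_le b1
        · exact h.trans_le b2
        · exact h.trans_le b3
    simpa [hFdef] using this
  by_contra! hcon
  have h1 := hmono z (r z) 0 hcon
  rw [(hr' z (r z)).2 rfl] at h1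
  linarith

end Radius

section Table

variable {a b c d : WithTop ℝ}

theorem skWall_toSk {u : Fin 3 → ℝ} (hu : IsSkPoint (linVal a b c) (negVal d) u) (i : Fin 3) :
    skWall a b c d i hu.toSk = wall (linVal a b c) (negVal d) i u := by
  unfold skWall IsSkPoint.toSk
  rw [neg_neg]

theorem coord_pair_pos {g : Fin 3 → ℝ} (h : ∀ i, 0 ≤ g i) (h' : ∀ i j, g i = 0 → g j = 0 → i = j) :
    0 < g 2 + g 0 ∧ 0 < g 0 * g 1 + g 1 * g 2 + g 2 * g 0 := by
  have pos : ∀ i j, i ≠ j → g i = 0 → 0 < g j := fun i j hij hi =>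
    (h j).lt_of_ne fun hj => hij (h' i j hi hj.symm)
  have h0 := h 0
  have h1 := h 1
  have h2 := h 2
  rcases h0.eq_or_lt with e0 | e0
  · have p1 := pos 0 1 (by decide) e0.symm
    have p2 := pos 0 2 (by decide) e0.symm
    constructor <;> nlinarith [mul_pos p1 p2]
  rcases h1.eq_or_lt with e1 | e1
  · have p2 := pos 1 2 (by decide) e1.symm
    constructor <;> nlinarith [mul_pos p2 e0]
  · constructor
    · linarith
    · nlinarith [mul_pos e0 e1, mul_nonneg h1 h2, mul_nonneg h2 h0]

theorem continuous_ofTriCoord {Z : Type*} [TopologicalSpace Z] {g : Z → Fin 3 → ℝ}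
    (hg : Continuous g) (h : ∀ z, 0 < g z 2 + g z 0)
    (h' : ∀ z, 0 < g z 0 * g z 1 + g z 1 * g z 2 + g z 2 * g z 0) :
    Continuous fun z => ofTriCoord (g z) (h z) (h' z) := by
  rw [UpperHalfPlane.isEmbedding_coe.continuous_iff]
  have h0 := (continuous_apply 0).comp hg
  have h1 := (continuous_apply 1).comp hg
  have h2 := (continuous_apply 2).comp hg
  have hre : Continuous fun z => g z 2 / (g z 2 + g z 0) :=
    h2.div (h2.add h0) fun z => (h z).ne'
  have him : Continuous fun z =>
      √(g z 0 * g z 1 + g z 1 * g z 2 + g z 2 * g z 0) / (g z 2 + g z 0) :=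
    (((h0.mul h1).add (h1.mul h2)).add (h2.mul h0)).sqrt.div (h2.add h0) fun z => (h z).ne'
  exact Complex.equivRealProdCLM.symm.continuous.comp (hre.prodMk him)

theorem exists_table_homeomorph (hne : 0 < negVal d ∨ ∃ i, 0 < linVal a b c i) :
    ∃ k : wallTable (skWall a b c d) ≃ₜ wallTable triWall,
      ∀ x i, skWall a b c d i x.1 = 0 ↔ triWall i (k x).1 = 0 := by
  obtain ⟨r, hr, hpos, hroot⟩ := exists_tableRadius hne
  have hgn : ∀ (x : wallTable (skWall a b c d)) i, 0 ≤ -skWall a b c d i x.1 := fun x i =>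
    neg_nonneg.2 (x.2.1 i)
  have hg0 : ∀ (x : wallTable (skWall a b c d)) i j, -skWall a b c d i x.1 = 0 →
      -skWall a b c d j x.1 = 0 → i = j := fun x i j hi hj =>
    x.2.2 i j (neg_eq_zero.1 hi) (neg_eq_zero.1 hj)
  have hP := fun x => coord_pair_pos (hgn x) (hg0 x)
  -- The map to the triangle keeps the wall vector up to a positive factor; its inverse L restores
  -- the factor by means of the radius.
  set K : wallTable (skWall a b c d) → ℍ := fun x =>
    ofTriCoord (fun i => -skWall a b c d i x.1) (hP x).1 (hP x).2 with hK
  have hKc : Continuous K := continuous_ofTriCoord (continuous_pi fun i =>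
    ((continuous_skWall i).comp continuous_subtype_val).neg) _ _
  have hKs : ∀ x, ∃ s : ℝ, 0 < s ∧ ∀ i, -skWall a b c d i x.1 = s * triCoord i (K x) := by
    intro x
    refine ⟨_, Real.sqrt_pos.2 (hP x).2, fun i => ?_⟩
    rw [hK]
    simp only
    rw [triCoord_ofTriCoord, mul_div_cancel₀]
    exact (Real.sqrt_pos.2 (hP x).2).ne'
  have hKz : ∀ x i, skWall a b c d i x.1 = 0 ↔ triWall i (K x) = 0 := by
    intro x i
    obtain ⟨s, hs, h⟩ := hKs x
    rw [triWall, neg_eq_zero, ← neg_eq_zero, h i, mul_eq_zero]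
    simp [hs.ne']
  have hKm : ∀ x, K x ∈ wallTable triWall := by
    intro x
    obtain ⟨s, hs, h⟩ := hKs x
    refine ⟨fun i => neg_nonpos.2 ?_, fun i j => triWall_eq i j _⟩
    have := hgn x i
    rw [h i] at this
    exact nonneg_of_mul_nonneg_right this hs
  have hY : ∀ z : wallTable triWall, ∀ i, (r z • triDir z.1) i ≤
      (r z • triDir z.1) (i + 1) + (r z • triDir z.1) (i + 2) := by
    intro z i
    have h0 := mul_nonneg (hpos z).le (triCoord_nonneg z i)
    fin_cases i
    · change r z * ((triCoord 1 z.1 + triCoord 2 z.1) / 2) ≤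
        r z * ((triCoord 2 z.1 + triCoord 0 z.1) / 2) +
          r z * ((triCoord 0 z.1 + triCoord 1 z.1) / 2)
      change 0 ≤ r z * triCoord 0 z.1 at h0
      linarith
    · change r z * ((triCoord 2 z.1 + triCoord 0 z.1) / 2) ≤
        r z * ((triCoord 0 z.1 + triCoord 1 z.1) / 2) +
          r z * ((triCoord 1 z.1 + triCoord 2 z.1) / 2)
      change 0 ≤ r z * triCoord 1 z.1 at h0
      linarith
    · change r z * ((triCoord 0 z.1 + triCoord 1 z.1) / 2) ≤
        r z * ((triCoord 1 z.1 + triCoord 2 z.1) / 2) +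
          r z * ((triCoord 2 z.1 + triCoord 0 z.1) / 2)
      change 0 ≤ r z * triCoord 2 z.1 at h0
      linarith
  have hspec := fun z => tablePoint_spec (hY z) ((hroot z (r z)).2 rfl)
  set L : wallTable triWall → Sk a b c d := fun z => (hspec z).1.toSk with hL
  have hLw : ∀ z i, skWall a b c d i (L z) = -(r z * triCoord i z.1) := by
    intro z i
    rw [hL]
    simp only
    rw [skWall_toSk, (hspec z).2]
    fin_cases i
    · change r z * ((triCoord 1 z.1 + triCoord 2 z.1) / 2) -
        r z * ((triCoord 2 z.1 + triCoord 0 z.1) / 2) -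
        r z * ((triCoord 0 z.1 + triCoord 1 z.1) / 2) = -(r z * triCoord 0 z.1)
      ring
    · change r z * ((triCoord 2 z.1 + triCoord 0 z.1) / 2) -
        r z * ((triCoord 0 z.1 + triCoord 1 z.1) / 2) -
        r z * ((triCoord 1 z.1 + triCoord 2 z.1) / 2) = -(r z * triCoord 1 z.1)
      ring
    · change r z * ((triCoord 0 z.1 + triCoord 1 z.1) / 2) -
        r z * ((triCoord 1 z.1 + triCoord 2 z.1) / 2) -
        r z * ((triCoord 2 z.1 + triCoord 0 z.1) / 2) = -(r z * triCoord 2 z.1)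
      ring
  have hLm : ∀ z, L z ∈ wallTable (skWall a b c d) := by
    intro z
    refine ⟨fun i => ?_, fun i j hi hj => triWall_eq i j z.1 ?_ ?_⟩
    · rw [hLw]
      exact neg_nonpos.2 (mul_nonneg (hpos z).le (triCoord_nonneg z i))
    · rw [hLw, neg_eq_zero, mul_eq_zero] at hi
      exact neg_eq_zero.2 (hi.resolve_left (hpos z).ne')
    · rw [hLw, neg_eq_zero, mul_eq_zero] at hj
      exact neg_eq_zero.2 (hj.resolve_left (hpos z).ne')
  have hLc : Continuous L := by
    refine Continuous.subtype_mk ?_ _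
    exact ((continuous_tablePoint _).comp
      (hr.smul (continuous_triDir.comp continuous_subtype_val))).neg
  have hLK : ∀ x, L ⟨K x, hKm x⟩ = x.1 := by
    intro x
    obtain ⟨s, hs, h⟩ := hKs x
    have hy : ∀ i, 2 * (s • triDir (K x)) i = -(wall (linVal a b c) (negVal d) (i + 1) (-x.1.1) +
        wall (linVal a b c) (negVal d) (i + 2) (-x.1.1)) := by
      intro i
      have h1 := h (i + 1)
      have h2 := h (i + 2)
      unfold skWall at h1 h2
      rw [Pi.smul_apply, smul_eq_mul, triDir]
      linarith
    obtain ⟨e1, e2⟩ := eq_tablePoint (isSkPoint_neg x.1) x.2.1 x.2.2 hy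
    have hsr : s = r ⟨K x, hKm x⟩ := (hroot ⟨K x, hKm x⟩ s).1 e1
    apply Subtype.ext
    change -tablePoint _ (r ⟨K x, hKm x⟩ • triDir (K x)) = x.1.1
    rw [← hsr, e2, neg_neg]
  refine ⟨⟨⟨fun x => ⟨K x, hKm x⟩, fun z => ⟨L z, hLm z⟩, fun x => Subtype.ext (hLK x),
    fun z => Subtype.ext ?_⟩, hKc.subtype_mk _, hLc.subtype_mk _⟩, hKz⟩
  obtain ⟨s, hs, h⟩ := hKs ⟨L z, hLm z⟩
  -- Both points have proportional homogeneous coordinates, and the quadratic normalization removes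
  -- the factor.
  refine eq_of_triCoord_eq_mul (s := s⁻¹ * r z) (mul_pos (inv_pos.2 hs) (hpos z)) fun i => ?_
  have h1 := h i
  rw [hLw, neg_neg] at h1
  change triCoord i (K ⟨L z, hLm z⟩) = _
  rw [mul_assoc, h1, inv_mul_cancel_left₀ hs.ne']

/-- The point `1/2 + i` lies in the interior of the ideal triangle. -/
theorem exists_triWall_neg : ∃ z, ∀ i, triWall i z < 0 := by
  refine ⟨⟨⟨1 / 2, 1⟩, one_pos⟩, fun i => neg_lt_zero.2 ?_⟩
  fin_cases i
  · change 0 < (1 - 1 / 2 : ℝ) / 1; norm_num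
  · change 0 < ((1 / 2) ^ 2 + 1 ^ 2 - 1 / 2 : ℝ) / 1; norm_num
  · change 0 < (1 / 2 : ℝ) / 1; norm_num

theorem nonempty_interior_table (hne : 0 < negVal d ∨ ∃ i, 0 < linVal a b c i) :
    (interior (wallTable (skWall a b c d))).Nonempty := by
  obtain ⟨k, hk⟩ := exists_table_homeomorph hne
  obtain ⟨z, hz⟩ := exists_triWall_neg
  have hzm : z ∈ wallTable triWall := ⟨fun i => (hz i).le, fun i j => triWall_eq i j z⟩
  refine ⟨(k.symm ⟨z, hzm⟩).1, mem_interior.2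
    ⟨{x | ∀ i, skWall a b c d i x < 0}, fun x hx => ⟨fun i => (hx i).le, fun i j hi =>
      absurd hi (hx i).ne⟩, ?_, fun i => ((k.symm ⟨z, hzm⟩).2.1 i).lt_of_ne ?_⟩⟩
  · rw [ofPred_forall]
    exact isOpen_iInter_of_finite fun i => isOpen_lt (continuous_skWall i) continuous_const
  · rw [Ne, hk, k.apply_symm_apply]
    exact (hz i).ne

/-- The translates of the ping-pong table are equivariantly homeomorphic to the hyperbolic
plane. -/
theorem exists_skDomain_homeomorph (hne : 0 < negVal d ∨ ∃ i, 0 < linVal a b c i)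
    (f : vietaGroup a b c d ≃* triangleGroup) (hf : ∀ i, f (vietaGen a b c d i) = triGen i) :
    ∃ h : skDomain a b c d ≃ₜ ℍ, ∀ (g : vietaGroup a b c d) (x : skDomain a b c d),
      ∃ hx : g.1 x.1 ∈ skDomain a b c d, h ⟨g.1 x.1, hx⟩ = (f g).1 • h x := by
  obtain ⟨k, hk⟩ := exists_table_homeomorph hne
  obtain ⟨K, hK⟩ := (skAction a b c d).exists_homeomorph (triAction.comp_equiv f hf) k hk
  have huniv : translates (triHom.comp f.toMonoidHom) (wallTable triWall) = univ := by
    rw [translates_comp_equiv, translates_triWall]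
  refine ⟨K.trans ((Homeomorph.setCongr huniv).trans (Homeomorph.Set.univ ℍ)), fun g x =>
    ⟨ReflectionAction.apply_mem_translates g x.2, hK g x⟩⟩

end Table

end

noncomputable section

/-! ### Holomorphic parameters -/

theorem negVal_of_nonneg {e : WithTop ℝ} (h : 0 ≤ e) : negVal e = 0 := by
  have := coe_neg_negVal e
  rw [min_eq_right h] at this
  have h' : -negVal e = 0 := WithTop.coe_inj.1 this
  linarith

theorem negVal_pos {e : WithTop ℝ} (h : e < 0) : 0 < negVal e := by
  have := coe_neg_negVal e
  rw [min_eq_left h.le] at this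
  rw [← this] at h
  have h' : -negVal e < 0 := WithTop.coe_lt_coe.1 h
  linarith

theorem exists_pos_of_min_neg {a b c d : WithTop ℝ} (h : min a (min b (min c d)) < 0) :
    0 < negVal d ∨ ∃ i, 0 < linVal a b c i := by
  simp only [min_lt_iff] at h
  rcases h with h | h | h | h
  · exact .inr ⟨0, negVal_pos h⟩
  · exact .inr ⟨1, negVal_pos h⟩
  · exact .inr ⟨2, negVal_pos h⟩
  · exact .inl (negVal_pos h)

theorem linVal_eq_zero {a b c d : WithTop ℝ} (h : 0 ≤ min a (min b (min c d))) :
    linVal a b c = 0 := by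
  simp only [le_min_iff] at h
  unfold linVal
  rw [negVal_of_nonneg h.1, negVal_of_nonneg h.2.1, negVal_of_nonneg h.2.2.1]
  ext i; fin_cases i <;> rfl

theorem negVal_eq_zero {a b c d : WithTop ℝ} (h : 0 ≤ min a (min b (min c d))) : negVal d = 0 := by
  simp only [le_min_iff] at h
  exact negVal_of_nonneg h.2.2.2

theorem induction_of_involutions {G : Type*} [Group G] {t : Fin 3 → G} (ht : ∀ i, t i * t i = 1)
    (hgen : Subgroup.closure (range t) = ⊤) {P : G → Prop} (one : P 1)
    (mul : ∀ i g, P g → P (t i * g)) (g : G) : P g := by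
  have hg : g ∈ Subgroup.closure (range t) := hgen ▸ Subgroup.mem_top g
  induction hg using Subgroup.closure_induction_left with
  | one => exact one
  | mul_left x hx y _ ih => obtain ⟨i, rfl⟩ := hx; exact mul i y ih
  | inv_mul_cancel x hx y _ ih =>
    obtain ⟨i, rfl⟩ := hx
    rw [inv_eq_of_mul_eq_one_left (ht i)]
    exact mul i y ih

section Sk

variable {a b c d : WithTop ℝ}

theorem vietaGroup_induction {P : vietaGroup a b c d → Prop} (one : P 1)
    (mul : ∀ i g, P g → P (vietaGen a b c d i * g)) (g : vietaGroup a b c d) : P g :=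
  induction_of_involutions vietaGen_mul_self closure_vietaGen one mul g

/-- The skeleton with its Vieta involutions depends only on the negative parts of the
parameters. -/
theorem exists_sk_homeomorph {a' b' c' d' : WithTop ℝ} (hp : linVal a b c = linVal a' b' c')
    (hD : negVal d = negVal d') (θ : vietaGroup a b c d ≃* vietaGroup a' b' c' d')
    (hθ : ∀ i, θ (vietaGen a b c d i) = vietaGen a' b' c' d' i) :
    ∃ φ : Sk a b c d ≃ₜ Sk a' b' c' d',
      ∀ (g : vietaGroup a b c d) (x : Sk a b c d), φ (g.1 x) = (θ g).1 (φ x) := by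
  have hS : Sk a b c d = Sk a' b' c' d' := by
    ext x
    rw [← neg_neg x, mem_Sk_iff_neg, mem_Sk_iff_neg, hp, hD]
  refine ⟨Homeomorph.setCongr hS, fun g => ?_⟩
  induction g using vietaGroup_induction with
  | one => intro x; rw [map_one]; rfl
  | mul i g ih =>
    intro x
    rw [map_mul, hθ]
    change Homeomorph.setCongr hS (skVieta a b c d i (g.1 x)) =
      skVieta a' b' c' d' i ((θ g).1 (Homeomorph.setCongr hS x))
    rw [← ih]
    apply Subtype.ext
    ext j
    change (skVieta a b c d i (g.1 x)).1 j = _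
    by_cases hj : j = i
    · subst hj
      apply neg_injective
      rw [neg_skVieta_self, neg_skVieta_self, hp, hD]
      rfl
    · rw [skVieta_of_ne hj, skVieta_of_ne hj]
      rfl

/-- The flips commute with dilations when the parameters vanish. -/
theorem flipMax_smul {t : ℝ} (ht : 0 ≤ t) (i : Fin 3) (u : Fin 3 → ℝ) :
    flipMax 0 0 i (t • u) = t * flipMax 0 0 i u := by
  simp only [flipMax, soloMax, Pi.zero_apply, zero_add, Pi.smul_apply, smul_eq_mul,
    mul_max_of_nonneg _ _ ht, mul_zero, mul_left_comm]

theorem smul_of_vieta (hp : linVal a b c = 0) (hD : negVal d = 0) (g : vietaGroup a b c d) :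
    ∀ {x y : Sk a b c d} {t : ℝ}, 0 < t → y.1 = t • x.1 → (g.1 y).1 = t • (g.1 x).1 := by
  induction g using vietaGroup_induction with
  | one => intro x y t _ h; exact h
  | mul i g ih =>
    intro x y t ht h
    have h' := ih ht h
    change (skVieta a b c d i (g.1 y)).1 = t • (skVieta a b c d i (g.1 x)).1
    ext j
    by_cases hj : j = i
    · subst hj
      have e1 := neg_skVieta_self j (g.1 y)
      have e2 := neg_skVieta_self j (g.1 x)
      rw [hp, hD, h', ← smul_neg, flipMax_smul ht.le] at e1
      rw [hp, hD] at e2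
      simp only [Pi.smul_apply, smul_eq_mul] at e1 ⊢
      linear_combination -e1 + t * e2
    · rw [Pi.smul_apply, skVieta_of_ne hj, skVieta_of_ne hj, h']
      rfl

/-- The origin is characterized by x = 2x, and the action commutes with dilations. -/
theorem vieta_ne_zero (hp : linVal a b c = 0) (hD : negVal d = 0) (g : vietaGroup a b c d)
    {x : Sk a b c d} (hx : x.1 ≠ 0) : (g.1 x).1 ≠ 0 := by
  intro h
  apply hx
  have h1 := smul_of_vieta hp hD g⁻¹ (x := g.1 x) (y := g.1 x) (t := 2) two_pos
    (by rw [h, smul_zero])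
  have h2 : (g⁻¹).1 (g.1 x) = x := g.1.symm_apply_apply x
  rw [h2, two_smul] at h1
  simpa using h1

/-- The action on the punctured skeleton. -/
def vietaPunctured (hp : linVal a b c = 0) (hD : negVal d = 0) (g : vietaGroup a b c d)
    (x : PuncturedSk a b c d) : PuncturedSk a b c d :=
  ⟨g.1 x.1, vieta_ne_zero hp hD g x.2⟩

theorem continuous_vietaPunctured (hp : linVal a b c = 0) (hD : negVal d = 0)
    (g : vietaGroup a b c d) : Continuous (vietaPunctured hp hD g) :=
  (g.1.continuous.comp continuous_subtype_val).subtype_mk _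

theorem vietaPunctured_rel (hp : linVal a b c = 0) (hD : negVal d = 0) (g : vietaGroup a b c d)
    (x y : PuncturedSk a b c d) (h : (radialSetoid a b c d).r x y) :
    (radialSetoid a b c d).r (vietaPunctured hp hD g x) (vietaPunctured hp hD g y) := by
  obtain ⟨t, ht, h⟩ := h
  exact ⟨t, ht, smul_of_vieta hp hD g ht h⟩

/-- The action on the radial projection. -/
def vietaRadial (hp : linVal a b c = 0) (hD : negVal d = 0) (g : vietaGroup a b c d) :
    Radial a b c d → Radial a b c d :=
  Quotient.map (vietaPunctured hp hD g) (vietaPunctured_rel hp hD g)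

theorem continuous_vietaRadial (hp : linVal a b c = 0) (hD : negVal d = 0)
    (g : vietaGroup a b c d) : Continuous (vietaRadial hp hD g) :=
  (continuous_vietaPunctured hp hD g).quotient_map' _

theorem vietaRadial_mul (hp : linVal a b c = 0) (hD : negVal d = 0) (g g' : vietaGroup a b c d)
    (x : Radial a b c d) :
    vietaRadial hp hD (g * g') x = vietaRadial hp hD g (vietaRadial hp hD g' x) := by
  induction x using Quotient.inductionOn
  rfl

theorem vietaRadial_one (hp : linVal a b c = 0) (hD : negVal d = 0) (x : Radial a b c d) :
    vietaRadial hp hD 1 x = x := by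
  induction x using Quotient.inductionOn
  rfl

/-- The action on the radial projection by homeomorphisms. -/
def radialHom (hp : linVal a b c = 0) (hD : negVal d = 0) :
    vietaGroup a b c d →* (Radial a b c d ≃ₜ Radial a b c d) where
  toFun g :=
    { toFun := vietaRadial hp hD g
      invFun := vietaRadial hp hD g⁻¹
      left_inv x := by rw [← vietaRadial_mul, inv_mul_cancel, vietaRadial_one]
      right_inv x := by rw [← vietaRadial_mul, mul_inv_cancel, vietaRadial_one]
      continuous_toFun := continuous_vietaRadial hp hD g
      continuous_invFun := continuous_vietaRadial hp hD g⁻¹ }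
  map_one' := Homeomorph.ext fun x => vietaRadial_one hp hD x
  map_mul' g g' := Homeomorph.ext fun x => vietaRadial_mul hp hD g g' x

end Sk

/-! ### The rays of the cone and the ideal boundary. -/

section Rays

theorem isSkPoint_zero_iff {u : Fin 3 → ℝ} : IsSkPoint 0 0 u ↔ (∀ i, 0 ≤ u i) ∧
    (u 0 = u 1 + u 2 ∨ u 1 = u 2 + u 0 ∨ u 2 = u 0 + u 1) := by
  constructor
  · intro h
    refine ⟨h.nonneg, ?_⟩
    have h0 := h.nonneg 0
    have h1 := h.nonneg 1
    have h2 := h.nonneg 2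
    have hle := le_of_eq h
    simp only [soloMax, Pi.zero_apply, zero_add, le_max_iff] at hle
    have hge := ge_of_eq h
    simp only [soloMax, Pi.zero_apply, zero_add, max_le_iff] at hge
    obtain ⟨-, ⟨g0, -⟩, ⟨g1, -⟩, g2, -⟩ := hge
    rcases hle with e | (e | e) | (e | e) | (e | e)
    · left; linarith
    · left; linarith
    · left; linarith
    · right; left; linarith
    · right; left; linarith
    · right; right; linarith
    · right; right; linarith
  · rintro ⟨h, h'⟩
    have h0 := h 0
    have h1 := h 1
    have h2 := h 2
    unfold IsSkPoint
    apply le_antisymm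
    · simp only [soloMax, le_max_iff]
      rcases h' with e | e | e
      · right; left; left; linarith
      · right; right; left; left; linarith
      · right; right; right; left; linarith
    · simp only [soloMax, Pi.zero_apply, zero_add, max_le_iff]
      rcases h' with e | e | e <;>
        exact ⟨by linarith, ⟨by linarith, by linarith⟩, ⟨by linarith, by linarith⟩, by linarith,
          by linarith⟩

/-- A vector on the ray of the skeleton which corresponds to a point of the ideal boundary. -/
def rayVec (t : OnePoint ℝ) : Fin 3 → ℝ := t.elim ![1, 0, 1] fun t => ![|t|, 1, |t - 1|]

theorem rayVec_coe (t : ℝ) : rayVec (t : OnePoint ℝ) = ![|t|, 1, |t - 1|] := rfl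

theorem rayVec_infty : rayVec OnePoint.infty = ![1, 0, 1] := rfl

/-- |t|, 1 and |t - 1| are the mutual distances of 0, 1 and t on a line, so the largest is the sum
of the other two. -/
theorem isSkPoint_rayVec (t : OnePoint ℝ) : IsSkPoint 0 0 (rayVec t) := by
  rw [isSkPoint_zero_iff]
  induction t using OnePoint.rec with
  | infty =>
    rw [rayVec_infty]
    refine ⟨fun i => by fin_cases i <;> simp, .inl (by simp)⟩
  | coe t =>
    rw [rayVec_coe]
    refine ⟨fun i => by fin_cases i <;> simp, ?_⟩
    change |t| = 1 + |t - 1| ∨ 1 = |t - 1| + |t| ∨ |t - 1| = |t| + 1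
    rcases abs_cases t with ⟨e, _⟩ | ⟨e, _⟩ <;> rcases abs_cases (t - 1) with ⟨e', _⟩ | ⟨e', _⟩ <;>
      rw [e, e']
    · left; ring
    · right; left; ring
    · linarith
    · right; right; ring

theorem rayVec_ne_zero (t : OnePoint ℝ) : rayVec t ≠ 0 := by
  induction t using OnePoint.rec with
  | infty => exact fun h => one_ne_zero (α := ℝ) (congrFun h 0)
  | coe t => exact fun h => one_ne_zero (α := ℝ) (congrFun h 1)

/-- The middle coordinate fixes the scale. Then t² and (t - 1)² are determined, and their difference
determines t. -/
theorem eq_of_rayVec_eq_smul {t t' : OnePoint ℝ} {s : ℝ} (h : rayVec t' = s • rayVec t)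
    (hs : 0 < s) : t = t' := by
  have h0 := congrFun h 0
  have h1 := congrFun h 1
  have h2 := congrFun h 2
  induction t using OnePoint.rec with
  | infty =>
    induction t' using OnePoint.rec with
    | infty => rfl
    | coe t' =>
      have : (1 : ℝ) = s * 0 := h1
      simp at this
  | coe t =>
    induction t' using OnePoint.rec with
    | infty =>
      have : (0 : ℝ) = s * 1 := h1
      linarith
    | coe t' =>
      have h1 : (1 : ℝ) = s * 1 := h1
      have hs1 : s = 1 := by linarith
      have h0 : |t'| = s * |t| := h0
      have h2 : |t' - 1| = s * |t - 1| := h2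
      rw [hs1, one_mul] at h0 h2
      have e0 := (sq_eq_sq_iff_abs_eq_abs _ _).2 h0
      have e2 := (sq_eq_sq_iff_abs_eq_abs _ _).2 h2
      rw [show t = t' by linarith]

theorem exists_eq_smul_rayVec {u : Fin 3 → ℝ} (hu : IsSkPoint 0 0 u) (hu0 : u ≠ 0) :
    ∃ t, ∃ s : ℝ, 0 < s ∧ u = s • rayVec t := by
  obtain ⟨hn, h⟩ := isSkPoint_zero_iff.1 hu
  have h0 := hn 0
  have h2 := hn 2
  rcases (hn 1).eq_or_lt with h1 | h1
  · have h02 : u 2 = u 0 := by rcases h with h | h | h <;> linarith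
    have hpos : 0 < u 0 := by
      refine h0.lt_of_ne fun h => hu0 ?_
      ext i
      fin_cases i
      · exact h.symm
      · exact h1.symm
      · exact h02.trans h.symm
    refine ⟨OnePoint.infty, u 0, hpos, ?_⟩
    ext i
    fin_cases i
    · exact (mul_one _).symm
    · exact h1.symm.trans (mul_zero _).symm
    · exact h02.trans (mul_one _).symm
  · have habs : ∀ v : ℝ, u 1 * |v| = |u 1 * v| := fun v => by rw [abs_mul, abs_of_pos h1]
    have main : ∀ t : ℝ, u 0 = |u 1 * t| → u 2 = |u 1 * t - u 1| →
        ∃ t, ∃ s : ℝ, 0 < s ∧ u = s • rayVec t := by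
      intro t e0 e2
      refine ⟨t, u 1, h1, ?_⟩
      ext i
      fin_cases i
      · change u 0 = u 1 * |t|
        rw [habs, e0]
      · exact (mul_one _).symm
      · change u 2 = u 1 * |t - 1|
        rw [habs, e2, mul_sub, mul_one]
    rcases h with h | h | h
    · refine main (u 0 / u 1) ?_ ?_ <;> rw [mul_div_cancel₀ _ h1.ne', abs_of_nonneg] <;> linarith
    · refine main (u 0 / u 1) ?_ ?_ <;> rw [mul_div_cancel₀ _ h1.ne']
      · rw [abs_of_nonneg h0]
      · rw [abs_of_nonpos] <;> linarith
    -- When u₂ = u₀ + u₁ the point 0 lies between t and 1, so t is not positive.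
    · refine main (-u 0 / u 1) ?_ ?_ <;> rw [mul_div_cancel₀ _ h1.ne', abs_of_nonpos] <;> linarith

theorem triReflection_zero_smul_coe (t : ℝ) :
    triReflection 0 • (t : OnePoint ℝ) = ((2 - t : ℝ) : OnePoint ℝ) := by
  rw [OnePoint.smul_some_eq_ite]
  simp [triReflection]
  ring

theorem triReflection_two_smul_coe (t : ℝ) :
    triReflection 2 • (t : OnePoint ℝ) = ((-t : ℝ) : OnePoint ℝ) := by
  rw [OnePoint.smul_some_eq_ite]
  simp [triReflection]

theorem triReflection_one_smul_coe (t : ℝ) :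
    triReflection 1 • (t : OnePoint ℝ) =
      if 2 * t - 1 = 0 then OnePoint.infty else ((t / (2 * t - 1) : ℝ) : OnePoint ℝ) := by
  rw [OnePoint.smul_some_eq_ite]
  simp [triReflection, ← sub_eq_add_neg]

theorem triReflection_zero_smul_infty :
    triReflection 0 • (OnePoint.infty : OnePoint ℝ) = OnePoint.infty := by
  rw [OnePoint.smul_infty_eq_ite]
  simp [triReflection]

theorem triReflection_two_smul_infty :
    triReflection 2 • (OnePoint.infty : OnePoint ℝ) = OnePoint.infty := by
  rw [OnePoint.smul_infty_eq_ite]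
  simp [triReflection]

theorem triReflection_one_smul_infty :
    triReflection 1 • (OnePoint.infty : OnePoint ℝ) = ((1 / 2 : ℝ) : OnePoint ℝ) := by
  rw [OnePoint.smul_infty_eq_ite]
  simp [triReflection]

theorem max_abs_sub_one (t : ℝ) : 2 * max 1 |t - 1| - |t| = |2 - t| := by
  rcases abs_cases t with ⟨e, _⟩ | ⟨e, _⟩ <;> rcases abs_cases (t - 1) with ⟨e', _⟩ | ⟨e', _⟩ <;>
    rcases abs_cases (2 - t) with ⟨e'', _⟩ | ⟨e'', _⟩ <;>
    rcases max_cases 1 |t - 1| with ⟨m, _⟩ | ⟨m, _⟩ <;> linarith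

theorem max_abs_abs_sub_one (t : ℝ) : 2 * max |t - 1| |t| - 1 = |2 * t - 1| := by
  rcases abs_cases t with ⟨e, _⟩ | ⟨e, _⟩ <;> rcases abs_cases (t - 1) with ⟨e', _⟩ | ⟨e', _⟩ <;>
    rcases abs_cases (2 * t - 1) with ⟨e'', _⟩ | ⟨e'', _⟩ <;>
    rcases max_cases |t - 1| |t| with ⟨m, _⟩ | ⟨m, _⟩ <;> linarith

theorem max_abs_one (t : ℝ) : 2 * max |t| 1 - |t - 1| = |-t - 1| := by
  rcases abs_cases t with ⟨e, _⟩ | ⟨e, _⟩ <;> rcases abs_cases (t - 1) with ⟨e', _⟩ | ⟨e', _⟩ <;>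
    rcases abs_cases (-t - 1) with ⟨e'', _⟩ | ⟨e'', _⟩ <;>
    rcases max_cases |t| 1 with ⟨m, _⟩ | ⟨m, _⟩ <;> linarith

/-- The reflections of the ideal boundary are the projectivized tropical Vieta involutions. -/
theorem exists_smul_rayVec (i : Fin 3) (t : OnePoint ℝ) : ∃ s : ℝ, 0 < s ∧
    s * rayVec (triReflection i • t) i =
      2 * max (rayVec t (i + 1)) (rayVec t (i + 2)) - rayVec t i ∧
    s * rayVec (triReflection i • t) (i + 1) = rayVec t (i + 1) ∧
    s * rayVec (triReflection i • t) (i + 2) = rayVec t (i + 2) := by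
  induction t using OnePoint.rec with
  | infty =>
    fin_cases i
    · refine ⟨1, one_pos, ?_⟩
      change 1 * rayVec (triReflection 0 • OnePoint.infty) 0 = 2 * max (0 : ℝ) 1 - 1 ∧
        1 * rayVec (triReflection 0 • OnePoint.infty) 1 = 0 ∧
        1 * rayVec (triReflection 0 • OnePoint.infty) 2 = 1
      rw [triReflection_zero_smul_infty]
      change 1 * (1 : ℝ) = _ ∧ 1 * (0 : ℝ) = _ ∧ 1 * (1 : ℝ) = _
      norm_num
    · refine ⟨2, two_pos, ?_⟩
      change 2 * rayVec (triReflection 1 • OnePoint.infty) 1 = 2 * max (1 : ℝ) 1 - 0 ∧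
        2 * rayVec (triReflection 1 • OnePoint.infty) 2 = 1 ∧
        2 * rayVec (triReflection 1 • OnePoint.infty) 0 = 1
      rw [triReflection_one_smul_infty, rayVec_coe]
      change 2 * (1 : ℝ) = _ ∧ 2 * |(1 / 2 : ℝ) - 1| = 1 ∧ 2 * |(1 / 2 : ℝ)| = 1
      rw [abs_of_neg (by norm_num : (1 / 2 : ℝ) - 1 < 0),
        abs_of_pos (by norm_num : (0 : ℝ) < 1 / 2)]
      norm_num
    · refine ⟨1, one_pos, ?_⟩
      change 1 * rayVec (triReflection 2 • OnePoint.infty) 2 = 2 * max (1 : ℝ) 0 - 1 ∧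
        1 * rayVec (triReflection 2 • OnePoint.infty) 0 = 1 ∧
        1 * rayVec (triReflection 2 • OnePoint.infty) 1 = 0
      rw [triReflection_two_smul_infty]
      change 1 * (1 : ℝ) = _ ∧ 1 * (1 : ℝ) = _ ∧ 1 * (0 : ℝ) = _
      norm_num
  | coe t =>
    fin_cases i
    · refine ⟨1, one_pos, ?_⟩
      change 1 * rayVec (triReflection 0 • (t : OnePoint ℝ)) 0 = 2 * max 1 |t - 1| - |t| ∧
        1 * rayVec (triReflection 0 • (t : OnePoint ℝ)) 1 = 1 ∧
        1 * rayVec (triReflection 0 • (t : OnePoint ℝ)) 2 = |t - 1|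
      rw [triReflection_zero_smul_coe, rayVec_coe, max_abs_sub_one]
      refine ⟨one_mul _, one_mul _, ?_⟩
      change 1 * |2 - t - 1| = |t - 1|
      rw [one_mul, ← abs_neg]
      ring_nf
    · change ∃ s : ℝ, 0 < s ∧
        s * rayVec (triReflection 1 • (t : OnePoint ℝ)) 1 = 2 * max |t - 1| |t| - 1 ∧
        s * rayVec (triReflection 1 • (t : OnePoint ℝ)) 2 = |t - 1| ∧
        s * rayVec (triReflection 1 • (t : OnePoint ℝ)) 0 = |t|
      rw [triReflection_one_smul_coe, max_abs_abs_sub_one]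
      -- The second reflection changes the middle coordinate 1 to |2t - 1|, which is the scale. At t
      -- = 1/2 the image is ∞, with vector (1, 0, 1), and the scale is 1/2.
      split_ifs with h
      · have ht : t = 1 / 2 := by linarith
        refine ⟨1 / 2, by norm_num, ?_⟩
        change 1 / 2 * (0 : ℝ) = _ ∧ 1 / 2 * (1 : ℝ) = _ ∧ 1 / 2 * (1 : ℝ) = _
        rw [h, ht, abs_of_neg (by norm_num : (1 / 2 : ℝ) - 1 < 0),
          abs_of_pos (by norm_num : (0 : ℝ) < 1 / 2)]
        norm_num
      · refine ⟨|2 * t - 1|, abs_pos.2 h, ?_⟩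
        change |2 * t - 1| * 1 = _ ∧ |2 * t - 1| * |t / (2 * t - 1) - 1| = _ ∧
          |2 * t - 1| * |t / (2 * t - 1)| = _
        rw [← abs_mul, ← abs_mul, mul_sub, mul_div_cancel₀ _ h]
        refine ⟨mul_one _, ?_, rfl⟩
        rw [← abs_neg]
        ring_nf
    · refine ⟨1, one_pos, ?_⟩
      change 1 * rayVec (triReflection 2 • (t : OnePoint ℝ)) 2 = 2 * max |t| 1 - |t - 1| ∧
        1 * rayVec (triReflection 2 • (t : OnePoint ℝ)) 0 = |t| ∧
        1 * rayVec (triReflection 2 • (t : OnePoint ℝ)) 1 = 1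
      rw [triReflection_two_smul_coe, rayVec_coe, max_abs_one]
      exact ⟨one_mul _, (one_mul _).trans (abs_neg t), one_mul _⟩

theorem flipMax_zero {u : Fin 3 → ℝ} (hu : ∀ i, 0 ≤ u i) (i : Fin 3) :
    flipMax 0 0 i u = 2 * max (u (i + 1)) (u (i + 2)) := by
  have h1 := hu (i + 1)
  have h2 := hu (i + 2)
  unfold flipMax soloMax
  rw [Pi.zero_apply, Pi.zero_apply, zero_add, zero_add,
    max_eq_left (by linarith : u (i + 1) ≤ 2 * u (i + 1)),
    max_eq_left (by linarith : u (i + 2) ≤ 2 * u (i + 2)), mul_max_of_nonneg _ _ two_pos.le]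
  exact max_eq_right (le_max_of_le_left (by linarith))

end Rays

/-! ### The radial projection as the ideal boundary. -/

section Boundary

variable {a b c d : WithTop ℝ}

/-- The point of the punctured skeleton with prescribed nonnegative coordinates. -/
def puncturedOf (hp : linVal a b c = 0) (hD : negVal d = 0) {u : Fin 3 → ℝ}
    (hu : IsSkPoint 0 0 u) (hu0 : u ≠ 0) : PuncturedSk a b c d :=
  ⟨⟨-u, mem_Sk_iff_neg.2 (by rwa [hp, hD])⟩, neg_ne_zero.2 hu0⟩

/-- The point of the radial projection which corresponds to a point of the ideal boundary. -/
def boundaryRay (hp : linVal a b c = 0) (hD : negVal d = 0) (t : OnePoint ℝ) : Radial a b c d :=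
  Quotient.mk _ (puncturedOf hp hD (isSkPoint_rayVec t) (rayVec_ne_zero t))

theorem boundaryRay_eq (hp : linVal a b c = 0) (hD : negVal d = 0) {t : OnePoint ℝ}
    {x : PuncturedSk a b c d} {s : ℝ} (hs : 0 < s) (h : -x.1.1 = s • rayVec t) :
    boundaryRay hp hD t = Quotient.mk _ x :=
  Quotient.sound ⟨s, hs, by rw [← neg_neg x.1.1, h, ← smul_neg]; rfl⟩

/-- On the real line the representative is continuous. Near ∞ it is rescaled by 1 / (1 + |t|) and
then tends to (1, 0, 1). -/
theorem continuous_boundaryRay (hp : linVal a b c = 0) (hD : negVal d = 0) :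
    Continuous (boundaryRay (a := a) (b := b) (c := c) hp hD) := by
  have hq : Continuous (Quotient.mk (radialSetoid a b c d)) := continuous_quotient_mk'
  have hnd : ∀ s t : ℝ, 0 < s → IsSkPoint 0 0 (s • rayVec t) ∧ s • rayVec t ≠ 0 := by
    intro s t hs
    refine ⟨?_, smul_ne_zero hs.ne' (rayVec_ne_zero t)⟩
    obtain ⟨h, h'⟩ := isSkPoint_zero_iff.1 (isSkPoint_rayVec t)
    refine isSkPoint_zero_iff.2 ⟨fun i => mul_nonneg hs.le (h i), ?_⟩
    simp only [Pi.smul_apply, smul_eq_mul, ← mul_add]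
    exact h'.imp (congrArg _) (Or.imp (congrArg _) (congrArg _))
  have hray : Continuous fun t : ℝ => rayVec t := by
    refine continuous_pi fun i => ?_
    fin_cases i
    · exact continuous_abs
    · exact continuous_const
    · exact (continuous_id.sub continuous_const).abs
  rw [OnePoint.continuous_iff]
  constructor
  · have hpos : ∀ t : ℝ, 0 < (1 + |t|)⁻¹ := fun t => by positivity
    have heq : (fun t : ℝ => boundaryRay hp hD (t : OnePoint ℝ)) = fun t : ℝ =>
        Quotient.mk (radialSetoid a b c d) (puncturedOf hp hD (hnd (1 + |t|)⁻¹ t (hpos t)).1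
          (hnd (1 + |t|)⁻¹ t (hpos t)).2) := by
      ext t
      exact boundaryRay_eq hp hD (hpos t) (neg_neg _)
    rw [heq]
    refine (hq.tendsto _).comp ?_
    rw [tendsto_subtype_rng, tendsto_subtype_rng, Filter.coclosedCompact_eq_cocompact]
    refine Filter.Tendsto.neg ?_
    have hw : Filter.Tendsto (fun t : ℝ => (1 + |t|)⁻¹) (Filter.cocompact ℝ) (𝓝 0) :=
      tendsto_inv_atTop_zero.comp
        (Filter.tendsto_atTop_add_const_left _ _ (tendsto_norm_cocompact_atTop (E := ℝ)))
    rw [tendsto_pi_nhds]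
    have h0 : Filter.Tendsto (fun t : ℝ => (1 + |t|)⁻¹ * |t|) (Filter.cocompact ℝ) (𝓝 1) := by
      have : (fun t : ℝ => (1 + |t|)⁻¹ * |t|) = fun t => 1 - (1 + |t|)⁻¹ := by
        ext t
        have : 1 + |t| ≠ 0 := by positivity
        field_simp
        ring
      rw [this]
      simpa using hw.const_sub 1
    intro i
    fin_cases i
    · exact h0
    · change Filter.Tendsto (fun t : ℝ => (1 + |t|)⁻¹ * 1) _ (𝓝 0)
      simpa using hw
    · change Filter.Tendsto (fun t : ℝ => (1 + |t|)⁻¹ * |t - 1|) _ (𝓝 1)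
      have h1 : Filter.Tendsto (fun t : ℝ => (1 + |t|)⁻¹ * (|t - 1| - |t|)) (Filter.cocompact ℝ)
          (𝓝 0) := by
        refine squeeze_zero_norm (fun t => ?_) hw
        rw [norm_mul, Real.norm_of_nonneg (hpos t).le, Real.norm_eq_abs]
        have := abs_abs_sub_abs_le_abs_sub (t - 1) t
        rw [show |t - 1 - t| = 1 by rw [show t - 1 - t = -1 by ring]; simp] at this
        exact mul_le_of_le_one_right (hpos t).le this
      have := h1.add h0
      rw [zero_add] at this
      refine this.congr fun t => ?_
      ring
  · exact hq.comp (((hray.neg).subtype_mk _).subtype_mk _)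

theorem bijective_boundaryRay (hp : linVal a b c = 0) (hD : negVal d = 0) :
    Function.Bijective (boundaryRay (a := a) (b := b) (c := c) hp hD) := by
  constructor
  · intro t t' h
    obtain ⟨s, hs, h⟩ := Quotient.exact h
    change -rayVec t' = s • -rayVec t at h
    rw [smul_neg, neg_inj] at h
    exact eq_of_rayVec_eq_smul h hs
  · intro x
    induction x using Quotient.inductionOn with | _ x
    have hu := isSkPoint_neg x.1
    rw [hp, hD] at hu
    obtain ⟨t, s, hs, h⟩ := exists_eq_smul_rayVec hu (neg_ne_zero.2 x.2)
    exact ⟨t, boundaryRay_eq hp hD hs h⟩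

theorem sum_neg_of_punctured (x : PuncturedSk a b c d) : x.1.1 0 + x.1.1 1 + x.1.1 2 < 0 := by
  by_contra! hcon
  have h := sk_nonpos x.1.2
  have h0 := h 0
  have h1 := h 1
  have h2 := h 2
  apply x.2
  ext i
  fin_cases i
  · change x.1.1 0 = 0; linarith
  · change x.1.1 1 = 0; linarith
  · change x.1.1 2 = 0; linarith

/-- Normalization of a nonzero point of the skeleton. -/
def radialNormalize : Radial a b c d → Fin 3 → ℝ :=
  Quotient.lift (fun x => (x.1.1 0 + x.1.1 1 + x.1.1 2)⁻¹ • x.1.1) (by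
    rintro x y ⟨t, ht, h⟩
    have hx := (sum_neg_of_punctured x).ne
    simp only [h, Pi.smul_apply, smul_eq_mul, ← mul_add, smul_smul]
    congr 1
    field_simp)

/-- Dividing by the coordinate sum, which is negative off the origin, maps the quotient injectively
and continuously to ℝ³. -/
instance : T2Space (Radial a b c d) := by
  refine T2Space.of_injective_continuous (f := radialNormalize) ?_ ?_
  · intro x y h
    induction x using Quotient.inductionOn with | _ x
    induction y using Quotient.inductionOn with | _ y
    have hx := sum_neg_of_punctured x
    have hy := sum_neg_of_punctured y
    change (x.1.1 0 + x.1.1 1 + x.1.1 2)⁻¹ • x.1.1 = (y.1.1 0 + y.1.1 1 + y.1.1 2)⁻¹ • y.1.1 at h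
    refine Quotient.sound ⟨(y.1.1 0 + y.1.1 1 + y.1.1 2) * (x.1.1 0 + x.1.1 1 + x.1.1 2)⁻¹,
      mul_pos_of_neg_of_neg hy (inv_lt_zero.2 hx), ?_⟩
    rw [mul_smul, h, smul_inv_smul₀ hy.ne]
  · refine Continuous.quotient_lift ?_ _
    have hv : Continuous fun x : PuncturedSk a b c d => x.1.1 :=
      continuous_subtype_val.comp continuous_subtype_val
    have h := fun i : Fin 3 => (continuous_apply i).comp hv
    exact ((((h 0).add (h 1)).add (h 2)).inv₀ fun x => (sum_neg_of_punctured x).ne).smul hv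

theorem vietaRadial_boundaryRay (hp : linVal a b c = 0) (hD : negVal d = 0) (i : Fin 3)
    (t : OnePoint ℝ) : vietaRadial hp hD (vietaGen a b c d i) (boundaryRay hp hD t) =
      boundaryRay hp hD (triReflection i • t) := by
  obtain ⟨s, hs, h0, h1, h2⟩ := exists_smul_rayVec i t
  symm
  refine boundaryRay_eq hp hD hs ?_
  set x : Sk a b c d := (puncturedOf hp hD (isSkPoint_rayVec t) (rayVec_ne_zero t)).1
  have hx : -x.1 = rayVec t := neg_neg _
  change -(skVieta a b c d i x).1 = _
  ext j
  rw [Pi.neg_apply, Pi.smul_apply, smul_eq_mul]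
  by_cases hj : j = i
  · subst hj
    rw [neg_skVieta_self, hp, hD, hx, flipMax_zero (isSkPoint_rayVec t).nonneg, h0, ← hx]
    rfl
  · rw [skVieta_of_ne hj]
    change (-x.1) j = _
    rw [hx]
    rcases eq_add_one_or_eq_add_two hj with rfl | rfl
    · exact h1.symm
    · exact h2.symm

/-- The radial projection of the skeleton is the ideal boundary of the hyperbolic plane. -/
theorem exists_radial_homeomorph (hp : linVal a b c = 0) (hD : negVal d = 0)
    (f : vietaGroup a b c d ≃* triangleGroup) (hf : ∀ i, f (vietaGen a b c d i) = triGen i) :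
    ∃ Φ : Radial a b c d ≃ₜ OnePoint ℝ, ∀ (g : vietaGroup a b c d) (p : Radial a b c d),
      Φ (radialHom hp hD g p) = (f g).1 • Φ p := by
  -- A continuous bijection from a compact space to a Hausdorff space is a homeomorphism.
  let Ψ : OnePoint ℝ ≃ₜ Radial a b c d := Continuous.homeoOfEquivCompactToT2
    (f := Equiv.ofBijective _ (bijective_boundaryRay hp hD)) (continuous_boundaryRay hp hD)
  have hΨ : ∀ (g : vietaGroup a b c d) (t : OnePoint ℝ),
      vietaRadial hp hD g (Ψ t) = Ψ ((f g).1 • t) := by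
    intro g
    induction g using vietaGroup_induction with
    | one =>
      intro t
      rw [vietaRadial_one, map_one]
      exact congrArg Ψ (one_smul (GL (Fin 2) ℝ) t).symm
    | mul i g ih =>
      intro t
      rw [vietaRadial_mul, ih, map_mul, hf]
      exact (vietaRadial_boundaryRay hp hD i _).trans
        (congrArg Ψ (mul_smul (triReflection i) (f g).1 t).symm)
  refine ⟨Ψ.symm, fun g p => ?_⟩
  obtain ⟨t, rfl⟩ := Ψ.surjective p
  change Ψ.symm (vietaRadial hp hD g (Ψ t)) = _
  rw [hΨ, Ψ.symm_apply_apply, Ψ.symm_apply_apply]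

end Boundary

end

theorem theoremA (a b c d : WithTop ℝ) :
    -- `Γ` is the free product of the groups of order two generated by `s₁, s₂, s₃`
    (∃ e : FreeInvolutionGroup ≃* vietaGroup a b c d,
      ∀ i, e (PresentedGroup.of i) = vietaGen a b c d i) ∧
    -- the isomorphism `Γ ≅ ⟨r₁, r₂, r₃⟩`
    ∃ f : vietaGroup a b c d ≃* triangleGroup,
      (∀ i, f (vietaGen a b c d i) = triGen i) ∧
      -- (a) meromorphic parameters
      (min a (min b (min c d)) < 0 →
        (∃! D : Fin 3 → Set (Sk a b c d), IsVietaDomains a b c d D) ∧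
        ∀ D : Fin 3 → Set (Sk a b c d), IsVietaDomains a b c d D →
          IsPingPong (skVieta a b c d) D ∧
          (interior (pingPongTable D)).Nonempty ∧
          IsOpen (vietaOrbit a b c d (pingPongTable D)) ∧
          Dense (vietaOrbit a b c d (pingPongTable D)) ∧
          (∃ 𝓡 : Set (Set (Fin 3 → ℝ)), 𝓡.Countable ∧ (∀ R ∈ 𝓡, IsRay R) ∧
            Subtype.val '' (vietaOrbit a b c d (pingPongTable D))ᶜ = ⋃₀ 𝓡) ∧
          ∃ h : vietaOrbit a b c d (pingPongTable D) ≃ₜ ℍ,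
            ∀ (g : vietaGroup a b c d) (x : vietaOrbit a b c d (pingPongTable D)),
              ∃ hx : g.1 x.1 ∈ vietaOrbit a b c d (pingPongTable D),
                h ⟨g.1 x.1, hx⟩ = (f g).1 • h x) ∧
      -- (b) holomorphic parameters
      (0 ≤ min a (min b (min c d)) →
        (∃ θ : vietaGroup a b c d ≃* vietaGroup ⊤ ⊤ ⊤ ⊤,
          (∀ i, θ (vietaGen a b c d i) = vietaGen ⊤ ⊤ ⊤ ⊤ i) ∧
          ∃ φ : Sk a b c d ≃ₜ Sk ⊤ ⊤ ⊤ ⊤,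
            ∀ (g : vietaGroup a b c d) (x : Sk a b c d), φ (g.1 x) = (θ g).1 (φ x)) ∧
        ∃ ρ : vietaGroup a b c d →* (Radial a b c d ≃ₜ Radial a b c d),
          (∀ (g : vietaGroup a b c d) (x : PuncturedSk a b c d),
            ∃ hx : (g.1 x.1 : Fin 3 → ℝ) ≠ 0,
              ρ g (Quotient.mk _ x) = Quotient.mk _ ⟨g.1 x.1, hx⟩) ∧
          ∃ Φ : Radial a b c d ≃ₜ OnePoint ℝ,
            ∀ (g : vietaGroup a b c d) (p : Radial a b c d), Φ (ρ g p) = (f g).1 • Φ p) := by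
  obtain ⟨e, he⟩ := (skAction a b c d).exists_freeInvolution_equiv exists_skWall_pos
  obtain ⟨e₀, he₀⟩ := triAction.exists_freeInvolution_equiv exists_triWall_pos
  -- Both groups are the same presented group, so the isomorphism passes through it and matches
  -- generators.
  have hf : ∀ i, (e.symm.trans e₀) (vietaGen a b c d i) = triGen i := fun i => by
    rw [← he, MulEquiv.trans_apply, e.symm_apply_apply, he₀]
  refine ⟨⟨e, he⟩, e.symm.trans e₀, hf, fun hneg => ?_, fun hpos => ⟨?_, ?_⟩⟩
  · have hne := exists_pos_of_min_neg hneg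
    refine ⟨⟨skHalf a b c d, isVietaDomains_skHalf a b c d, fun D hD => hD.eq_skHalf⟩, ?_⟩
    intro D hD
    rw [hD.eq_skHalf, pingPongTable_skHalf, vietaOrbit_eq]
    exact ⟨isPingPong_skHalf a b c d, nonempty_interior_table hne,
      (skAction a b c d).isOpen_translates, dense_skDomain hne, exists_rays hne,
      exists_skDomain_homeomorph hne _ hf⟩
  · obtain ⟨e₁, he₁⟩ := (skAction ⊤ ⊤ ⊤ ⊤).exists_freeInvolution_equiv exists_skWall_pos
    have hθ : ∀ i, (e.symm.trans e₁) (vietaGen a b c d i) = vietaGen ⊤ ⊤ ⊤ ⊤ i := fun i => by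
      rw [← he, MulEquiv.trans_apply, e.symm_apply_apply, he₁]
    have htop : (0 : WithTop ℝ) ≤ min ⊤ (min ⊤ (min ⊤ ⊤)) := by simp
    exact ⟨e.symm.trans e₁, hθ, exists_sk_homeomorph
      ((linVal_eq_zero hpos).trans (linVal_eq_zero htop).symm)
      ((negVal_eq_zero hpos).trans (negVal_eq_zero htop).symm) _ hθ⟩
  · have hp := linVal_eq_zero hpos
    have hD := negVal_eq_zero hpos
    exact ⟨radialHom hp hD, fun g x => ⟨vieta_ne_zero hp hD g x.2, rfl⟩,
      exists_radial_homeomorph hp hD _ hf⟩
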